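/- Let $X$ be a real Banach space and let $A\colon X\supset D(A)\to X$ be a sectorial operator with compact resolvents; thus $A$ is closed and densely defined, and there are $a\in\mathbb R$, $\varphi\in(0,\pi/2)$ and $M$ such that every $z\in\mathbb C\setminus\{a\}$ with $\varphi\le|\arg(z-a)|$ belongs to the resolvent set of (the complexification of) $A$ and $\|(z-A)^{-1}\|\le M/|z-a|$. Let $\{S_A(t)\}_{t\ge 0}$ be the $C_0$ semigroup generated by $-A$. Let $\delta\in\mathbb R$ be such that $A_\delta:=A+\delta I$ is positively defined, i.e. $\operatorname{Re} z>0$ for all $z$ in the spectrum of $A_\delta$. Let $\alpha\in(0,1)$, and let $X^\alpha:=D(A_\delta^\alpha)$ with the norm $\|x\|_\alpha:=\|A_\delta^\alpha x\|$, where $A_\delta^\alpha$ is the inverse of the injective operator $A_\delta^{-\alpha}:=\frac1{\Gamma(\alpha)}\int_0^\infty t^{\alpha-1}S_{A_\delta}(t)\,dt$. Let $\lambda\in\mathbb R$ and let $F\colon[0,1]\times[0,+\infty)\times X^\alpha\to X$ be a continuous map such that: (F1) every $x\in X^\alpha$ has a neighborhood $V\subset X^\alpha$ and a constant $L>0$ such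 that $\|F(s,t,x_1)-F(s,t,x_2)\|\le L\|x_1-x_2\|_\alpha$ for all $s\in[0,1]$, $t\ge0$ and $x_1,x_2\in V$; (F2) there is a continuous function $c\colon[0,+\infty)\to[0,+\infty)$ such that $\|F(s,t,x)\|\le c(t)(1+\|x\|_\alpha)$ for all $s\in[0,1]$, $t\ge0$ and $x\in X^\alpha$. A mild solution on $[0,+\infty)$ of $$\dot u(t)=-Au(t)+\lambda u(t)+F(s,t,u(t)),\qquad t>0,$$ is a continuous map $u\colon[0,+\infty)\to X^\alpha$ such that, for all $0\le t'<t$, $$u(t)=e^{\lambda(t-t')}S_A(t-t')u(t')+\int_{t'}^t e^{\lambda(t-\tau)}S_A(t-\tau)F(s,\tau,u(\tau))\,d\tau .$$ Then for every $s\in[0,1]$ and $x\in X^\alpha$ there is a unique mild solution $u(\,\cdot\,;s,x)$ on $[0,+\infty)$ with $u(0;s,x)=x$. Moreover, for every $t>0$: (i) for every bounded set $\Omega\subset X^\alpha$, the set $\{u(t;s,x)\mid s\in[0,1],\ x\in\Omega\}$ is relatively compact in $X^\alpha$; (ii) the translation operator $\Phi_t\colon[0,1]\times X^\alpha\to X^\alpha$,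 $\Phi_t(s,x):=u(t;s,x)$, is completely continuous, i.e. it is continuous and maps bounded sets onto relatively compact sets. -/

import Mathlib

open Set Filter Topology MeasureTheory

noncomputable section

namespace SemilinearEvolution

section Operators

variable {X : Type*} [NormedAddCommGroup X] [NormedSpace ℝ X]

/-- Multiplication by the complex number `z` on the complexification `X × X` of the real space
`X`, where the pair `(x, y)` stands for `x + i y`. -/
def complexMul (z : ℂ) (v : X × X) : X × X :=
  (z.re • v.1 - z.im • v.2, z.im • v.1 + z.re • v.2)

/-- The complexification `x + i y ↦ A x + i A y` of the operator `A`, with domain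
`D(A) × D(A)`. -/
def complexification (A : X →ₗ.[ℝ] X) : (X × X) →ₗ.[ℝ] (X × X) where
  domain := A.domain.prod A.domain
  toFun :=
    { toFun := fun v => (A ⟨v.1.1, v.2.1⟩, A ⟨v.1.2, v.2.2⟩)
      map_add' := fun v w => Prod.ext
        (A.map_add ⟨v.1.1, v.2.1⟩ ⟨w.1.1, w.2.1⟩) (A.map_add ⟨v.1.2, v.2.2⟩ ⟨w.1.2, w.2.2⟩)
      map_smul' := fun c v => Prod.ext
        (A.map_smul c ⟨v.1.1, v.2.1⟩) (A.map_smul c ⟨v.1.2, v.2.2⟩) }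

/-- `R` is the resolvent of `A` at `z`: the operator `z - A_ℂ` is a bijection of `D(A_ℂ)` onto
`X × X`, and the bounded operator `R` is its inverse. (The product norm of `X × X` is equivalent
to every norm that turns `X × X` into a complexification of the Banach space `X`.) -/
def IsResolvent (A : X →ₗ.[ℝ] X) (z : ℂ) (R : (X × X) →L[ℝ] (X × X)) : Prop :=
  ∀ v w : X × X, R w = v ↔
    ∃ hv : v ∈ (complexification A).domain, complexMul z v - complexification A ⟨v, hv⟩ = w

/-- The complex spectrum of `A`. -/
def complexSpectrum (A : X →ₗ.[ℝ] X) : Set ℂ :=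
  {z | ¬ ∃ R : (X × X) →L[ℝ] (X × X), IsResolvent A z R}

/-- `A` is sectorial: closed, densely defined, and there are a vertex `a`, an angle
`φ ∈ (0, π / 2)` and a constant `M` such that the set of all `z ≠ a` with
`φ ≤ |arg (z - a)|` lies in the resolvent set and `‖(z - A)⁻¹‖ ≤ M / |z - a|` there. -/
def IsSectorial (A : X →ₗ.[ℝ] X) : Prop :=
  A.IsClosed ∧ Dense (A.domain : Set X) ∧
    ∃ a φ M : ℝ, 0 < φ ∧ φ < Real.pi / 2 ∧
      ∀ z : ℂ, z ≠ (a : ℂ) → φ ≤ |Complex.arg (z - a)| →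
        ∃ R : (X × X) →L[ℝ] (X × X), IsResolvent A z R ∧ ‖R‖ ≤ M / ‖z - a‖

/-- All resolvents of `A` are compact operators. -/
def HasCompactResolvents (A : X →ₗ.[ℝ] X) : Prop :=
  ∀ (z : ℂ) (R : (X × X) →L[ℝ] (X × X)), IsResolvent A z R → IsCompactOperator R

/-- The operator `A + δ I`, with the domain of `A`. -/
def shift (A : X →ₗ.[ℝ] X) (δ : ℝ) : X →ₗ.[ℝ] X where
  domain := A.domain
  toFun := A.toFun + δ • A.domain.subtype

/-- `A` is positively defined: `Re z > 0` for every `z` in the spectrum of `A`. -/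
def IsPositivelyDefined (A : X →ₗ.[ℝ] X) : Prop :=
  ∀ z ∈ complexSpectrum A, 0 < z.re

/-- `(S t)_{t ≥ 0}` is a `C₀` semigroup of bounded operators (values at `t < 0` are ignored). -/
structure IsC0Semigroup (S : ℝ → X →L[ℝ] X) : Prop where
  zero : S 0 = ContinuousLinearMap.id ℝ X
  add : ∀ s t : ℝ, 0 ≤ s → 0 ≤ t → S (s + t) = (S s).comp (S t)
  tendsto : ∀ x : X, Tendsto (fun t => S t x) (𝓝[>] 0) (𝓝 x)

/-- `B` is the infinitesimal generator of `S`: `x ∈ D(B)` and `B x = y` if and only if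
`(S t x - x) / t` tends to `y` as `t → 0+`. -/
def IsGenerator (S : ℝ → X →L[ℝ] X) (B : X →ₗ.[ℝ] X) : Prop :=
  ∀ x y : X, (x, y) ∈ B.graph ↔ Tendsto (fun t : ℝ => t⁻¹ • (S t x - x)) (𝓝[>] 0) (𝓝 y)

open Classical in
/-- The `C₀` semigroup `S_A` generated by `-A` (on `[0, ∞)` there is at most one). -/
def semigroup (A : X →ₗ.[ℝ] X) : ℝ → X →L[ℝ] X :=
  if h : ∃ S : ℝ → X →L[ℝ] X, IsC0Semigroup S ∧ IsGenerator S (-A) then h.choose else 0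

/-- The negative fractional power
`B ^ (-α) = Γ(α)⁻¹ ∫_0^∞ t ^ (α - 1) S_B(t) dt` of a positively defined sectorial operator. -/
def fracNegPow (B : X →ₗ.[ℝ] X) (α : ℝ) : X →L[ℝ] X :=
  (Real.Gamma α)⁻¹ • ∫ t in Ioi (0 : ℝ), (t ^ (α - 1)) • semigroup B t

/-- The fractional power `B ^ α`: the inverse of the (injective) operator `B ^ (-α)`, with domain
the range of `B ^ (-α)`. -/
def fracPow (B : X →ₗ.[ℝ] X) (α : ℝ) : X →ₗ.[ℝ] X :=
  ((fracNegPow B α : X →ₗ[ℝ] X).toPMap ⊤).inverse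

/-- The fractional power space `D(B ^ α)`, with the norm `‖x‖_α = ‖B ^ α x‖`. -/
def FracSpace (B : X →ₗ.[ℝ] X) (α : ℝ) : Type _ := (fracPow B α).domain

namespace FracSpace

variable (B : X →ₗ.[ℝ] X) (α : ℝ)

instance : AddCommGroup (FracSpace B α) :=
  inferInstanceAs (AddCommGroup (fracPow B α).domain)

instance : Module ℝ (FracSpace B α) :=
  inferInstanceAs (Module ℝ (fracPow B α).domain)

variable {B α}

/-- The inclusion of `D(B ^ α)` into `X`. -/
def toX : FracSpace B α →ₗ[ℝ] X := (fracPow B α).domain.subtype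

/-- The map `x ↦ B ^ α x` on `D(B ^ α)`. -/
def pow : FracSpace B α →ₗ[ℝ] X := (fracPow B α).toFun

instance : SeminormedAddCommGroup (FracSpace B α) :=
  SeminormedAddCommGroup.induced (FracSpace B α) X (pow (B := B) (α := α))

theorem norm_def (x : FracSpace B α) : ‖x‖ = ‖pow x‖ := rfl

instance : NormedSpace ℝ (FracSpace B α) :=
  NormedSpace.induced ℝ (FracSpace B α) X (pow (B := B) (α := α))

end FracSpace

end Operators

section Equation

variable {X : Type*} [NormedAddCommGroup X] [NormedSpace ℝ X] {α δ : ℝ}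

/-- On the interval `J`, the map `u` with values in `X^α = D((A + δ I) ^ α)` is a mild solution of
`u'(t) = - A u(t) + lam u(t) + F (s, t, u(t))`; here `e ^ (lam t) S_A(t)` is the semigroup
generated by `-A + lam I`. -/
def IsMildSolution (A : X →ₗ.[ℝ] X) (lam : ℝ) (F : ℝ → ℝ → FracSpace (shift A δ) α → X) (s : ℝ)
    (J : Set ℝ) (u : ℝ → FracSpace (shift A δ) α) : Prop :=
  ContinuousOn u J ∧ ∀ t ∈ J, ∀ t' ∈ J, t' < t →
    (u t).toX = Real.exp (lam * (t - t')) • semigroup A (t - t') (u t').toX +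
      ∫ τ in t'..t, Real.exp (lam * (t - τ)) • semigroup A (t - τ) (F s τ (u τ))

/-- Local Lipschitz condition in the space variable, uniform in the parameter and in time. -/
def LocallyLipschitzInSpace (A : X →ₗ.[ℝ] X) (F : ℝ → ℝ → FracSpace (shift A δ) α → X) : Prop :=
  ∀ x : FracSpace (shift A δ) α, ∃ V ∈ 𝓝 x, ∃ L : ℝ, 0 < L ∧
    ∀ s ∈ Icc (0 : ℝ) 1, ∀ x₁ ∈ V, ∀ x₂ ∈ V, ∀ t : ℝ, 0 ≤ t →
      ‖F s t x₁ - F s t x₂‖ ≤ L * ‖x₁ - x₂‖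

/-- Linear growth in the space variable. -/
def HasLinearGrowth (A : X →ₗ.[ℝ] X) (F : ℝ → ℝ → FracSpace (shift A δ) α → X) : Prop :=
  ∃ c : ℝ → ℝ, ContinuousOn c (Ici 0) ∧ (∀ t, 0 ≤ t → 0 ≤ c t) ∧
    ∀ s ∈ Icc (0 : ℝ) 1, ∀ t : ℝ, 0 ≤ t → ∀ x : FracSpace (shift A δ) α,
      ‖F s t x‖ ≤ c t * (1 + ‖x‖)

open Classical in
/-- The mild solution `u(·; s, x)` on `[0, ∞)` starting at `x` (zero if there is none). -/
def mildSolution (A : X →ₗ.[ℝ] X) (lam : ℝ) (F : ℝ → ℝ → FracSpace (shift A δ) α → X) (s : ℝ)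
    (x : FracSpace (shift A δ) α) : ℝ → FracSpace (shift A δ) α :=
  if h : ∃ u, IsMildSolution A lam F s (Ici 0) u ∧ u 0 = x then h.choose else 0

/-- The translation along trajectories operator `Φ_t (s, x) = u(t; s, x)` on `[0, 1] × X^α`. -/
def translationOperator (A : X →ₗ.[ℝ] X) (lam : ℝ) (F : ℝ → ℝ → FracSpace (shift A δ) α → X)
    (t : ℝ) (p : unitInterval × FracSpace (shift A δ) α) : FracSpace (shift A δ) α :=
  mildSolution A lam F p.1 p.2 t

end Equation

/-- A completely continuous map: it is continuous and maps bounded sets onto relatively compact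
sets. -/
def IsCompletelyContinuous {Y Z : Type*} [PseudoMetricSpace Y] [TopologicalSpace Z]
    (Φ : Y → Z) : Prop :=
  Continuous Φ ∧ ∀ Ω : Set Y, Bornology.IsBounded Ω → IsCompact (closure (Φ '' Ω))

end SemilinearEvolution

end

/-!
The problem lives in the fractional power space `X^α`, but `B ^ α`, with `B = A + δ I`, is an
isometry of `X^α` onto `X`. In terms of `v = B ^ α u` a mild solution is a solution of the Volterra
equation `v t = T t (v 0) + ∫₀ᵗ K (t - r) g (r, v r) dr` in `X`, where `T t = e ^ (lam t) S_A(t)`,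
`K t = B ^ α T t`, and `g` is the nonlinearity read through the isometry
(`IsSmoothingPair.mild_iff`, `isMildSolution_iff`). The proof has two independent halves.

*Linear half.* On the left half plane the resolvent of `L = B - ω I`, for a small `ω > 0`, is
bounded by `M / ‖z‖` (`exists_hasHalfPlaneBound`). Such an operator generates a bounded holomorphic
semigroup (`HasHalfPlaneBound.exists_isHolomorphicSemigroup`). The Dunford integral used here runs
along the vertical line `Re w = -1` and contains the square of the resolvent of `t L`, so that it converges
absolutely and no contour has to be deformed; its normalising constant is computed by Fourier
inversion (`integral_cexp_div_sq`). The construction takes place in the real Banach algebra of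
operators on the complexification `X × X` and is compressed to `X` at the end. Since the semigroup
factors through the resolvent of `L`, it is compact. The kernel is
`K t = -e ^ ((lam + δ) t) B ^ (-(1 - α)) b'(t)` with `b t = e ^ (-t B)`; the Beta integral gives
`B ^ (-α) B ^ (-(1 - α)) = ∫ b`, hence `B ^ (-α) K t = T t`, and `‖b'(t)‖ ≤ C / t` gives the bound
`‖K t‖ ≤ C t ^ (-α)` (`IsHolomorphicSemigroup.negPow_mul_fracKernel`,
`IsHolomorphicSemigroup.exists_norm_fracKernel_le`). All that the second half needs is collected in
`IsSmoothingPair`, and provided by `exists_isSmoothingPair`.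

*Nonlinear half.* A Gronwall inequality for the kernel `t ^ (-α)`
(`IsSmoothingPair.exists_gronwall_const`) bounds solutions by their initial values, because the
nonlinearity grows linearly, and bounds the distance of two solutions as long as one of them stays
in a tube around the compact trajectory of the other in which the nonlinearity is uniformly
Lipschitz. This yields uniqueness and continuity in the parameter and the initial value
(`IsSmoothingPair.solution_unique`, `IsSmoothingPair.continuous_solution`). Existence is a
contraction argument on short intervals (`IsSmoothingPair.exists_local_solution`) followed by
continuation, which the a priori bound keeps from breaking down
(`IsSmoothingPair.exists_global_solution`). Compactness comes from
`v t = T ε (v (t - ε)) + O(ε ^ (1 - α))`: bounded sets of initial values give bounded sets of values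
`v (t - ε)`, and `T ε` is compact (`IsSmoothingPair.isCompact_closure_values`).
-/

noncomputable section

namespace SemilinearEvolution

/-! ### The normalising constant of the Dunford integral -/

theorem integrableOn_mul_exp_neg : IntegrableOn (fun x : ℝ => x * Real.exp (-x)) (Ioi 0) := by
  have := integrableOn_rpow_mul_exp_neg_mul_rpow (s := 1) (p := 1) (b := 1) (by norm_num) one_pos
    one_pos
  simpa using this

/-- The Laplace transform of `x ↦ x` on the line `Re p = 1`. -/
theorem integral_Ioi_mul_cexp {p : ℂ} (hp : p.re = 1) :
    ∫ x in Ioi (0 : ℝ), (x : ℂ) * Complex.exp (-p * x) = 1 / p ^ 2 := by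
  have hp0 : p ≠ 0 := by rintro rfl; simp at hp
  have hnorm : ∀ x : ℝ, ‖Complex.exp (-p * x)‖ = Real.exp (-x) := fun x => by
    rw [Complex.norm_exp]; simp [hp]
  have hd : ∀ x ∈ Ioi (0 : ℝ), HasDerivAt
      (fun x : ℝ => -((x : ℂ) / p + 1 / p ^ 2) * Complex.exp (-p * x))
      ((x : ℂ) * Complex.exp (-p * x)) x := by
    intro x _
    have h1 : HasDerivAt (fun x : ℝ => (x : ℂ)) 1 x := Complex.ofRealCLM.hasDerivAt
    have h2 := (((h1.div_const p).add_const (1 / p ^ 2)).neg).mul ((h1.const_mul (-p)).cexp)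
    refine h2.congr_deriv ?_
    simp only [Pi.neg_apply]
    field_simp
    ring
  have hint : IntegrableOn (fun x : ℝ => (x : ℂ) * Complex.exp (-p * x)) (Ioi 0) := by
    refine integrableOn_mul_exp_neg.mono' (by fun_prop) ?_
    refine (ae_restrict_iff' measurableSet_Ioi).2 (Eventually.of_forall fun x hx => ?_)
    rw [norm_mul, hnorm, Complex.norm_real, Real.norm_of_nonneg (le_of_lt hx)]
  have hlim : Tendsto (fun x : ℝ => -((x : ℂ) / p + 1 / p ^ 2) * Complex.exp (-p * x)) atTop
      (𝓝 0) := by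
    rw [tendsto_zero_iff_norm_tendsto_zero]
    have h0 : Tendsto (fun x : ℝ => ‖p‖⁻¹ * (x * Real.exp (-x)) + ‖1 / p ^ 2‖ * Real.exp (-x)) atTop
        (𝓝 0) := by
      have ha := (Real.tendsto_pow_mul_exp_neg_atTop_nhds_zero 1).const_mul ‖p‖⁻¹
      have hb := (Real.tendsto_exp_neg_atTop_nhds_zero).const_mul ‖1 / p ^ 2‖
      simpa using ha.add hb
    refine squeeze_zero' (Eventually.of_forall fun _ => norm_nonneg _) ?_ h0
    filter_upwards [eventually_ge_atTop 0] with x hx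
    rw [norm_mul, hnorm, norm_neg]
    calc _ ≤ (‖(x : ℂ) / p‖ + ‖1 / p ^ 2‖) * Real.exp (-x) := by gcongr; exact norm_add_le _ _
      _ = _ := by rw [norm_div, Complex.norm_real, Real.norm_of_nonneg hx]; ring
  rw [integral_Ioi_of_hasDerivAt_of_tendsto (by fun_prop) hd hint hlim]
  simp

/-- The normalising constant of the Dunford integral along the line `Re w = -1`, obtained by
Fourier inversion of `x ↦ max x 0 * exp (-x)`. -/
theorem integral_cexp_div_sq :
    ∫ y : ℝ, Complex.exp (1 - y * Complex.I) / (-1 + y * Complex.I) ^ 2 =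
      ((2 * Real.pi : ℝ) : ℂ) := by
  set f : ℝ → ℂ := fun x => ((max x 0 * Real.exp (-x) : ℝ) : ℂ) with hf
  have hfc : Continuous f := by fun_prop
  have hf0 : ∀ x ∉ Ioi (0 : ℝ), f x = 0 := fun x hx => by
    simp [hf, max_eq_right (notMem_Ioi.1 hx)]
  have hfi : Integrable f := by
    have : IntegrableOn f (Ioi 0) := by
      refine IntegrableOn.congr_fun (integrableOn_mul_exp_neg.ofReal (𝕜 := ℂ)) (fun x hx => ?_)
        measurableSet_Ioi
      simp [hf, max_eq_left (le_of_lt (mem_Ioi.1 hx))]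
    rw [← integrableOn_univ]
    exact this.of_forall_sdiff_eq_zero MeasurableSet.univ (fun x hx => hf0 x hx.2)
  have hF : FourierTransform.fourier f =
      fun ξ : ℝ => 1 / (1 + (2 * Real.pi * ξ : ℝ) * Complex.I) ^ 2 := by
    funext ξ
    rw [Real.fourier_real_eq_integral_exp_smul, ← integral_Ioi_mul_cexp (by simp),
      ← setIntegral_eq_integral_of_forall_compl_eq_zero (s := Ioi 0)
        (fun x hx => by rw [hf0 x hx, smul_zero])]
    refine setIntegral_congr_fun measurableSet_Ioi fun x hx => ?_
    simp only [hf, max_eq_left (le_of_lt (mem_Ioi.1 hx)), smul_eq_mul]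
    push_cast
    rw [mul_left_comm, ← Complex.exp_add]
    congr 2
    ring
  have hn : ∀ y : ℝ, ‖(1 : ℂ) / (1 + (y : ℝ) * Complex.I) ^ 2‖ = (1 + y ^ 2)⁻¹ := fun y => by
    rw [norm_div, norm_pow, ← Complex.normSq_eq_norm_sq, Complex.normSq_apply]
    simp; ring
  have hFi : Integrable (FourierTransform.fourier f) := by
    rw [hF]
    have h1 : Integrable (fun ξ : ℝ => (1 + (2 * Real.pi * ξ) ^ 2)⁻¹) :=
      integrable_inv_one_add_sq.comp_mul_left' (by positivity)
    have hne : ∀ y : ℝ, (1 + ((2 * Real.pi * y : ℝ) : ℂ) * Complex.I) ^ 2 ≠ 0 := fun y => by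
      refine pow_ne_zero 2 fun h => ?_
      simpa using congrArg Complex.re h
    refine h1.mono' (Continuous.aestronglyMeasurable ?_) (Eventually.of_forall fun ξ => (hn _).le)
    exact continuous_const.div (by fun_prop) hne
  have key := congrFun (hfc.fourierInv_fourier_eq hfi hFi) (1 : ℝ)
  rw [Real.fourierInv_eq', hF] at key
  have h2 := Measure.integral_comp_mul_left (fun y : ℝ => Complex.exp (1 - y * Complex.I) /
    (-1 + y * Complex.I) ^ 2) (-(2 * Real.pi))
  have h3 : ∀ v : ℝ, Complex.exp (1 - ((-(2 * Real.pi) * v : ℝ) : ℂ) * Complex.I) /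
      (-1 + ((-(2 * Real.pi) * v : ℝ) : ℂ) * Complex.I) ^ 2 = Complex.exp 1 *
      (Complex.exp ((2 * Real.pi * inner ℝ v (1 : ℝ) : ℝ) * Complex.I) •
        (1 / (1 + ((2 * Real.pi * v : ℝ) : ℂ) * Complex.I) ^ 2)) := fun v => by
    rw [smul_eq_mul, mul_one_div, mul_div_assoc', ← Complex.exp_add]
    congr 1
    · congr 1
      simp
    · push_cast
      ring
  simp only [h3] at h2
  rw [integral_const_mul, key] at h2
  have h4 : Complex.exp 1 * f 1 = 1 := by
    simp [hf, ← Complex.exp_add]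
  rw [h4, abs_inv, abs_neg, abs_of_pos (by positivity), eq_inv_smul_iff₀ (by positivity)] at h2
  rw [← h2]
  simp

/-! ### Resolvent families on a half plane -/

section ResolventFamily

variable {E : Type*} [NormedRing E] [NormedAlgebra ℝ E]

/-- An abstract resolvent `z ↦ R z` on the open left half plane, with values in a real Banach
algebra `E` on which the complex numbers act through the algebra homomorphism `J`, and with the
decay `‖R z‖ ≤ M / ‖z‖` that characterises bounded holomorphic semigroups. -/
structure IsResolventFamily (J : ℂ →ₐ[ℝ] E) (κ M : ℝ) (R : ℂ → E) : Prop where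
  norm_map : ∀ z, ‖J z‖ ≤ κ * ‖z‖
  norm_le : ∀ z : ℂ, z.re < 0 → ‖R z‖ ≤ M / ‖z‖
  sub_eq : ∀ z z' : ℂ, z.re < 0 → z'.re < 0 → R z - R z' = J (z' - z) * (R z * R z')
  comm : ∀ z z' : ℂ, z.re < 0 → z'.re < 0 → R z * R z' = R z' * R z
  map_comm : ∀ w z : ℂ, z.re < 0 → J w * R z = R z * J w

/-- The upward parametrisation of the line `Re w = -1`. -/
def dunfordLine (y : ℝ) : ℂ := -1 + y * Complex.I

/-- The scaled resolvent `Q = (w - t C)⁻¹ = t⁻¹ R(t⁻¹ w)` at the point `w` of the line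
`Re w = -1`, where `C` is the operator with the resolvent `R z = (z - C)⁻¹`. -/
def scaledRes (R : ℂ → E) (t y : ℝ) : E := t⁻¹ • R (t⁻¹ • dunfordLine y)

/-- The bounded operator `G = C (w - t C)⁻¹`. -/
def scaledGen (J : ℂ →ₐ[ℝ] E) (R : ℂ → E) (t y : ℝ) : E :=
  t⁻¹ • (J (dunfordLine y) * scaledRes R t y - 1)

theorem norm_dunfordLine_sq (y : ℝ) : ‖dunfordLine y‖ ^ 2 = 1 + y ^ 2 := by
  rw [← Complex.normSq_eq_norm_sq, Complex.normSq_apply]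
  simp [dunfordLine]; ring

theorem one_le_norm_dunfordLine (y : ℝ) : 1 ≤ ‖dunfordLine y‖ := by
  have := norm_dunfordLine_sq y
  nlinarith [norm_nonneg (dunfordLine y), sq_nonneg y]

theorem dunfordLine_ne_zero (y : ℝ) : dunfordLine y ≠ 0 := by
  rw [← norm_pos_iff]; linarith [one_le_norm_dunfordLine y]

theorem re_smul_dunfordLine {t : ℝ} (ht : 0 < t) (y : ℝ) : (t⁻¹ • dunfordLine y).re < 0 := by
  simp [dunfordLine, ht]

theorem continuous_dunfordLine : Continuous dunfordLine := by
  unfold dunfordLine; fun_prop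

theorem hasDerivAt_dunfordLine (y : ℝ) : HasDerivAt dunfordLine Complex.I y := by
  have h1 : HasDerivAt (fun x : ℝ => (x : ℂ)) 1 y := Complex.ofRealCLM.hasDerivAt
  refine ((h1.mul_const Complex.I).const_add (-1)).congr_deriv (one_mul _)

theorem norm_cexp_dunfordLine (y : ℝ) : ‖Complex.exp (-dunfordLine y)‖ = Real.exp 1 := by
  rw [Complex.norm_exp]; simp [dunfordLine]

namespace IsResolventFamily

variable {J : ℂ →ₐ[ℝ] E} {κ M : ℝ} {R : ℂ → E}

theorem kappa_nonneg (h : IsResolventFamily J κ M R) : 0 ≤ κ := by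
  simpa using (norm_nonneg _).trans (h.norm_map 1)

theorem bound_nonneg (h : IsResolventFamily J κ M R) : 0 ≤ M := by
  simpa using (norm_nonneg _).trans (h.norm_le (-1) (by simp))

theorem continuous_map (h : IsResolventFamily J κ M R) : Continuous J :=
  (J.toLinearMap.mkContinuous κ h.norm_map).continuous

theorem continuousAt (h : IsResolventFamily J κ M R) {z : ℂ} (hz : z.re < 0) :
    ContinuousAt R z := by
  have hz0 : z ≠ 0 := by rintro rfl; simp at hz
  have hev : ∀ᶠ z' in 𝓝 z, z'.re < 0 :=
    Complex.continuous_re.continuousAt.eventually_lt continuousAt_const hz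
  rw [ContinuousAt, tendsto_iff_norm_sub_tendsto_zero]
  have hb : Tendsto (fun z' : ℂ => κ * ‖z - z'‖ * (M / ‖z'‖ * (M / ‖z‖))) (𝓝 z) (𝓝 0) := by
    have : ContinuousAt (fun z' : ℂ => κ * ‖z - z'‖ * (M / ‖z'‖ * (M / ‖z‖))) z := by
      have : ‖z‖ ≠ 0 := norm_ne_zero_iff.2 hz0
      fun_prop (disch := assumption)
    simpa [ContinuousAt] using this
  refine squeeze_zero' (Eventually.of_forall fun _ => norm_nonneg _) ?_ hb
  filter_upwards [hev] with z' hz'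
  rw [h.sub_eq _ _ hz' hz]
  refine (norm_mul_le _ _).trans (mul_le_mul (h.norm_map _) ((norm_mul_le _ _).trans ?_)
    (norm_nonneg _) (mul_nonneg h.kappa_nonneg (norm_nonneg _)))
  exact mul_le_mul (h.norm_le _ hz') (h.norm_le _ hz) (norm_nonneg _)
    (div_nonneg h.bound_nonneg (norm_nonneg _))

/-- Chain rule for the resolvent, `R' = - R ^ 2`, along a real curve. -/
theorem hasDerivAt_comp (h : IsResolventFamily J κ M R) {γ : ℝ → ℂ} {γ' : ℂ} {x : ℝ}
    (hγ : HasDerivAt γ γ' x) (hx : (γ x).re < 0) :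
    HasDerivAt (fun y => R (γ y)) (-(J γ' * (R (γ x) * R (γ x)))) x := by
  have hev : ∀ᶠ y in 𝓝 x, (γ y).re < 0 :=
    (Complex.continuous_re.continuousAt.comp hγ.continuousAt).eventually_lt continuousAt_const hx
  have hc : Tendsto (fun y => R (γ y)) (𝓝[≠] x) (𝓝 (R (γ x))) :=
    ((h.continuousAt hx).comp hγ.continuousAt).tendsto.mono_left nhdsWithin_le_nhds
  have hs := hasDerivAt_iff_tendsto_slope.1 hγ
  rw [hasDerivAt_iff_tendsto_slope, ← neg_mul, ← map_neg]
  have hJ : Tendsto (fun y => J (-slope γ x y)) (𝓝[≠] x) (𝓝 (J (-γ'))) :=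
    (h.continuous_map.tendsto _).comp hs.neg
  refine (hJ.mul (hc.mul_const (R (γ x)))).congr' ?_
  filter_upwards [hev.filter_mono nhdsWithin_le_nhds] with y hy
  rw [slope_def_module, slope_def_module, h.sub_eq _ _ hy hx, ← smul_neg, map_smul, neg_sub,
    smul_mul_assoc]

section Scaled

variable (h : IsResolventFamily J κ M R) {t : ℝ} (ht : 0 < t) (y : ℝ)
include h ht

theorem norm_scaledRes_le : ‖scaledRes R t y‖ ≤ M * ‖dunfordLine y‖⁻¹ := by
  have := h.norm_le _ (re_smul_dunfordLine ht y)
  rw [norm_smul, norm_inv, Real.norm_of_nonneg ht.le] at this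
  rw [scaledRes, norm_smul, norm_inv, Real.norm_of_nonneg ht.le]
  calc _ ≤ t⁻¹ * (M / (t⁻¹ * ‖dunfordLine y‖)) := by gcongr
    _ = _ := by field_simp

theorem norm_scaledRes_mul_le :
    ‖scaledRes R t y * scaledRes R t y‖ ≤ M ^ 2 * (1 + y ^ 2)⁻¹ := by
  have h1 := h.norm_scaledRes_le ht y
  calc _ ≤ (M * ‖dunfordLine y‖⁻¹) * (M * ‖dunfordLine y‖⁻¹) :=
        (norm_mul_le _ _).trans (mul_le_mul h1 h1 (norm_nonneg _) ((norm_nonneg _).trans h1))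
    _ = _ := by rw [← norm_dunfordLine_sq]; ring

theorem norm_scaledRes_le' : ‖scaledRes R t y‖ ≤ M := by
  refine (h.norm_scaledRes_le ht y).trans (mul_le_of_le_one_right h.bound_nonneg ?_)
  exact inv_le_one_of_one_le₀ (one_le_norm_dunfordLine y)

theorem norm_scaledGen_le : ‖scaledGen J R t y‖ ≤ (κ * M + ‖(1 : E)‖) / t := by
  rw [scaledGen, norm_smul, norm_inv, Real.norm_of_nonneg ht.le, div_eq_inv_mul]
  have h1 : ‖J (dunfordLine y) * scaledRes R t y‖ ≤ κ * M := by
    refine (norm_mul_le _ _).trans ((mul_le_mul (h.norm_map _) (h.norm_scaledRes_le ht y)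
      (norm_nonneg _) (mul_nonneg h.kappa_nonneg (norm_nonneg _))).trans_eq ?_)
    have := (norm_pos_iff.2 (dunfordLine_ne_zero y)).ne'
    field_simp
  gcongr
  exact (norm_sub_le _ _).trans (by gcongr)

theorem map_mul_scaledRes (w : ℂ) : J w * scaledRes R t y = scaledRes R t y * J w := by
  rw [scaledRes, mul_smul_comm, smul_mul_assoc, h.map_comm _ _ (re_smul_dunfordLine ht y)]

theorem scaledGen_mul_scaledRes :
    scaledGen J R t y * scaledRes R t y = scaledRes R t y * scaledGen J R t y := by
  rw [scaledGen, smul_mul_assoc, mul_smul_comm, sub_mul, mul_sub, one_mul, mul_one, ← mul_assoc,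
    h.map_mul_scaledRes ht]

theorem hasDerivAt_scaledRes_left :
    HasDerivAt (fun t => scaledRes R t y) (scaledGen J R t y * scaledRes R t y) t := by
  have h1 : HasDerivAt (fun t : ℝ => t⁻¹) (-(t ^ 2)⁻¹) t := hasDerivAt_inv ht.ne'
  have h2 := h.hasDerivAt_comp (h1.smul_const (dunfordLine y)) (re_smul_dunfordLine ht y)
  refine (h1.smul h2).congr_deriv ?_
  simp only [scaledGen, scaledRes, map_smul, smul_mul_assoc, mul_smul_comm, sub_mul, one_mul,
    mul_assoc, neg_smul, map_neg, neg_mul, neg_neg, smul_sub, smul_smul]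
  rw [sub_eq_add_neg]
  congr 2 <;> congr 1 <;> field_simp

theorem hasDerivAt_scaledRes_right :
    HasDerivAt (fun y => scaledRes R t y)
      (-(J Complex.I * (scaledRes R t y * scaledRes R t y))) y := by
  have h2 := h.hasDerivAt_comp ((hasDerivAt_dunfordLine y).const_smul t⁻¹)
    (re_smul_dunfordLine ht y)
  refine (h2.const_smul t⁻¹).congr_deriv ?_
  simp only [scaledRes, map_smul, smul_mul_assoc, mul_smul_comm, smul_neg, Pi.smul_apply]

omit y in
theorem continuous_scaledRes : Continuous (fun y => scaledRes R t y) :=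
  continuous_iff_continuousAt.2 fun y => (h.hasDerivAt_scaledRes_right ht y).continuousAt

omit y in
theorem continuous_scaledGen : Continuous (fun y => scaledGen J R t y) := by
  unfold scaledGen
  exact continuous_const.smul (((h.continuous_map.comp continuous_dunfordLine).mul
    (h.continuous_scaledRes ht)).sub continuous_const)

/-- The relation `Q = r (- Q - G)` expresses that `(-1 - C) Q = - Q - G`, where `r = R (-1)`. -/
theorem scaledRes_eq :
    scaledRes R t y = R (-1) * (-scaledRes R t y - scaledGen J R t y) := by
  have hz := re_smul_dunfordLine ht y
  have h1 := h.sub_eq (-1) _ (by simp) hz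
  have h2 : R (t⁻¹ • dunfordLine y) = R (-1) - J (t⁻¹ • dunfordLine y - -1) *
      (R (-1) * R (t⁻¹ • dunfordLine y)) := by rw [← h1]; abel
  have h3 : -scaledRes R t y - scaledGen J R t y =
      t⁻¹ • (1 - J (t⁻¹ • dunfordLine y - -1) * R (t⁻¹ • dunfordLine y)) := by
    simp only [scaledGen, scaledRes, sub_neg_eq_add, map_add, map_smul, map_one, smul_mul_assoc,
      mul_smul_comm, smul_sub, one_mul, add_mul, smul_add]
    abel
  rw [h3, mul_smul_comm, mul_sub, mul_one, ← mul_assoc, ← h.map_comm _ _ (by simp), mul_assoc,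
    ← h2, scaledRes]

end Scaled

end IsResolventFamily

end ResolventFamily

/-! ### The Dunford integral -/

section DunfordIntegral

variable {E : Type*} [NormedRing E] [NormedAlgebra ℝ E]

/-- The weighted Dunford integral `(2 π)⁻¹ ∫ e ^ (-w) F (w - t C)⁻² dy` along the line
`w = -1 + i y`; for `F = 1` it is the semigroup `e ^ (-t C)`. -/
def dunford (J : ℂ →ₐ[ℝ] E) (R : ℂ → E) (t : ℝ) (F : ℝ → E) : E :=
  (2 * Real.pi)⁻¹ • ∫ y : ℝ, J (Complex.exp (-dunfordLine y)) *
    (F y * (scaledRes R t y * scaledRes R t y))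

namespace IsResolventFamily

variable {J : ℂ →ₐ[ℝ] E} {κ M : ℝ} {R : ℂ → E}

theorem continuous_map_cexp (h : IsResolventFamily J κ M R) :
    Continuous fun y => J (Complex.exp (-dunfordLine y)) :=
  h.continuous_map.comp (Complex.continuous_exp.comp continuous_dunfordLine.neg)

theorem norm_map_cexp_le (h : IsResolventFamily J κ M R) (y : ℝ) :
    ‖J (Complex.exp (-dunfordLine y))‖ ≤ κ * Real.exp 1 := by
  simpa [norm_cexp_dunfordLine] using h.norm_map (Complex.exp (-dunfordLine y))

section

variable (h : IsResolventFamily J κ M R) {t : ℝ} (ht : 0 < t) {F : ℝ → E} {B : ℝ}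
include h ht

theorem norm_dunford_integrand_le (hB : ∀ y, ‖F y‖ ≤ B) (y : ℝ) :
    ‖J (Complex.exp (-dunfordLine y)) * (F y * (scaledRes R t y * scaledRes R t y))‖ ≤
      κ * Real.exp 1 * (B * M ^ 2) * (1 + y ^ 2)⁻¹ := by
  have h1 := h.norm_scaledRes_mul_le ht y
  have h0 : 0 ≤ B := (norm_nonneg _).trans (hB y)
  have hk := h.kappa_nonneg
  calc _ ≤ (κ * Real.exp 1) * (B * (M ^ 2 * (1 + y ^ 2)⁻¹)) := by
        refine (norm_mul_le _ _).trans (mul_le_mul (h.norm_map_cexp_le y)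
          ((norm_mul_le _ _).trans (mul_le_mul (hB y) h1 (norm_nonneg _) h0))
          (norm_nonneg _) (by positivity))
    _ = _ := by ring

theorem continuous_dunford_integrand (hF : Continuous F) :
    Continuous fun y => J (Complex.exp (-dunfordLine y)) *
      (F y * (scaledRes R t y * scaledRes R t y)) :=
  h.continuous_map_cexp.mul
    (hF.mul ((h.continuous_scaledRes ht).mul (h.continuous_scaledRes ht)))

theorem integrable_dunford (hF : Continuous F) (hB : ∀ y, ‖F y‖ ≤ B) :
    Integrable fun y => J (Complex.exp (-dunfordLine y)) *
      (F y * (scaledRes R t y * scaledRes R t y)) :=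
  (integrable_inv_one_add_sq.const_mul (κ * Real.exp 1 * (B * M ^ 2))).mono'
    (h.continuous_dunford_integrand ht hF).aestronglyMeasurable
    (Eventually.of_forall (h.norm_dunford_integrand_le ht hB))

theorem norm_dunford_le (hB : ∀ y, ‖F y‖ ≤ B) :
    ‖dunford J R t F‖ ≤ κ * Real.exp 1 * M ^ 2 / 2 * B := by
  have h1 := norm_integral_le_of_norm_le
    (integrable_inv_one_add_sq.const_mul (κ * Real.exp 1 * (B * M ^ 2)))
    (Eventually.of_forall (h.norm_dunford_integrand_le ht hB))
  rw [integral_const_mul, integral_univ_inv_one_add_sq] at h1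
  rw [dunford, norm_smul, Real.norm_of_nonneg (by positivity)]
  calc _ ≤ (2 * Real.pi)⁻¹ * (κ * Real.exp 1 * (B * M ^ 2) * Real.pi) := by gcongr
    _ = _ := by field_simp

theorem dunford_add {F₁ F₂ : ℝ → E} (hF₁ : Continuous F₁) (hF₂ : Continuous F₂) {B₁ B₂ : ℝ}
    (hB₁ : ∀ y, ‖F₁ y‖ ≤ B₁) (hB₂ : ∀ y, ‖F₂ y‖ ≤ B₂) :
    dunford J R t (fun y => F₁ y + F₂ y) = dunford J R t F₁ + dunford J R t F₂ := by
  simp only [dunford, add_mul, mul_add]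
  rw [integral_add (h.integrable_dunford ht hF₁ hB₁) (h.integrable_dunford ht hF₂ hB₂), smul_add]

theorem mul_dunford (hF : Continuous F) (hB : ∀ y, ‖F y‖ ≤ B) :
    dunford J R t (fun y => R (-1) * F y) = R (-1) * dunford J R t F := by
  rw [dunford, dunford, mul_smul_comm,
    ← integral_const_mul_of_integrable (h.integrable_dunford ht hF hB)]
  congr 2
  funext y
  rw [← mul_assoc (R (-1)), ← h.map_comm _ _ (by simp)]
  simp only [mul_assoc]

theorem commute_dunford_one :
    R (-1) * dunford J R t (fun _ => 1) = dunford J R t (fun _ => 1) * R (-1) := by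
  have hi := h.integrable_dunford ht (F := fun _ => 1) continuous_const (fun _ => le_rfl)
  rw [dunford, mul_smul_comm, smul_mul_assoc, ← integral_const_mul_of_integrable hi,
    ← integral_mul_const_of_integrable hi]
  congr 2
  funext y
  have hc : R (-1) * scaledRes R t y = scaledRes R t y * R (-1) := by
    rw [scaledRes, mul_smul_comm, smul_mul_assoc,
      h.comm _ _ (by simp) (re_smul_dunfordLine ht y)]
  rw [← mul_assoc, ← h.map_comm _ _ (by simp), one_mul, mul_assoc, mul_assoc, ← mul_assoc (R (-1)),
    hc, mul_assoc, hc, mul_assoc]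

/-- Integration by parts along the line `Re w = -1`. -/
theorem dunford_one_eq :
    dunford J R t (fun _ => 1) = -(2 : ℝ) • dunford J R t (fun y => scaledRes R t y) := by
  have hQ := h.continuous_scaledRes ht
  have hi1 := h.integrable_dunford ht (F := fun _ => 1) continuous_const (fun _ => le_rfl)
  have hi2 := h.integrable_dunford ht hQ (h.norm_scaledRes_le' ht)
  have hd : ∀ y : ℝ, HasDerivAt (fun y => J (Complex.exp (-dunfordLine y)) *
      (1 * (scaledRes R t y * scaledRes R t y)))
      (J (-Complex.I) * (J (Complex.exp (-dunfordLine y)) *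
        (1 * (scaledRes R t y * scaledRes R t y)) + (2 : ℝ) • (J (Complex.exp (-dunfordLine y)) *
        (scaledRes R t y * (scaledRes R t y * scaledRes R t y))))) y := by
    intro y
    have he : HasDerivAt (fun y => J (Complex.exp (-dunfordLine y)))
        (J (-Complex.I) * J (Complex.exp (-dunfordLine y))) y := by
      have := (J.toLinearMap.mkContinuous κ h.norm_map).hasFDerivAt.comp_hasDerivAt y
        (hasDerivAt_dunfordLine y).neg.cexp
      refine this.congr_deriv ?_
      rw [← map_mul, mul_comm]
      rfl
    have hq := h.hasDerivAt_scaledRes_right ht y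
    refine (he.mul ((hq.mul hq).const_mul 1)).congr_deriv ?_
    have hI : ∀ x : E, scaledRes R t y * (J Complex.I * x) = J Complex.I * (scaledRes R t y * x) :=
      fun x => by rw [← mul_assoc, ← h.map_mul_scaledRes ht, mul_assoc]
    have hIe : ∀ x : E, J (Complex.exp (-dunfordLine y)) * (J Complex.I * x) =
        J Complex.I * (J (Complex.exp (-dunfordLine y)) * x) := fun x => by
      rw [← mul_assoc, ← mul_assoc, ← map_mul, ← map_mul, mul_comm]
    simp only [one_mul, map_neg, neg_mul, mul_neg, mul_add, hI, hIe, mul_assoc, two_smul,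
      Pi.mul_apply]
  have hi3 : Integrable fun y => (2 : ℝ) • (J (Complex.exp (-dunfordLine y)) *
      (scaledRes R t y * (scaledRes R t y * scaledRes R t y))) := hi2.smul (2 : ℝ)
  have hi4 : Integrable fun y => J (Complex.exp (-dunfordLine y)) *
      (1 * (scaledRes R t y * scaledRes R t y)) + (2 : ℝ) • (J (Complex.exp (-dunfordLine y)) *
      (scaledRes R t y * (scaledRes R t y * scaledRes R t y))) := hi1.add hi3
  have h0 := integral_eq_zero_of_hasDerivAt_of_integrable hd (hi4.const_mul _) hi1
  rw [integral_const_mul_of_integrable hi4] at h0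
  have h1 := congrArg (J Complex.I * ·) h0
  simp only [mul_zero] at h1
  rw [← mul_assoc, ← map_mul, mul_neg, Complex.I_mul_I, neg_neg, map_one, one_mul,
    integral_add hi1 hi3, integral_smul] at h1
  rw [dunford, dunford, eq_neg_of_add_eq_zero_left h1, smul_comm, neg_smul]

/-- The derivative of `t ↦ e ^ (-t C)`. -/
theorem hasDerivAt_dunford_one :
    HasDerivAt (fun t => dunford J R t (fun _ => 1))
      ((2 : ℝ) • dunford J R t (fun y => scaledGen J R t y)) t := by
  set D := (κ * M + ‖(1 : E)‖) / (t / 2) with hD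
  have hs : Ioi (t / 2) ∈ 𝓝 t := Ioi_mem_nhds (by linarith)
  have hpos : ∀ x ∈ Ioi (t / 2), 0 < x := fun x hx => lt_trans (by linarith) (mem_Ioi.1 hx)
  have hkM : 0 ≤ κ * M + ‖(1 : E)‖ :=
    add_nonneg (mul_nonneg h.kappa_nonneg h.bound_nonneg) (norm_nonneg _)
  have hG : ∀ x ∈ Ioi (t / 2), ∀ y, ‖(2 : ℝ) • scaledGen J R x y‖ ≤ 2 * D := fun x hx y => by
    rw [norm_smul, Real.norm_of_nonneg zero_le_two]
    gcongr
    refine (h.norm_scaledGen_le (hpos x hx) y).trans ?_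
    exact div_le_div_of_nonneg_left hkM (by linarith) (le_of_lt hx)
  have key := hasDerivAt_integral_of_dominated_loc_of_deriv_le (μ := volume) (𝕜 := ℝ) (x₀ := t)
    (F := fun t y => J (Complex.exp (-dunfordLine y)) *
      (1 * (scaledRes R t y * scaledRes R t y)))
    (F' := fun t y => J (Complex.exp (-dunfordLine y)) *
      ((2 : ℝ) • scaledGen J R t y * (scaledRes R t y * scaledRes R t y)))
    (bound := fun y => κ * Real.exp 1 * (2 * D * M ^ 2) * (1 + y ^ 2)⁻¹)
    hs ?_ ?_ ?_ ?_ ?_ ?_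
  · refine (key.2.const_smul (2 * Real.pi)⁻¹).congr_deriv ?_
    rw [dunford, smul_comm (2 : ℝ), ← integral_smul (2 : ℝ)]
    simp only [smul_mul_assoc, mul_smul_comm]
  · filter_upwards [hs] with x hx
    exact (h.continuous_dunford_integrand (hpos x hx) continuous_const).aestronglyMeasurable
  · exact h.integrable_dunford ht continuous_const (fun _ => le_rfl)
  · exact (h.continuous_dunford_integrand ht
      ((h.continuous_scaledGen ht).const_smul _)).aestronglyMeasurable
  · exact Eventually.of_forall fun y x hx =>
      h.norm_dunford_integrand_le (hpos x hx) (hG x hx) y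
  · exact integrable_inv_one_add_sq.const_mul _
  · refine Eventually.of_forall fun y x hx => ?_
    have hq := h.hasDerivAt_scaledRes_left (hpos x hx) y
    refine (((hq.mul hq).const_mul 1).const_mul _).congr_deriv ?_
    have hc := h.scaledGen_mul_scaledRes (hpos x hx) y
    rw [one_mul, ← mul_assoc (scaledRes R x y), ← hc, two_smul, add_mul, mul_assoc]

/-- The relation `e ^ (-t C) = r ((e ^ (-t C))' - e ^ (-t C))` with `r = R (-1)`, which says that
`(-1 - C) e ^ (-t C) = (e ^ (-t C))' - e ^ (-t C)`. -/
theorem dunford_one_eq_mul :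
    dunford J R t (fun _ => 1) = R (-1) *
      ((2 : ℝ) • dunford J R t (fun y => scaledGen J R t y) - dunford J R t (fun _ => 1)) := by
  have hQ := h.continuous_scaledRes ht
  have hQb := h.norm_scaledRes_le' ht
  have hG := h.continuous_scaledGen ht
  have hGb := h.norm_scaledGen_le ht
  have h1 : dunford J R t (fun y => scaledRes R t y) =
      R (-1) * (-dunford J R t (fun y => scaledRes R t y) -
        dunford J R t (fun y => scaledGen J R t y)) := by
    have h2 : (fun y => scaledRes R t y) =
        fun y => R (-1) * (scaledRes R t y + scaledGen J R t y) * (-1) := by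
      funext y
      conv_lhs => rw [h.scaledRes_eq ht y]
      rw [mul_neg_one, ← mul_neg, neg_add, sub_eq_add_neg]
    have h3 := h.mul_dunford ht (F := fun y => scaledRes R t y + scaledGen J R t y) (hQ.add hG)
      (fun y => (norm_add_le _ _).trans (add_le_add (hQb y) (hGb y)))
    rw [h.dunford_add ht hQ hG hQb hGb] at h3
    calc _ = -dunford J R t (fun y => R (-1) * (scaledRes R t y + scaledGen J R t y)) := by
          rw [h2, dunford, dunford, ← smul_neg, ← integral_neg]
          simp
      _ = _ := by rw [h3, ← mul_neg, neg_add, sub_eq_add_neg]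
  conv_lhs => rw [h.dunford_one_eq ht, h1, ← mul_smul_comm]
  congr 1
  rw [h.dunford_one_eq ht, neg_smul, neg_smul, smul_sub, smul_neg]
  abel

variable [CompleteSpace E]

/-- On the range of `r = R (-1)` the function `t ↦ e ^ (-t C)` is Lipschitz continuous at `t = 0`:
there `Q = (w - t C)⁻¹` differs from `w⁻¹` by `O(t)`, and the Dunford integral with `w⁻²` in
place of `Q ^ 2` is the identity. -/
theorem norm_dunford_one_mul_sub_le :
    ‖dunford J R t (fun _ => 1) * R (-1) - R (-1)‖ ≤
      κ ^ 2 * Real.exp 1 * (M + M ^ 2) / 2 * ‖1 + R (-1)‖ * t := by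
  have hk := h.kappa_nonneg
  have hM := h.bound_nonneg
  set r := R (-1) with hr
  set u : ℝ → ℂ := fun y => (dunfordLine y)⁻¹ with hu
  have hu1 : ∀ y, ‖u y‖ ≤ 1 := fun y => by
    rw [hu, norm_inv]; exact inv_le_one_of_one_le₀ (one_le_norm_dunfordLine y)
  have hu2 : ∀ y, ‖u y * u y‖ = (1 + y ^ 2)⁻¹ := fun y => by
    rw [hu, norm_mul, norm_inv, ← norm_dunfordLine_sq, sq, mul_inv]
  have huc : Continuous u := continuous_dunfordLine.inv₀ dunfordLine_ne_zero
  have hi1 := h.integrable_dunford ht (F := fun _ => 1) continuous_const (fun _ => le_rfl)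
  have hic : Integrable fun y => Complex.exp (-dunfordLine y) * (u y * u y) := by
    refine (integrable_inv_one_add_sq.const_mul (Real.exp 1)).mono'
      (Continuous.aestronglyMeasurable ?_) (Eventually.of_forall fun y => ?_)
    · exact (Complex.continuous_exp.comp continuous_dunfordLine.neg).mul (huc.mul huc)
    · rw [norm_mul, hu2, norm_cexp_dunfordLine]
  -- The normalising constant produces the limit `r`.
  have hconst : r =
      (2 * Real.pi)⁻¹ • ∫ y : ℝ, J (Complex.exp (-dunfordLine y) * (u y * u y)) * r := by
    have h1 : ∫ y : ℝ, J (Complex.exp (-dunfordLine y) * (u y * u y)) =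
        (2 * Real.pi) • (1 : E) := by
      have h2 := (J.toLinearMap.mkContinuous κ h.norm_map).integral_comp_comm hic
      refine h2.trans ?_
      have h3 : ∫ y : ℝ, Complex.exp (-dunfordLine y) * (u y * u y) = ((2 * Real.pi : ℝ) : ℂ) := by
        rw [← integral_cexp_div_sq]
        congr 1
        funext y
        rw [hu, dunfordLine, div_eq_mul_inv, sq, mul_inv]
        congr 2
        ring
      rw [h3]
      change J _ = _
      rw [← Algebra.algebraMap_eq_smul_one]
      exact J.commutes _
    have h4 := integral_mul_const_of_integrable
      ((J.toLinearMap.mkContinuous κ h.norm_map).integrable_comp hic) (c := r)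
    refine Eq.trans ?_ (congrArg ((2 * Real.pi)⁻¹ • ·) h4).symm
    change r = (2 * Real.pi)⁻¹ •
      ((∫ y : ℝ, J (Complex.exp (-dunfordLine y) * (u y * u y))) * r)
    rw [h1, smul_mul_assoc, one_mul, smul_smul, inv_mul_cancel₀ (by positivity), one_smul]
  -- `Q r = w⁻¹ (r - t (1 + r) Q)`, because `w Q = 1 + t C Q` and `C r = -(1 + r)`.
  have hQr : ∀ y, scaledRes R t y * r = J (u y) * (r - t • ((1 + r) * scaledRes R t y)) := by
    intro y
    have hc : r * scaledRes R t y = scaledRes R t y * r := by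
      rw [scaledRes, mul_smul_comm, smul_mul_assoc,
        h.comm _ _ (by simp) (re_smul_dunfordLine ht y)]
    have h1 : J (dunfordLine y) * (scaledRes R t y * r) =
        r - t • ((1 + r) * scaledRes R t y) := by
      have h2 : J (dunfordLine y) * scaledRes R t y = 1 + t • scaledGen J R t y := by
        rw [scaledGen, smul_smul, mul_inv_cancel₀ ht.ne', one_smul, add_sub_cancel]
      have h3 : r * scaledGen J R t y = -((1 + r) * scaledRes R t y) := by
        have h4 := h.scaledRes_eq ht y
        rw [mul_sub, mul_neg, ← hr] at h4
        rw [add_mul, one_mul]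
        rw [eq_sub_iff_add_eq] at h4
        rw [eq_sub_of_add_eq' h4]
        abel
      have h5 : r * (1 + t • scaledGen J R t y) = (1 + t • scaledGen J R t y) * r := by
        rw [← h2, ← mul_assoc, ← h.map_comm _ _ (by simp), mul_assoc, hc, mul_assoc]
      rw [← mul_assoc, h2, ← h5, mul_add, mul_one, mul_smul_comm, h3, smul_neg, sub_eq_add_neg]
    rw [← h1, ← mul_assoc, ← map_mul, hu, inv_mul_cancel₀ (dunfordLine_ne_zero y), map_one, one_mul]
  -- Two applications of the preceding identity compare `Q ^ 2 r` with `w⁻² r`.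
  have hQQr : ∀ y, J (Complex.exp (-dunfordLine y)) *
      (1 * (scaledRes R t y * scaledRes R t y)) * r -
      J (Complex.exp (-dunfordLine y) * (u y * u y)) * r =
      -(t • (J (Complex.exp (-dunfordLine y)) * (J (u y * u y) * ((1 + r) * scaledRes R t y) +
        J (u y) * ((1 + r) * (scaledRes R t y * scaledRes R t y))))) := by
    intro y
    have hc : r * scaledRes R t y = scaledRes R t y * r := by
      rw [scaledRes, mul_smul_comm, smul_mul_assoc,
        h.comm _ _ (by simp) (re_smul_dunfordLine ht y)]
    have h1 : scaledRes R t y * scaledRes R t y * r = J (u y) * (J (u y) * (r - t • ((1 + r) *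
        scaledRes R t y)) - t • ((1 + r) * (scaledRes R t y * scaledRes R t y))) := by
      have hc' : scaledRes R t y * (1 + r) = (1 + r) * scaledRes R t y := by
        rw [mul_add, add_mul, hc, mul_one, one_mul]
      rw [mul_assoc, hQr, ← mul_assoc, ← h.map_mul_scaledRes ht, mul_assoc, mul_sub,
        mul_smul_comm, ← mul_assoc _ (1 + r), hc', mul_assoc (1 + r), hQr]
    rw [one_mul, mul_assoc, h1]
    simp only [map_mul, mul_sub, mul_add, mul_smul_comm, smul_add, mul_assoc]
    abel
  have hbd : ∀ y, ‖J (Complex.exp (-dunfordLine y)) *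
      (1 * (scaledRes R t y * scaledRes R t y)) * r -
      J (Complex.exp (-dunfordLine y) * (u y * u y)) * r‖ ≤
      κ ^ 2 * Real.exp 1 * (M + M ^ 2) * ‖1 + r‖ * t * (1 + y ^ 2)⁻¹ := by
    intro y
    have e1 : ‖J (u y * u y) * ((1 + r) * scaledRes R t y)‖ ≤
        κ * (1 + y ^ 2)⁻¹ * (‖1 + r‖ * M) := by
      refine (norm_mul_le _ _).trans (mul_le_mul ?_ ((norm_mul_le _ _).trans ?_) (norm_nonneg _)
        (by positivity))
      · simpa only [hu2] using h.norm_map (u y * u y)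
      · gcongr
        exact h.norm_scaledRes_le' ht y
    have e2 : ‖J (u y) * ((1 + r) * (scaledRes R t y * scaledRes R t y))‖ ≤
        κ * (‖1 + r‖ * (M ^ 2 * (1 + y ^ 2)⁻¹)) := by
      refine (norm_mul_le _ _).trans (mul_le_mul ?_ ((norm_mul_le _ _).trans ?_) (norm_nonneg _)
        hk)
      · exact (h.norm_map _).trans (mul_le_of_le_one_right hk (hu1 y))
      · gcongr
        exact h.norm_scaledRes_mul_le ht y
    rw [hQQr, norm_neg, norm_smul, Real.norm_of_nonneg ht.le]
    calc _ ≤ t * ((κ * Real.exp 1) * (κ * (1 + y ^ 2)⁻¹ * (‖1 + r‖ * M) +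
          κ * (‖1 + r‖ * (M ^ 2 * (1 + y ^ 2)⁻¹)))) := by
          gcongr
          exact (norm_mul_le _ _).trans (mul_le_mul (h.norm_map_cexp_le y)
            ((norm_add_le _ _).trans (add_le_add e1 e2)) (norm_nonneg _) (by positivity))
      _ = _ := by ring
  have hi2 : Integrable fun y => J (Complex.exp (-dunfordLine y) * (u y * u y)) * r :=
    ((J.toLinearMap.mkContinuous κ h.norm_map).integrable_comp hic).mul_const r
  have hfin := norm_integral_le_of_norm_le
    (integrable_inv_one_add_sq.const_mul (κ ^ 2 * Real.exp 1 * (M + M ^ 2) * ‖1 + r‖ * t))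
    (Eventually.of_forall hbd)
  rw [integral_const_mul, integral_univ_inv_one_add_sq, integral_sub (hi1.mul_const r) hi2,
    integral_mul_const_of_integrable hi1] at hfin
  calc _ = ‖(2 * Real.pi)⁻¹ • ((∫ y : ℝ, J (Complex.exp (-dunfordLine y)) *
      (1 * (scaledRes R t y * scaledRes R t y))) * r -
      ∫ y : ℝ, J (Complex.exp (-dunfordLine y) * (u y * u y)) * r)‖ := by
        rw [smul_sub, ← hconst, dunford, smul_mul_assoc]
    _ ≤ (2 * Real.pi)⁻¹ * (κ ^ 2 * Real.exp 1 * (M + M ^ 2) * ‖1 + r‖ * t * Real.pi) := by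
        rw [norm_smul, Real.norm_of_nonneg (by positivity)]
        gcongr
    _ = _ := by field_simp

end

end IsResolventFamily

end DunfordIntegral

/-! ### `C₀` semigroups and bounded holomorphic semigroups -/

section C0Semigroup

variable {X : Type*} [NormedAddCommGroup X] [NormedSpace ℝ X]

/-- Strong continuity together with local boundedness gives joint continuity. -/
theorem continuousOn_clm_apply_of_bounded {T : ℝ → X →L[ℝ] X} {u : ℝ → X} {I : Set ℝ} {M : ℝ}
    (hM : ∀ a ∈ I, ‖T a‖ ≤ M) (hT : ∀ x, ContinuousOn (fun a => T a x) I)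
    (hu : ContinuousOn u I) : ContinuousOn (fun a => T a (u a)) I := by
  intro a₀ ha₀
  have h1 : Tendsto (fun a => M * ‖u a - u a₀‖ + ‖T a (u a₀) - T a₀ (u a₀)‖) (𝓝[I] a₀) (𝓝 0) := by
    have e1 := (tendsto_iff_norm_sub_tendsto_zero.1 (hu a₀ ha₀)).const_mul M
    have e2 := tendsto_iff_norm_sub_tendsto_zero.1 (hT (u a₀) a₀ ha₀)
    simpa using e1.add e2
  refine tendsto_iff_norm_sub_tendsto_zero.2
    (squeeze_zero' (Eventually.of_forall fun _ => norm_nonneg _) ?_ h1)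
  filter_upwards [self_mem_nhdsWithin] with a ha
  calc ‖T a (u a) - T a₀ (u a₀)‖ = ‖T a (u a - u a₀) + (T a (u a₀) - T a₀ (u a₀))‖ := by
        rw [map_sub]; congr 1; abel
    _ ≤ _ := (norm_add_le _ _).trans (add_le_add_left ((T a).le_of_opNorm_le (hM a ha) _) _)

namespace IsC0Semigroup

variable {S : ℝ → X →L[ℝ] X}

theorem tendsto_nhdsGE (hS : IsC0Semigroup S) (x : X) :
    Tendsto (fun t => S t x) (𝓝[≥] 0) (𝓝 x) := by
  have h0 : S 0 x = x := by rw [hS.zero]; rfl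
  rw [← Ioi_insert, nhdsWithin_insert]
  refine Tendsto.sup ?_ (hS.tendsto x)
  rw [tendsto_pure_left]
  intro s hs
  rw [h0]
  exact mem_of_mem_nhds hs

variable [CompleteSpace X]

theorem exists_bound_near_zero (hS : IsC0Semigroup S) :
    ∃ ε > 0, ∃ M : ℝ, ∀ t ∈ Icc 0 ε, ‖S t‖ ≤ M := by
  by_contra! hcon
  have h1 : ∀ n : ℕ, ∃ t ∈ Icc (0 : ℝ) (1 / ((n : ℝ) + 1)), (n : ℝ) < ‖S t‖ := fun n =>
    hcon _ (by positivity) n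
  choose t ht htn using h1
  have ht0 : Tendsto t atTop (𝓝[≥] 0) := tendsto_nhdsWithin_iff.2
    ⟨squeeze_zero (fun n => (ht n).1) (fun n => (ht n).2) tendsto_one_div_add_atTop_nhds_zero_nat,
      Eventually.of_forall fun n => (ht n).1⟩
  obtain ⟨C, hC⟩ := banach_steinhaus (g := fun n => S (t n)) fun x => by
    obtain ⟨C, hC⟩ := ((hS.tendsto_nhdsGE x).comp ht0).norm.bddAbove_range
    exact ⟨C, fun n => hC ⟨n, rfl⟩⟩
  obtain ⟨n, hn⟩ := exists_nat_gt C
  exact absurd ((htn n).trans_le (hC n)) (not_lt.2 hn.le)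

theorem exists_bound (hS : IsC0Semigroup S) (τ : ℝ) :
    ∃ M : ℝ, 0 ≤ M ∧ ∀ t ∈ Icc 0 τ, ‖S t‖ ≤ M := by
  obtain ⟨ε, hε, M, hM⟩ := hS.exists_bound_near_zero
  have h1 : ∀ n : ℕ, ∃ C : ℝ, ∀ t ∈ Icc 0 (n * ε), ‖S t‖ ≤ C := by
    intro n
    induction n with
    | zero => exact ⟨‖S 0‖, fun t ht => by
        have : t = 0 := le_antisymm (by simpa using ht.2) ht.1
        rw [this]⟩
    | succ n ih =>
      obtain ⟨C, hC⟩ := ih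
      refine ⟨max C (M * C), fun t ht => ?_⟩
      rcases le_total t (n * ε) with h | h
      · exact (hC t ⟨ht.1, h⟩).trans (le_max_left _ _)
      · have hn : 0 ≤ n * ε := by positivity
        have h2 : t - n * ε ∈ Icc 0 ε := ⟨by linarith, by
          have := ht.2; push_cast at this; linarith⟩
        have h3 := hS.add _ _ h2.1 hn
        rw [sub_add_cancel] at h3
        rw [h3]
        refine (ContinuousLinearMap.opNorm_comp_le _ _).trans (le_trans ?_ (le_max_right _ _))
        exact mul_le_mul (hM _ h2) (hC _ ⟨hn, le_rfl⟩) (norm_nonneg _)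
          ((norm_nonneg _).trans (hM _ h2))
  obtain ⟨n, hn⟩ := exists_nat_gt (τ / ε)
  obtain ⟨C, hC⟩ := h1 n
  rw [div_lt_iff₀ hε] at hn
  exact ⟨max C 0, le_max_right _ _, fun t ht =>
    (hC t ⟨ht.1, ht.2.trans hn.le⟩).trans (le_max_left _ _)⟩

theorem continuousOn (hS : IsC0Semigroup S) (x : X) : ContinuousOn (fun t => S t x) (Ici 0) := by
  have key : ∀ τ : ℝ, ContinuousOn (fun t => S t x) (Icc 0 τ) := by
    intro τ
    obtain ⟨M, hM0, hM⟩ := hS.exists_bound τ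
    have hle : ∀ a ∈ Icc 0 τ, ∀ b ∈ Icc 0 τ, a ≤ b → ‖S b x - S a x‖ ≤ M * ‖S |b - a| x - x‖ := by
      intro a ha b hb hab
      have h3 := hS.add a (b - a) ha.1 (sub_nonneg.2 hab)
      rw [add_sub_cancel] at h3
      rw [h3, abs_of_nonneg (sub_nonneg.2 hab), ContinuousLinearMap.comp_apply, ← map_sub]
      exact (S a).le_of_opNorm_le (hM a ha) _
    intro t₀ ht₀
    have habs : Tendsto (fun t => |t - t₀|) (𝓝[Icc 0 τ] t₀) (𝓝[≥] 0) := by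
      refine tendsto_nhdsWithin_iff.2 ⟨?_, Eventually.of_forall fun t => mem_Ici.2 (abs_nonneg _)⟩
      have : Continuous fun t : ℝ => |t - t₀| := by fun_prop
      simpa using (this.tendsto t₀).mono_left nhdsWithin_le_nhds
    have h1 := (tendsto_iff_norm_sub_tendsto_zero.1
      ((hS.tendsto_nhdsGE x).comp habs)).const_mul M
    rw [mul_zero] at h1
    refine tendsto_iff_norm_sub_tendsto_zero.2
      (squeeze_zero' (Eventually.of_forall fun _ => norm_nonneg _) ?_ h1)
    filter_upwards [self_mem_nhdsWithin] with t ht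
    rcases le_total t₀ t with h | h
    · exact hle _ ht₀ _ ht h
    · rw [norm_sub_rev]
      have := hle _ ht _ ht₀ h
      rwa [abs_sub_comm] at this
  intro t ht
  have h2 := key (t + 1) t ⟨ht, by linarith⟩
  refine h2.mono_of_mem_nhdsWithin ?_
  filter_upwards [self_mem_nhdsWithin, mem_nhdsWithin_of_mem_nhds (Iio_mem_nhds (lt_add_one t))]
    with a ha hb using ⟨ha, le_of_lt hb⟩

omit [CompleteSpace X] in
/-- Trajectories of a `C₀` semigroup that start in the domain of the generator `B` stay there, and
their right derivative is `B S(t) x = S(t) B x`. -/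
theorem hasDerivWithinAt (hS : IsC0Semigroup S) {x y : X}
    (h : Tendsto (fun t : ℝ => t⁻¹ • (S t x - x)) (𝓝[>] 0) (𝓝 y)) {t : ℝ} (ht : 0 ≤ t) :
    Tendsto (fun r : ℝ => r⁻¹ • (S r (S t x) - S t x)) (𝓝[>] 0) (𝓝 (S t y)) ∧
      HasDerivWithinAt (fun t => S t x) (S t y) (Ici t) t := by
  have h1 : Tendsto (fun r : ℝ => r⁻¹ • (S r (S t x) - S t x)) (𝓝[>] 0) (𝓝 (S t y)) := by
    refine (((S t).continuous.tendsto y).comp h).congr' ?_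
    filter_upwards [self_mem_nhdsWithin] with r hr
    have e1 := hS.add r t (le_of_lt hr) ht
    have e2 := hS.add t r ht (le_of_lt hr)
    rw [add_comm, e2] at e1
    have e3 := congrArg (fun f : X →L[ℝ] X => f x) e1
    simp only [ContinuousLinearMap.comp_apply] at e3
    simp [e3]
  refine ⟨h1, ?_⟩
  rw [← hasDerivWithinAt_Ioi_iff_Ici, hasDerivWithinAt_iff_tendsto_slope' self_notMem_Ioi]
  have h2 : Tendsto (fun b => b - t) (𝓝[>] t) (𝓝[>] 0) := by
    refine tendsto_nhdsWithin_iff.2 ⟨?_, ?_⟩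
    · have : Continuous fun b : ℝ => b - t := by fun_prop
      simpa using (this.tendsto t).mono_left nhdsWithin_le_nhds
    · filter_upwards [self_mem_nhdsWithin] with b hb using sub_pos.2 (mem_Ioi.1 hb)
  refine (h1.comp h2).congr' ?_
  filter_upwards [self_mem_nhdsWithin] with b hb
  have e1 := hS.add (b - t) t (sub_nonneg.2 (le_of_lt hb)) ht
  rw [sub_add_cancel] at e1
  rw [slope_def_module, e1]
  rfl

end IsC0Semigroup

end C0Semigroup

section HolomorphicSemigroup

variable {X : Type*} [NormedAddCommGroup X] [NormedSpace ℝ X]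

/-- The data of a bounded holomorphic semigroup `s t = e ^ (-t L)`, `t > 0`, on a real Banach space:
its derivative `s'`, the bounds `‖s t‖ ≤ K` and `‖s' t‖ ≤ K / t`, and its relation to the
resolvent `ρ = (-1 - L)⁻¹`. -/
structure IsHolomorphicSemigroup (ρ : X →L[ℝ] X) (K : ℝ) (s s' : ℝ → X →L[ℝ] X) : Prop where
  injective : Function.Injective ρ
  denseRange : DenseRange ρ
  hasDerivAt : ∀ t, 0 < t → HasDerivAt s (s' t) t
  norm_le : ∀ t, 0 < t → ‖s t‖ ≤ K
  norm_deriv_le : ∀ t, 0 < t → ‖s' t‖ ≤ K / t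
  eq_mul : ∀ t, 0 < t → s t = ρ * (s' t - s t)
  comm : ∀ t, 0 < t → ρ * s t = s t * ρ
  norm_mul_sub_le : ∀ t, 0 < t → ‖s t * ρ - ρ‖ ≤ K * t

open Classical in
/-- The extension of a family of operators `s t`, `t > 0`, by the identity to `t ≤ 0`. -/
def extendOne (s : ℝ → X →L[ℝ] X) (t : ℝ) : X →L[ℝ] X := if 0 < t then s t else 1

theorem extendOne_of_pos {s : ℝ → X →L[ℝ] X} {t : ℝ} (ht : 0 < t) : extendOne s t = s t := if_pos ht

theorem extendOne_zero {s : ℝ → X →L[ℝ] X} : extendOne s 0 = 1 := if_neg (lt_irrefl _)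

namespace IsHolomorphicSemigroup

variable {ρ : X →L[ℝ] X} {K : ℝ} {s s' : ℝ → X →L[ℝ] X}

theorem bound_nonneg (h : IsHolomorphicSemigroup ρ K s s') : 0 ≤ K :=
  (norm_nonneg _).trans (h.norm_le 1 one_pos)

theorem mul_left_cancel (h : IsHolomorphicSemigroup ρ K s s') {a b : X →L[ℝ] X}
    (hab : ρ * a = ρ * b) : a = b := by
  ext x
  exact h.injective (congrArg (fun f : X →L[ℝ] X => f x) hab)

theorem comm_deriv (h : IsHolomorphicSemigroup ρ K s s') {t : ℝ} (ht : 0 < t) :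
    ρ * s' t = s' t * ρ := by
  have h1 := (h.hasDerivAt t ht).const_mul ρ
  have h2 := (h.hasDerivAt t ht).mul_const ρ
  refine h1.unique (h2.congr_of_eventuallyEq ?_)
  filter_upwards [Ioi_mem_nhds ht] with r hr using h.comm r hr

theorem deriv_mul (h : IsHolomorphicSemigroup ρ K s s') {t : ℝ} (ht : 0 < t) :
    s' t * ρ = s t * (1 + ρ) := by
  have h1 := h.eq_mul t ht
  rw [mul_sub, h.comm_deriv ht, h.comm t ht, eq_sub_iff_add_eq] at h1
  rw [← h1, mul_add, mul_one]

theorem deriv_apply (h : IsHolomorphicSemigroup ρ K s s') {t : ℝ} (ht : 0 < t) {x y : X}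
    (hxy : ρ (y - x) = x) : s' t x = s t y := by
  have h1 := congrArg (fun f : X →L[ℝ] X => f (y - x)) (h.deriv_mul ht)
  simpa [hxy] using h1

theorem tendsto_mul (h : IsHolomorphicSemigroup ρ K s s') :
    Tendsto (fun t => s t * ρ) (𝓝[>] 0) (𝓝 ρ) := by
  have h1 : Tendsto (fun t : ℝ => K * t) (𝓝[>] 0) (𝓝 0) := by
    have : Continuous fun t : ℝ => K * t := by fun_prop
    simpa using (this.tendsto 0).mono_left nhdsWithin_le_nhds
  refine tendsto_iff_norm_sub_tendsto_zero.2
    (squeeze_zero' (Eventually.of_forall fun _ => norm_nonneg _) ?_ h1)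
  filter_upwards [self_mem_nhdsWithin] with t ht using h.norm_mul_sub_le t ht

/-- The semigroup law: `a ↦ s (t - a) s (a + r) ρ` has derivative zero on `(0, t)`. -/
theorem add (h : IsHolomorphicSemigroup ρ K s s') {t r : ℝ} (ht : 0 < t) (hr : 0 < r) :
    s (t + r) = s t * s r := by
  set f : ℝ → X →L[ℝ] X := fun a => s (t - a) * (s (a + r) * ρ) with hf
  have hd : ∀ a, 0 ≤ a → a < t → HasDerivAt f 0 a := by
    intro a ha hat
    have e1 : HasDerivAt (fun a => s (t - a)) (-s' (t - a)) a := by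
      exact (h.hasDerivAt (t - a) (sub_pos.2 hat)).comp_const_sub t a
    have e2 : HasDerivAt (fun a => s (a + r)) (s' (a + r)) a := by
      exact (h.hasDerivAt (a + r) (by positivity)).comp_add_const a r
    refine (e1.mul (e2.mul_const ρ)).congr_deriv ?_
    rw [h.deriv_mul (by positivity), ← h.comm _ (by positivity), neg_mul, ← mul_assoc,
      h.deriv_mul (sub_pos.2 hat), mul_assoc, add_mul, one_mul, h.comm _ (by positivity),
      mul_add (s (a + r)), mul_one, neg_add_cancel]
  have hconst : ∀ a, 0 ≤ a → a < t → f a = f 0 := by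
    intro a ha hat
    refine constant_of_has_deriv_right_zero (a := 0) (b := a) (fun b hb => ?_) (fun b hb => ?_) a
      ⟨ha, le_rfl⟩
    · exact (hd b hb.1 (hb.2.trans_lt hat)).continuousAt.continuousWithinAt
    · exact (hd b hb.1 (hb.2.trans hat)).hasDerivWithinAt
  have hlim : Tendsto f (𝓝[<] t) (𝓝 (ρ * s (t + r))) := by
    have e1 : Tendsto (fun a => t - a) (𝓝[<] t) (𝓝[>] 0) := by
      refine tendsto_nhdsWithin_iff.2 ⟨?_, ?_⟩
      · have : Continuous fun b : ℝ => t - b := by fun_prop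
        simpa using (this.tendsto t).mono_left nhdsWithin_le_nhds
      · filter_upwards [self_mem_nhdsWithin] with b hb using sub_pos.2 (mem_Iio.1 hb)
    have e2 : Tendsto (fun a => s (a + r)) (𝓝[<] t) (𝓝 (s (t + r))) := by
      have : ContinuousAt (fun a => s (a + r)) t :=
        ContinuousAt.comp' (h.hasDerivAt (t + r) (by positivity)).continuousAt (by fun_prop)
      exact this.tendsto.mono_left nhdsWithin_le_nhds
    refine ((h.tendsto_mul.comp e1).mul e2).congr' ?_
    filter_upwards [Ioo_mem_nhdsLT ht] with a ha
    simp only [hf, Function.comp_apply]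
    rw [← h.comm (a + r) (by linarith [ha.1]), mul_assoc]
  have h2 : f 0 = ρ * s (t + r) := by
    refine tendsto_nhds_unique (tendsto_const_nhds.congr' ?_) hlim
    filter_upwards [Ioo_mem_nhdsLT ht] with a ha using (hconst a ha.1.le ha.2).symm
  refine h.mul_left_cancel (h2.symm.trans ?_)
  simp only [hf, sub_zero, zero_add]
  rw [← h.comm r hr, ← mul_assoc, ← h.comm t ht, mul_assoc]

theorem isC0Semigroup (h : IsHolomorphicSemigroup ρ K s s') : IsC0Semigroup (extendOne s) where
  zero := extendOne_zero
  add a b ha hb := by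
    rcases ha.eq_or_lt with rfl | ha
    · rw [zero_add, extendOne_zero]; rfl
    rcases hb.eq_or_lt with rfl | hb
    · rw [add_zero, extendOne_zero]; rfl
    rw [extendOne_of_pos ha, extendOne_of_pos hb, extendOne_of_pos (add_pos ha hb), h.add ha hb]
    rfl
  tendsto x := by
    have hK := h.bound_nonneg
    rw [Metric.tendsto_nhds]
    intro ε hε
    obtain ⟨y, hy⟩ := h.denseRange.exists_dist_lt x (ε := ε / (2 * (K + 1))) (by positivity)
    rw [dist_eq_norm] at hy
    have h1 : Tendsto (fun t : ℝ => K * t * ‖y‖) (𝓝[>] 0) (𝓝 0) := by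
      have : Continuous fun t : ℝ => K * t * ‖y‖ := by fun_prop
      simpa using (this.tendsto 0).mono_left nhdsWithin_le_nhds
    filter_upwards [self_mem_nhdsWithin, h1.eventually_lt_const (half_pos hε)] with t ht ht2
    rw [extendOne_of_pos ht, dist_eq_norm]
    calc ‖s t x - x‖ = ‖(s t (x - ρ y) - (x - ρ y)) + (s t * ρ - ρ) y‖ := by
          congr 1; simp; abel
      _ ≤ (K * ‖x - ρ y‖ + ‖x - ρ y‖) + K * t * ‖y‖ :=
          (norm_add_le _ _).trans (add_le_add ((norm_sub_le _ _).trans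
            (add_le_add_left ((s t).le_of_opNorm_le (h.norm_le t ht) _) _))
            (ContinuousLinearMap.le_of_opNorm_le _ (h.norm_mul_sub_le t ht) _))
      _ = (K + 1) * ‖x - ρ y‖ + K * t * ‖y‖ := by ring
      _ < (K + 1) * (ε / (2 * (K + 1))) + ε / 2 := by gcongr
      _ = ε := by field_simp; ring

theorem tendsto_slope_iff (h : IsHolomorphicSemigroup ρ K s s') (x y : X) :
    ρ (y - x) = x ↔ Tendsto (fun t : ℝ => t⁻¹ • (extendOne s t x - x)) (𝓝[>] 0) (𝓝 y) := by
  have hC := h.isC0Semigroup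
  have h0 : ∀ x, extendOne s 0 x = x := fun x => by rw [extendOne_zero]; rfl
  have hdir : ∀ x y : X, ρ (y - x) = x →
      Tendsto (fun t : ℝ => t⁻¹ • (extendOne s t x - x)) (𝓝[>] 0) (𝓝 y) := by
    intro x y hxy
    have hd : ∀ t, 0 < t → HasDerivAt (fun t => extendOne s t x) (s t y) t := by
      intro t ht
      have e1 := (h.hasDerivAt t ht).clm_apply (hasDerivAt_const t x)
      rw [map_zero, add_zero, h.deriv_apply ht hxy] at e1
      refine e1.congr_of_eventuallyEq ?_
      filter_upwards [Ioi_mem_nhds ht] with r hr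
      rw [extendOne_of_pos hr]
    have h1 : HasDerivWithinAt (fun t => extendOne s t x) y (Ici 0) 0 := by
      refine hasDerivWithinAt_Ici_of_tendsto_deriv (s := Ioi 0)
        (fun t ht => (hd t ht).differentiableAt.differentiableWithinAt) ?_ self_mem_nhdsWithin ?_
      · rw [ContinuousWithinAt, h0]
        exact hC.tendsto x
      · refine (hC.tendsto y).congr' ?_
        filter_upwards [self_mem_nhdsWithin] with t ht
        rw [(hd t ht).deriv, extendOne_of_pos ht]
    rw [← hasDerivWithinAt_Ioi_iff_Ici, hasDerivWithinAt_iff_tendsto_slope' self_notMem_Ioi] at h1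
    refine h1.congr fun t => ?_
    rw [slope_def_module, h0, sub_zero]
  refine ⟨hdir x y, fun hlim => ?_⟩
  have h1 := hdir (ρ x) (x + ρ x) (by rw [add_sub_cancel_right])
  have h2 := (ρ.continuous.tendsto y).comp hlim
  have h3 : ρ y = x + ρ x := by
    refine tendsto_nhds_unique (h2.congr' ?_) h1
    filter_upwards [self_mem_nhdsWithin] with t ht
    have e := congrArg (fun f : X →L[ℝ] X => f x) (h.comm t ht)
    simp only [mul_apply_eq_comp] at e
    simp [extendOne_of_pos (mem_Ioi.1 ht), e]
  rw [map_sub, h3, add_sub_cancel_right]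

variable [CompleteSpace X]

/-- A `C₀` semigroup is determined by its generator: `a ↦ s (t - a) S a x` has right derivative
zero for `x` in the domain. -/
theorem eq_of_generator (h : IsHolomorphicSemigroup ρ K s s') {S : ℝ → X →L[ℝ] X}
    (hS : IsC0Semigroup S)
    (hgen : ∀ x y : X, ρ (y - x) = x ↔ Tendsto (fun t : ℝ => t⁻¹ • (S t x - x)) (𝓝[>] 0) (𝓝 y))
    {t : ℝ} (ht : 0 ≤ t) : S t = extendOne s t := by
  have hC := h.isC0Semigroup
  have key : ∀ w, S t (ρ w) = extendOne s t (ρ w) := by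
    intro w
    set x := ρ w with hx
    have hxy : ρ ((w + x) - x) = x := by rw [add_sub_cancel_right]
    have hlim := (hgen x (w + x)).1 hxy
    obtain ⟨M, -, hM⟩ := hC.exists_bound t
    have hcont : ContinuousOn (fun a => extendOne s (t - a) (S a x)) (Icc 0 t) := by
      refine continuousOn_clm_apply_of_bounded (T := fun a => extendOne s (t - a)) (M := M)
        (fun a ha => hM _ ⟨sub_nonneg.2 ha.2, by linarith [ha.1]⟩) (fun z => ?_)
        ((hS.continuousOn x).mono Icc_subset_Ici_self)
      exact (hC.continuousOn z).comp (by fun_prop) (fun a ha => sub_nonneg.2 ha.2)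
    have hd : ∀ a ∈ Ico 0 t,
        HasDerivWithinAt (fun a => extendOne s (t - a) (S a x)) 0 (Ici a) a := by
      intro a ha
      obtain ⟨e1, e2⟩ := hS.hasDerivWithinAt hlim ha.1
      have e3 := (hgen _ _).2 e1
      have e4 : HasDerivAt (fun a => extendOne s (t - a)) (-s' (t - a)) a := by
        have : HasDerivAt (fun a => s (t - a)) (-s' (t - a)) a := by
          exact (h.hasDerivAt (t - a) (sub_pos.2 ha.2)).comp_const_sub t a
        refine this.congr_of_eventuallyEq ?_
        filter_upwards [Iio_mem_nhds ha.2] with b hb using extendOne_of_pos (sub_pos.2 hb)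
      refine (e4.hasDerivWithinAt.clm_apply e2).congr_deriv ?_
      rw [neg_apply, h.deriv_apply (sub_pos.2 ha.2) e3,
        extendOne_of_pos (sub_pos.2 ha.2), neg_add_cancel]
    have := constant_of_has_deriv_right_zero hcont hd t ⟨ht, le_rfl⟩
    simpa [extendOne_zero, hS.zero] using this
  ext x
  exact congrFun (h.denseRange.equalizer (S t).continuous (extendOne s t).continuous
    (funext key)) x

end IsHolomorphicSemigroup

end HolomorphicSemigroup

/-! ### Resolvents on the complexification and the half plane bound -/

section ComplexResolvent

variable {X : Type*} [NormedAddCommGroup X] [NormedSpace ℝ X]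

theorem complexMul_add_left (z w : ℂ) (v : X × X) :
    complexMul (z + w) v = complexMul z v + complexMul w v := by
  ext <;> simp [complexMul] <;> module

theorem complexMul_mul (z w : ℂ) (v : X × X) :
    complexMul (z * w) v = complexMul z (complexMul w v) := by
  ext <;> simp [complexMul] <;> module

theorem complexMul_ofReal (a : ℝ) (v : X × X) : complexMul (a : ℂ) v = a • v := by
  ext <;> simp [complexMul]

theorem norm_complexMul_le (z : ℂ) (v : X × X) : ‖complexMul z v‖ ≤ 2 * ‖z‖ * ‖v‖ := by
  have h1 : ∀ (a b : ℝ) (x y : X), |a| ≤ ‖z‖ → |b| ≤ ‖z‖ → ‖x‖ ≤ ‖v‖ → ‖y‖ ≤ ‖v‖ →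
      ‖a • x‖ + ‖b • y‖ ≤ 2 * ‖z‖ * ‖v‖ := by
    intro a b x y ha hb hx hy
    rw [norm_smul, norm_smul, Real.norm_eq_abs, Real.norm_eq_abs]
    calc _ ≤ ‖z‖ * ‖v‖ + ‖z‖ * ‖v‖ := by gcongr
      _ = _ := by ring
  exact norm_prod_le_iff.2 ⟨(norm_sub_le _ _).trans (h1 _ _ _ _ (Complex.abs_re_le_norm z)
      (Complex.abs_im_le_norm z) (norm_fst_le v) (norm_snd_le v)),
    (norm_add_le _ _).trans (h1 _ _ _ _ (Complex.abs_im_le_norm z)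
      (Complex.abs_re_le_norm z) (norm_fst_le v) (norm_snd_le v))⟩

variable (X) in
/-- The action of the complex numbers on the complexification `X × X`, as a homomorphism into the
real Banach algebra of bounded operators. -/
def complexMulHom : ℂ →ₐ[ℝ] ((X × X) →L[ℝ] (X × X)) where
  toFun z := LinearMap.mkContinuous
    { toFun := complexMul z
      map_add' := fun v w => by ext <;> simp [complexMul] <;> module
      map_smul' := fun c v => by ext <;> simp [complexMul] <;> module }
    (2 * ‖z‖) (norm_complexMul_le z)
  map_one' := by ext v <;> simp [complexMul]
  map_zero' := by ext v <;> simp [complexMul]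
  map_mul' z w := ContinuousLinearMap.ext fun v => complexMul_mul z w v
  map_add' z w := ContinuousLinearMap.ext fun v => complexMul_add_left z w v
  commutes' a := ContinuousLinearMap.ext fun v => complexMul_ofReal a v

theorem complexMulHom_apply (z : ℂ) (v : X × X) : complexMulHom X z v = complexMul z v := rfl

theorem norm_complexMulHom_le (z : ℂ) : ‖complexMulHom X z‖ ≤ 2 * ‖z‖ :=
  LinearMap.mkContinuous_norm_le _ (by positivity) (norm_complexMul_le z)

theorem complexification_complexMul (L : X →ₗ.[ℝ] X) (z : ℂ) {v : X × X}
    (hv : v ∈ (complexification L).domain) :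
    ∃ hzv : complexMul z v ∈ (complexification L).domain,
      complexification L ⟨complexMul z v, hzv⟩ = complexMul z (complexification L ⟨v, hv⟩) := by
  have h1 : complexMul z v ∈ (complexification L).domain :=
    ⟨L.domain.sub_mem (L.domain.smul_mem _ hv.1) (L.domain.smul_mem _ hv.2),
      L.domain.add_mem (L.domain.smul_mem _ hv.1) (L.domain.smul_mem _ hv.2)⟩
  refine ⟨h1, Prod.ext ?_ ?_⟩
  · have : (⟨(complexMul z v).1, h1.1⟩ : L.domain) = z.re • ⟨v.1, hv.1⟩ - z.im • ⟨v.2, hv.2⟩ := rfl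
    change L ⟨(complexMul z v).1, h1.1⟩ = z.re • L ⟨v.1, hv.1⟩ - z.im • L ⟨v.2, hv.2⟩
    rw [this, L.map_sub, L.map_smul, L.map_smul]
  · have : (⟨(complexMul z v).2, h1.2⟩ : L.domain) = z.im • ⟨v.1, hv.1⟩ + z.re • ⟨v.2, hv.2⟩ := rfl
    change L ⟨(complexMul z v).2, h1.2⟩ = z.im • L ⟨v.1, hv.1⟩ + z.re • L ⟨v.2, hv.2⟩
    rw [this, L.map_add, L.map_smul, L.map_smul]

namespace IsResolvent

variable {L : X →ₗ.[ℝ] X} {z z' : ℂ} {R R' : (X × X) →L[ℝ] (X × X)}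

theorem unique (h : IsResolvent L z R) (h' : IsResolvent L z R') : R = R' :=
  ContinuousLinearMap.ext fun w => (h _ w).2 ((h' _ w).1 rfl)

theorem complexMulHom_comm (h : IsResolvent L z R) (w : ℂ) :
    complexMulHom X w * R = R * complexMulHom X w := by
  refine ContinuousLinearMap.ext fun x => ?_
  obtain ⟨hv, e⟩ := (h (R x) x).1 rfl
  obtain ⟨hv', e'⟩ := complexification_complexMul L w hv
  refine ((h (complexMul w (R x)) (complexMul w x)).2 ⟨hv', ?_⟩).symm
  rw [e', ← complexMul_mul, mul_comm, complexMul_mul]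
  conv_rhs => rw [← e]
  exact (map_sub (complexMulHom X w) _ _).symm

theorem sub_eq_mul (h : IsResolvent L z R) (h' : IsResolvent L z' R') :
    R - R' = R' * complexMulHom X (z' - z) * R := by
  refine ContinuousLinearMap.ext fun w => ?_
  obtain ⟨hv, e⟩ := (h (R w) w).1 rfl
  have h1 : R' (w + complexMul (z' - z) (R w)) = R w := by
    refine (h' _ _).2 ⟨hv, ?_⟩
    have : complexMul z' (R w) = complexMul z (R w) + complexMul (z' - z) (R w) := by
      rw [← complexMul_add_left, add_sub_cancel]
    rw [this, add_sub_right_comm, e]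
  change R w - R' w = R' (complexMul (z' - z) (R w))
  rw [map_add] at h1
  rw [← eq_sub_of_add_eq' h1]

theorem comm (h : IsResolvent L z R) (h' : IsResolvent L z' R') : R * R' = R' * R := by
  rcases eq_or_ne z z' with rfl | hne
  · rw [h.unique h']
  · have e1 := h.sub_eq_mul h'
    have e2 := h'.sub_eq_mul h
    rw [← h'.complexMulHom_comm, mul_assoc] at e1
    have hneg : ∀ T, complexMulHom X (z - z') * T = -(complexMulHom X (z' - z) * T) := fun T =>
      ContinuousLinearMap.ext fun v => by
        change complexMul (z - z') (T v) = -complexMul (z' - z) (T v)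
        ext <;> simp [complexMul] <;> module
    rw [← h.complexMulHom_comm, mul_assoc, hneg, ← neg_sub, neg_inj, e1] at e2
    have e3 := congrArg (complexMulHom X (z' - z)⁻¹ * ·) e2
    simp only [← mul_assoc, ← map_mul] at e3
    rw [inv_mul_cancel₀ (sub_ne_zero.2 hne.symm), map_one, one_mul, one_mul] at e3
    exact e3.symm

/-- The resolvent set is open, by the Neumann series. -/
theorem exists_add [CompleteSpace X] (h : IsResolvent L z R) {d : ℂ} (hd : 2 * ‖d‖ * ‖R‖ ≤ 1 / 2) :
    ∃ R', IsResolvent L (z + d) R' ∧ ‖R'‖ ≤ 2 * ‖R‖ := by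
  set T := -(complexMulHom X d * R) with hT
  have hTn : ‖T‖ ≤ 1 / 2 := by
    rw [hT, norm_neg]
    refine (norm_mul_le _ _).trans (le_trans ?_ hd)
    gcongr
    exact norm_complexMulHom_le d
  set U := Units.oneSub T (hTn.trans_lt (by norm_num)) with hU
  set N : (X × X) →L[ℝ] (X × X) := ↑U⁻¹ with hN
  have hUv : (U : (X × X) →L[ℝ] (X × X)) = 1 - T := rfl
  have hUN : ∀ w, N w + complexMul d (R (N w)) = w := by
    intro w
    have := congrArg (fun f : (X × X) →L[ℝ] (X × X) => f w) U.mul_inv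
    simpa [hUv, hT, complexMulHom_apply] using this
  have hNU : ∀ q, N (q + complexMul d (R q)) = q := by
    intro q
    have := congrArg (fun f : (X × X) →L[ℝ] (X × X) => f q) U.inv_mul
    simpa [hUv, hT, complexMulHom_apply] using this
  have hNn : ‖N‖ ≤ 2 := by
    refine N.opNorm_le_bound zero_le_two fun w => ?_
    have e1 : N w = w + T (N w) := by
      change N w = w + -complexMul d (R (N w))
      rw [← sub_eq_add_neg]
      exact eq_sub_of_add_eq (hUN w)
    have e2 : ‖N w‖ ≤ ‖w‖ + 1 / 2 * ‖N w‖ := by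
      conv_lhs => rw [e1]
      exact (norm_add_le _ _).trans (add_le_add_right (T.le_of_opNorm_le hTn _) _)
    linarith
  refine ⟨R * N, fun v w => ⟨?_, ?_⟩, ?_⟩
  · rintro rfl
    obtain ⟨hv, e⟩ := (h (R (N w)) (N w)).1 rfl
    refine ⟨hv, ?_⟩
    rw [complexMul_add_left, add_sub_right_comm]
    refine Eq.trans ?_ (hUN w)
    exact congrArg (· + complexMul d (R (N w))) e
  · rintro ⟨hv, e⟩
    have e1 : R (complexMul z v - complexification L ⟨v, hv⟩) = v := (h _ _).2 ⟨hv, rfl⟩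
    have e2 := hNU (complexMul z v - complexification L ⟨v, hv⟩)
    rw [e1, ← add_sub_right_comm, ← complexMul_add_left, e] at e2
    change R (N w) = v
    rw [e2, e1]
  · refine (norm_mul_le _ _).trans ?_
    rw [mul_comm]
    gcongr

end IsResolvent

theorem isResolvent_shift_iff (A : X →ₗ.[ℝ] X) (μ : ℝ) (z : ℂ) (R : (X × X) →L[ℝ] (X × X)) :
    IsResolvent (shift A μ) z R ↔ IsResolvent A (z - μ) R := by
  have h1 : ∀ (v : X × X) (hv : v ∈ (complexification A).domain),
      complexMul z v - complexification (shift A μ) ⟨v, hv⟩ =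
        complexMul (z - μ) v - complexification A ⟨v, hv⟩ := by
    intro v hv
    have e1 : complexification (shift A μ) ⟨v, hv⟩ = complexification A ⟨v, hv⟩ + μ • v := rfl
    have e2 : complexMul z v = complexMul (z - μ) v + μ • v := by
      rw [← complexMul_ofReal, ← complexMul_add_left, sub_add_cancel]
    rw [e1, e2]
    abel
  refine forall_congr' fun v => forall_congr' fun w => iff_congr Iff.rfl ?_
  exact exists_congr fun hv => by rw [h1 v hv]

theorem HasCompactResolvents.shift {A : X →ₗ.[ℝ] X} (hA : HasCompactResolvents A) (μ : ℝ) :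
    HasCompactResolvents (shift A μ) :=
  fun z R hR => hA _ R ((isResolvent_shift_iff A μ z R).1 hR)

/-- The resolvent bound `‖(z - L)⁻¹‖ ≤ M / ‖z‖` on the open left half plane. -/
def HasHalfPlaneBound (L : X →ₗ.[ℝ] X) (M : ℝ) : Prop :=
  ∀ z : ℂ, z.re < 0 → ∃ R : (X × X) →L[ℝ] (X × X), IsResolvent L z R ∧ ‖R‖ ≤ M / ‖z‖

/-- If `A` is sectorial and the spectrum of `A + δ` lies in the open right half plane, then the
resolvent bound `‖(z - L)⁻¹‖ ≤ M / ‖z‖` on the left half plane holds for `L = A + δ - ω` with some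
`ω > 0`: far from the origin it is part of sectoriality, on bounded sets it follows from compactness
and the openness of the resolvent set. -/
theorem exists_hasHalfPlaneBound [CompleteSpace X] {A : X →ₗ.[ℝ] X} (hA : IsSectorial A) {δ : ℝ}
    (hδ : IsPositivelyDefined (shift A δ)) :
    ∃ ω > 0, ∃ M, HasHalfPlaneBound (shift A (δ - ω)) M := by
  obtain ⟨-, -, a, φ, M, hφ0, hφ, hsec⟩ := hA
  have hcos : 0 < Real.cos φ := Real.cos_pos_of_mem_Ioo ⟨by linarith, hφ⟩
  set m := |δ + a| with hm
  have hm0 : 0 ≤ m := abs_nonneg _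
  set N := 2 * m + 1 + m / Real.cos φ with hN
  have hN0 : 0 ≤ N := by positivity
  have hfar : ∀ z : ℂ, z.re ≤ 0 → N ≤ ‖z‖ → ∃ R : (X × X) →L[ℝ] (X × X),
      IsResolvent (shift A δ) z R ∧ ‖R‖ ≤ 2 * |M| / (1 + ‖z‖) := by
    intro z hz hNz
    set ζ : ℂ := z - δ - a with hζ
    have hζn : ‖z‖ - m ≤ ‖ζ‖ := by
      have h1 : z = ζ + ((δ + a : ℝ) : ℂ) := by rw [hζ]; push_cast; ring
      have h2 := norm_add_le ζ ((δ + a : ℝ) : ℂ)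
      rw [← h1, Complex.norm_real, Real.norm_eq_abs] at h2
      linarith
    have hdiv : 0 ≤ m / Real.cos φ := by positivity
    have hζpos : (1 + ‖z‖) / 2 ≤ ‖ζ‖ := by linarith
    have hζ0 : 0 < ‖ζ‖ := lt_of_lt_of_le (by positivity) hζpos
    have harg : φ ≤ |Complex.arg ζ| := by
      by_contra! hlt
      have h1 : Real.cos φ ≤ Real.cos (Complex.arg ζ) := by
        rw [← Real.cos_abs (Complex.arg ζ)]
        exact Real.cos_le_cos_of_nonneg_of_le_pi (abs_nonneg _) (by linarith [Real.pi_pos]) hlt.le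
      have h2 : ‖ζ‖ * Real.cos φ ≤ m := by
        calc ‖ζ‖ * Real.cos φ ≤ ‖ζ‖ * Real.cos (Complex.arg ζ) := by gcongr
          _ = ζ.re := Complex.norm_mul_cos_arg ζ
          _ = z.re - (δ + a) := by simp [hζ]; ring
          _ ≤ m := by linarith [neg_le_abs (δ + a)]
      rw [← le_div_iff₀ hcos] at h2
      linarith
    obtain ⟨R, hR, hRn⟩ := hsec (z - δ) (fun h => by
      rw [hζ, h, sub_self, norm_zero] at hζ0; exact lt_irrefl _ hζ0) harg
    refine ⟨R, (isResolvent_shift_iff A δ z R).2 hR, hRn.trans ?_⟩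
    calc M / ‖ζ‖ ≤ |M| / ((1 + ‖z‖) / 2) := by
          gcongr
          exact le_abs_self M
      _ = _ := by field_simp
  have hnear : ∃ C : ℝ, ∀ z ∈ Metric.closedBall (0 : ℂ) N ∩ {z | z.re ≤ 0},
      ∃ R : (X × X) →L[ℝ] (X × X), IsResolvent (shift A δ) z R ∧ ‖R‖ ≤ C := by
    have hK : IsCompact (Metric.closedBall (0 : ℂ) N ∩ {z | z.re ≤ 0}) :=
      (isCompact_closedBall 0 N).inter_right
        (isClosed_le Complex.continuous_re continuous_const)
    refine hK.induction_on (p := fun s => ∃ C : ℝ, ∀ z ∈ s,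
      ∃ R : (X × X) →L[ℝ] (X × X), IsResolvent (SemilinearEvolution.shift A δ) z R ∧ ‖R‖ ≤ C)
      ⟨0, by simp⟩ ?_ ?_ ?_
    · rintro s t hst ⟨C, hC⟩
      exact ⟨C, fun z hz => hC z (hst hz)⟩
    · rintro s t ⟨C, hC⟩ ⟨C', hC'⟩
      refine ⟨max C C', ?_⟩
      rintro z (hz | hz)
      · obtain ⟨R, hR, hRn⟩ := hC z hz
        exact ⟨R, hR, hRn.trans (le_max_left _ _)⟩
      · obtain ⟨R, hR, hRn⟩ := hC' z hz
        exact ⟨R, hR, hRn.trans (le_max_right _ _)⟩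
    · intro z hz
      have : z ∉ complexSpectrum (SemilinearEvolution.shift A δ) :=
        fun h => absurd (hδ z h) (not_lt.2 hz.2)
      obtain ⟨R, hR⟩ := not_not.1 this
      refine ⟨Metric.ball z (1 / (4 * (‖R‖ + 1))), mem_nhdsWithin_of_mem_nhds
        (Metric.ball_mem_nhds _ (by positivity)), 2 * ‖R‖, fun z' hz' => ?_⟩
      rw [Metric.mem_ball, dist_eq_norm, lt_div_iff₀ (by positivity)] at hz'
      obtain ⟨R', hR', hRn'⟩ := hR.exists_add (d := z' - z) (by
        nlinarith [norm_nonneg (z' - z), norm_nonneg R])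
      rw [add_sub_cancel] at hR'
      exact ⟨R', hR', hRn'⟩
  obtain ⟨C, hC⟩ := hnear
  set K := max (2 * |M|) (|C| * (1 + N)) with hKdef
  have hK0 : 0 ≤ K := le_trans (by positivity) (le_max_left _ _)
  have hall : ∀ z : ℂ, z.re ≤ 0 → ∃ R : (X × X) →L[ℝ] (X × X),
      IsResolvent (shift A δ) z R ∧ ‖R‖ ≤ K / (1 + ‖z‖) := by
    intro z hz
    rcases le_total N ‖z‖ with h | h
    · obtain ⟨R, hR, hRn⟩ := hfar z hz h
      refine ⟨R, hR, hRn.trans ?_⟩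
      gcongr
      exact le_max_left _ _
    · obtain ⟨R, hR, hRn⟩ := hC z ⟨by simpa using h, hz⟩
      refine ⟨R, hR, hRn.trans ?_⟩
      rw [le_div_iff₀ (by positivity)]
      calc C * (1 + ‖z‖) ≤ |C| * (1 + N) := by
            gcongr
            exact le_abs_self C
        _ ≤ K := le_max_right _ _
  refine ⟨1 / (4 * (K + 1)), by positivity, 2 * K, fun z hz => ?_⟩
  obtain ⟨R, hR, hRn⟩ := hall z hz.le
  have hz0 : 0 < ‖z‖ := norm_pos_iff.2 (by rintro rfl; simp at hz)
  have hRK : ‖R‖ ≤ K := hRn.trans (div_le_self hK0 (by linarith))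
  obtain ⟨R', hR', hRn'⟩ := hR.exists_add (d := ((1 / (4 * (K + 1)) : ℝ) : ℂ)) (by
    rw [Complex.norm_real, Real.norm_of_nonneg (by positivity)]
    calc 2 * (1 / (4 * (K + 1))) * ‖R‖ ≤ 2 * (1 / (4 * (K + 1))) * (K + 1) := by
          gcongr; linarith
      _ = 1 / 2 := by field_simp; norm_num)
  refine ⟨R', ?_, hRn'.trans ?_⟩
  · rw [isResolvent_shift_iff] at hR' ⊢
    convert hR' using 1
    push_cast
    ring
  · calc 2 * ‖R‖ ≤ 2 * (K / (1 + ‖z‖)) := by gcongr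
      _ ≤ 2 * (K / ‖z‖) := by gcongr; linarith
      _ = _ := by ring

end ComplexResolvent

/-! ### The semigroup generated by a sectorial operator -/

section RealSemigroup

variable {X : Type*} [NormedAddCommGroup X] [NormedSpace ℝ X]

variable (X) in
/-- The compression `T ↦ (x ↦ Re T (x + i 0))` of operators from the complexification to the real
space. -/
def realPart : ((X × X) →L[ℝ] (X × X)) →L[ℝ] (X →L[ℝ] X) :=
  (ContinuousLinearMap.compL ℝ X (X × X) X (ContinuousLinearMap.fst ℝ X X)).comp
    ((ContinuousLinearMap.compL ℝ X (X × X) (X × X)).flip (ContinuousLinearMap.inl ℝ X X))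

theorem realPart_apply (T : (X × X) →L[ℝ] (X × X)) (x : X) : realPart X T x = (T (x, 0)).1 := rfl

theorem norm_realPart_le (T : (X × X) →L[ℝ] (X × X)) : ‖realPart X T‖ ≤ ‖T‖ := by
  refine ContinuousLinearMap.opNorm_le_bound _ (norm_nonneg _) fun x => ?_
  rw [realPart_apply]
  exact ((norm_fst_le _).trans (T.le_opNorm _)).trans_eq (by simp)

theorem isCompactOperator_realPart {T : (X × X) →L[ℝ] (X × X)} (hT : IsCompactOperator T) :
    IsCompactOperator (realPart X T) :=
  (hT.comp_clm (ContinuousLinearMap.inl ℝ X X)).clm_comp (ContinuousLinearMap.fst ℝ X X)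

/-- `ρ` is the real resolvent `(-1 - L)⁻¹`. -/
def IsRealResolvent (L : X →ₗ.[ℝ] X) (ρ : X →L[ℝ] X) : Prop :=
  ∀ v w : X, ρ w = v ↔ ∃ hv : v ∈ L.domain, -v - L ⟨v, hv⟩ = w

section

variable {L : X →ₗ.[ℝ] X} {R : (X × X) →L[ℝ] (X × X)}

theorem complexMul_neg_one (v : X × X) : complexMul (-1) v = -v := by
  ext <;> simp [complexMul]

theorem IsResolvent.isRealResolvent (h : IsResolvent L (-1) R) :
    IsRealResolvent L (realPart X R) := by
  intro v w
  constructor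
  · rintro rfl
    obtain ⟨hv, e⟩ := (h (R (w, 0)) (w, 0)).1 rfl
    rw [complexMul_neg_one] at e
    exact ⟨hv.1, congrArg Prod.fst e⟩
  · rintro ⟨hv, e⟩
    have h1 : R (w, 0) = (v, 0) := by
      refine (h _ _).2 ⟨⟨hv, L.domain.zero_mem⟩, ?_⟩
      rw [complexMul_neg_one]
      refine Prod.ext e ?_
      change -(0 : X) - L ⟨0, L.domain.zero_mem⟩ = 0
      have : L ⟨0, L.domain.zero_mem⟩ = 0 := L.map_zero
      rw [this, neg_zero, sub_zero]
    rw [realPart_apply, h1]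

theorem IsResolvent.apply_eq (h : IsResolvent L (-1) R) (w : X × X) :
    R w = (realPart X R w.1, realPart X R w.2) := by
  obtain ⟨h1, e1⟩ := (h.isRealResolvent _ w.1).1 rfl
  obtain ⟨h2, e2⟩ := (h.isRealResolvent _ w.2).1 rfl
  refine (h _ _).2 ⟨⟨h1, h2⟩, ?_⟩
  rw [complexMul_neg_one]
  exact Prod.ext e1 e2

theorem IsResolvent.realPart_mul (h : IsResolvent L (-1) R) (T : (X × X) →L[ℝ] (X × X)) :
    realPart X (R * T) = realPart X R * realPart X T :=
  ContinuousLinearMap.ext fun x => by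
    change (R (T (x, 0))).1 = _
    rw [h.apply_eq]
    rfl

theorem IsResolvent.realPart_mul' (h : IsResolvent L (-1) R) (T : (X × X) →L[ℝ] (X × X)) :
    realPart X (T * R) = realPart X T * realPart X R :=
  ContinuousLinearMap.ext fun x => by
    have := h.apply_eq (x, 0)
    rw [map_zero] at this
    exact congrArg (fun v => (T v).1) this

theorem IsRealResolvent.mem_graph_neg_iff {ρ : X →L[ℝ] X} (hρ : IsRealResolvent L ρ) (x y : X) :
    (x, y) ∈ (-L).graph ↔ ρ (y - x) = x := by
  rw [hρ, LinearPMap.mem_graph_iff]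
  constructor
  · rintro ⟨⟨v, hv⟩, rfl, rfl⟩
    exact ⟨hv, by rw [LinearPMap.neg_apply]; exact neg_sub_left _ _ |>.trans (neg_add' _ _)⟩
  · rintro ⟨hx, e⟩
    refine ⟨⟨x, hx⟩, rfl, ?_⟩
    rw [LinearPMap.neg_apply]
    have : -L ⟨x, hx⟩ = (y - x) + x := by rw [← e]; abel
    exact this.trans (sub_add_cancel _ _)

end

theorem HasHalfPlaneBound.exists_isResolventFamily {L : X →ₗ.[ℝ] X} {M : ℝ}
    (h : HasHalfPlaneBound L M) : ∃ R : ℂ → (X × X) →L[ℝ] (X × X),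
      (∀ z : ℂ, z.re < 0 → IsResolvent L z (R z)) ∧
      IsResolventFamily (complexMulHom X) 2 M R := by
  choose! R hR hRn using h
  refine ⟨R, hR, norm_complexMulHom_le, hRn, fun z z' hz hz' => ?_,
    fun z z' hz hz' => (hR z hz).comm (hR z' hz'), fun w z hz => (hR z hz).complexMulHom_comm w⟩
  rw [(hR z hz).sub_eq_mul (hR z' hz'), ← (hR z' hz').complexMulHom_comm, mul_assoc,
    (hR z hz).comm (hR z' hz')]

/-- A densely defined operator `L` with the resolvent bound `M / ‖z‖` on the left half plane
generates a bounded holomorphic semigroup `e ^ (-t L)`, given by the Dunford integral. -/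
theorem HasHalfPlaneBound.exists_isHolomorphicSemigroup [CompleteSpace X] {L : X →ₗ.[ℝ] X} {M : ℝ}
    (h : HasHalfPlaneBound L M) (hd : Dense (L.domain : Set X)) :
    ∃ (ρ : X →L[ℝ] X) (K : ℝ) (s s' : ℝ → X →L[ℝ] X), IsRealResolvent L ρ ∧
      (HasCompactResolvents L → IsCompactOperator ρ) ∧ IsHolomorphicSemigroup ρ K s s' := by
  obtain ⟨R, hR, hF⟩ := h.exists_isResolventFamily
  have h1 : IsResolvent L (-1) (R (-1)) := hR _ (by simp)
  have hρ := h1.isRealResolvent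
  set J := complexMulHom X with hJ
  set c : ℝ := 2 * Real.exp 1 * M ^ 2 / 2 with hc
  have hM := hF.bound_nonneg
  have hc0 : 0 ≤ c := by positivity
  set K₁ : ℝ := c * ‖(1 : (X × X) →L[ℝ] (X × X))‖ with hK₁
  set K₂ : ℝ := 2 * (c * (2 * M + ‖(1 : (X × X) →L[ℝ] (X × X))‖)) with hK₂
  set K₃ : ℝ := 2 ^ 2 * Real.exp 1 * (M + M ^ 2) / 2 * ‖1 + R (-1)‖ with hK₃
  have h₁ : 0 ≤ K₁ := by positivity
  have h₂ : 0 ≤ K₂ := by positivity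
  have h₃ : 0 ≤ K₃ := by positivity
  refine ⟨realPart X (R (-1)), K₁ + K₂ + K₃,
    fun t => realPart X (dunford J R t (fun _ => 1)),
    fun t => realPart X ((2 : ℝ) • dunford J R t (fun y => scaledGen J R t y)), hρ,
    fun hcomp => isCompactOperator_realPart (hcomp _ _ h1), ?_⟩
  refine ⟨fun w w' hw => ?_, ?_, fun t ht => ?_, fun t ht => ?_, fun t ht => ?_, fun t ht => ?_,
    fun t ht => ?_, fun t ht => ?_⟩
  · obtain ⟨hv, e⟩ := (hρ _ w).1 rfl
    obtain ⟨hv', e'⟩ := (hρ _ w).1 hw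
    obtain ⟨hv'', e''⟩ := (hρ _ w').1 rfl
    exact e'.symm.trans e''
  · have : range (realPart X (R (-1))) = (L.domain : Set X) := by
      ext v
      constructor
      · rintro ⟨w, hw⟩
        exact ((hρ _ _).1 hw).1
      · intro hv
        exact ⟨_, (hρ v _).2 ⟨hv, rfl⟩⟩
    rw [DenseRange, this]
    exact hd
  · exact (realPart X).hasFDerivAt.comp_hasDerivAt t (hF.hasDerivAt_dunford_one ht)
  · refine (norm_realPart_le _).trans ((hF.norm_dunford_le ht (fun _ => le_rfl)).trans ?_)
    calc _ = K₁ := rfl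
      _ ≤ _ := by linarith
  · refine (norm_realPart_le _).trans ?_
    rw [norm_smul, Real.norm_of_nonneg zero_le_two]
    have := hF.norm_dunford_le ht (hF.norm_scaledGen_le ht)
    calc _ ≤ 2 * (c * ((2 * M + ‖(1 : (X × X) →L[ℝ] (X × X))‖) / t)) := by gcongr
      _ = K₂ / t := by rw [hK₂]; ring
      _ ≤ _ := by gcongr; linarith
  · rw [← map_sub, ← h1.realPart_mul, ← hF.dunford_one_eq_mul ht]
  · rw [← h1.realPart_mul, ← h1.realPart_mul', hF.commute_dunford_one ht]
  · rw [← h1.realPart_mul', ← map_sub]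
    refine (norm_realPart_le _).trans ((hF.norm_dunford_one_mul_sub_le ht).trans ?_)
    gcongr
    linarith

theorem IsHolomorphicSemigroup.isGenerator {L : X →ₗ.[ℝ] X} {ρ : X →L[ℝ] X} {K : ℝ}
    {s s' : ℝ → X →L[ℝ] X} (h : IsHolomorphicSemigroup ρ K s s') (hρ : IsRealResolvent L ρ) :
    IsGenerator (extendOne s) (-L) :=
  fun x y => (hρ.mem_graph_neg_iff x y).trans (h.tendsto_slope_iff x y)

theorem shift_shift (A : X →ₗ.[ℝ] X) (a b : ℝ) : shift (shift A a) b = shift A (a + b) := by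
  refine LinearPMap.ext rfl fun x _ => ?_
  intro h1
  change (A ⟨x, _⟩ + a • x) + b • x = A ⟨x, _⟩ + (a + b) • x
  rw [add_smul, add_assoc]

theorem shift_zero (A : X →ₗ.[ℝ] X) : shift A 0 = A := by
  refine LinearPMap.ext rfl fun x _ => ?_
  intro h1
  change A ⟨x, _⟩ + (0 : ℝ) • x = A ⟨x, _⟩
  rw [zero_smul, add_zero]

theorem mem_graph_neg_shift_iff (A : X →ₗ.[ℝ] X) (μ : ℝ) (x y : X) :
    (x, y) ∈ (-shift A μ).graph ↔ (x, y + μ • x) ∈ (-A).graph := by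
  rw [LinearPMap.mem_graph_iff, LinearPMap.mem_graph_iff]
  constructor
  · rintro ⟨⟨v, hv⟩, rfl, rfl⟩
    refine ⟨⟨v, hv⟩, rfl, ?_⟩
    change -A ⟨v, _⟩ = -(A ⟨v, _⟩ + μ • v) + μ • v
    abel
  · rintro ⟨⟨v, hv⟩, rfl, e⟩
    refine ⟨⟨v, hv⟩, rfl, ?_⟩
    change -(A ⟨v, _⟩ + μ • v) = y
    change -A ⟨v, _⟩ = y + μ • v at e
    rw [neg_add, e]
    abel

variable {S : ℝ → X →L[ℝ] X}

theorem IsC0Semigroup.exp_smul (hS : IsC0Semigroup S) (μ : ℝ) :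
    IsC0Semigroup (fun t => Real.exp (-(μ * t)) • S t) where
  zero := by simp [hS.zero]
  add a b ha hb := by
    ext x
    simp only [hS.add a b ha hb, ContinuousLinearMap.comp_apply, smul_apply,
      map_smul, smul_smul, ← Real.exp_add]
    ring_nf
  tendsto x := by
    have h1 : Tendsto (fun t : ℝ => Real.exp (-(μ * t))) (𝓝[>] 0) (𝓝 1) := by
      have : Continuous fun t : ℝ => Real.exp (-(μ * t)) := by fun_prop
      simpa using (this.tendsto 0).mono_left nhdsWithin_le_nhds
    simpa using h1.smul (hS.tendsto x)

/-- Multiplication of a semigroup by `e ^ (-μ t)` adds `-μ` to its generator. -/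
theorem IsGenerator.exp_smul {L : X →ₗ.[ℝ] X} (hg : IsGenerator S (-L)) (μ : ℝ) :
    IsGenerator (fun t => Real.exp (-(μ * t)) • S t) (-shift L μ) := by
  intro x y
  rw [mem_graph_neg_shift_iff, hg]
  have h1 : Tendsto (fun t : ℝ => Real.exp (-(μ * t))) (𝓝[>] 0) (𝓝 1) := by
    have : Continuous fun t : ℝ => Real.exp (-(μ * t)) := by fun_prop
    simpa using (this.tendsto 0).mono_left nhdsWithin_le_nhds
  have h2 : Tendsto (fun t : ℝ => t⁻¹ • (Real.exp (-(μ * t)) - 1)) (𝓝[>] 0) (𝓝 (-μ)) := by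
    have h3 : HasDerivAt (fun t : ℝ => Real.exp (-(μ * t))) (-μ) 0 := by
      have := (((hasDerivAt_id (0 : ℝ)).const_mul μ).neg).exp
      simpa using! this
    refine (h3.tendsto_slope_zero_right).congr fun t => ?_
    simp
  constructor
  · intro h
    have h4 := (h1.smul h).add (h2.smul_const x)
    rw [one_smul, neg_smul, add_neg_cancel_right] at h4
    refine h4.congr fun t => ?_
    simp only [smul_apply, smul_eq_mul]
    module
  · intro h
    have h5 : Tendsto (fun t : ℝ => (Real.exp (-(μ * t)))⁻¹) (𝓝[>] 0) (𝓝 1) := by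
      simpa using h1.inv₀ one_ne_zero
    have h4 := h5.smul (h.sub (h2.smul_const x))
    rw [one_smul, neg_smul, sub_neg_eq_add] at h4
    refine h4.congr fun t => ?_
    have h6 : Real.exp (-(μ * t)) ≠ 0 := (Real.exp_pos _).ne'
    simp only [smul_apply, smul_eq_mul]
    have h7 : t⁻¹ • (Real.exp (-(μ * t)) • S t x - x) - (t⁻¹ * (Real.exp (-(μ * t)) - 1)) • x =
      Real.exp (-(μ * t)) • (t⁻¹ • (S t x - x)) := by module
    rw [h7, smul_smul, inv_mul_cancel₀ h6, one_smul]

/-- The semigroup generated by `-(L + μ)` is `e ^ (-μ t) e ^ (-t L)`. -/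
theorem IsHolomorphicSemigroup.semigroup_shift [CompleteSpace X] {L : X →ₗ.[ℝ] X} {ρ : X →L[ℝ] X}
    {K : ℝ} {s s' : ℝ → X →L[ℝ] X} (h : IsHolomorphicSemigroup ρ K s s')
    (hρ : IsRealResolvent L ρ) (μ : ℝ) {t : ℝ} (ht : 0 ≤ t) :
    semigroup (shift L μ) t = Real.exp (-(μ * t)) • extendOne s t := by
  have hC := h.isC0Semigroup
  have hex : ∃ S : ℝ → X →L[ℝ] X, IsC0Semigroup S ∧ IsGenerator S (-shift L μ) :=
    ⟨_, hC.exp_smul μ, (h.isGenerator hρ).exp_smul μ⟩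
  have hsg : semigroup (shift L μ) = hex.choose := dif_pos hex
  obtain ⟨h1, h2⟩ := hex.choose_spec
  rw [← hsg] at h1 h2
  have h3 := h2.exp_smul (-μ)
  rw [shift_shift, add_neg_cancel, shift_zero] at h3
  have h4 := h.eq_of_generator (h1.exp_smul (-μ))
    (fun x y => (hρ.mem_graph_neg_iff x y).symm.trans (h3 x y)) ht
  rw [← h4, smul_smul, ← Real.exp_add]
  simp

end RealSemigroup

/-! ### A Beta integral and its companion -/

section Beta

/-- The real form of the identity `B(α, 1 - α) = Γ(α) Γ(1 - α)`, scaled to `[0, x]`. -/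
theorem integral_rpow_mul_sub_rpow {α : ℝ} (hα : α ∈ Ioo (0 : ℝ) 1) {x : ℝ} (hx : 0 < x) :
    ∫ t in 0..x, t ^ (α - 1) * (x - t) ^ (1 - α - 1) = Real.Gamma α * Real.Gamma (1 - α) := by
  have h1 := Complex.betaIntegral_scaled (α : ℂ) (1 - α : ℂ) hx
  have h2 := Complex.Gamma_mul_Gamma_eq_betaIntegral (s := (α : ℂ)) (t := (1 - α : ℂ))
    (by simpa using hα.1) (by simpa using hα.2)
  rw [add_sub_cancel, Complex.Gamma_one, one_mul] at h2
  rw [add_sub_cancel, sub_self, Complex.cpow_zero, one_mul, ← h2] at h1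
  have h3 : ((∫ t in 0..x, t ^ (α - 1) * (x - t) ^ (1 - α - 1) : ℝ) : ℂ) =
      ∫ t in 0..x, (t : ℂ) ^ ((α : ℂ) - 1) * ((x : ℂ) - t) ^ ((1 - α : ℂ) - 1) := by
    rw [← intervalIntegral.integral_ofReal]
    refine intervalIntegral.integral_congr fun t ht => ?_
    rw [uIcc_of_le hx.le] at ht
    rw [Complex.ofReal_mul, Complex.ofReal_cpow ht.1, Complex.ofReal_cpow (sub_nonneg.2 ht.2)]
    push_cast
    rfl
  rw [h1] at h3
  apply Complex.ofReal_injective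
  rw [h3, Complex.ofReal_mul, ← Complex.Gamma_ofReal, ← Complex.Gamma_ofReal]
  push_cast
  rfl

theorem integrableOn_rpow_div {α : ℝ} (hα : α ∈ Ioo (0 : ℝ) 1) :
    IntegrableOn (fun u : ℝ => u ^ (-α) / (u + 1)) (Ioi 0) := by
  have hmeas :
      AEStronglyMeasurable (fun u : ℝ => u ^ (-α) / (u + 1)) (volume.restrict (Ioi 0)) := by
    refine ContinuousOn.aestronglyMeasurable (fun u hu => ?_) measurableSet_Ioi
    have h1 : u ≠ 0 := (mem_Ioi.1 hu).ne'
    have h2 : u + 1 ≠ 0 := by linarith [mem_Ioi.1 hu]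
    exact ((Real.continuousAt_rpow_const u _ (Or.inl h1)).div (by fun_prop) h2).continuousWithinAt
  rw [← Ioc_union_Ioi_eq_Ioi zero_le_one]
  refine IntegrableOn.union ?_ ?_
  · have h1 : IntegrableOn (fun u : ℝ => u ^ (-α)) (Ioc 0 1) :=
      (intervalIntegrable_iff_integrableOn_Ioc_of_le zero_le_one).1
        (intervalIntegral.intervalIntegrable_rpow' (by linarith [hα.2]))
    refine Integrable.mono' h1 (hmeas.mono_set Ioc_subset_Ioi_self) ?_
    refine (ae_restrict_iff' measurableSet_Ioc).2 (Eventually.of_forall fun u hu => ?_)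
    have h0 : 0 ≤ u ^ (-α) := Real.rpow_nonneg hu.1.le _
    rw [Real.norm_of_nonneg (div_nonneg h0 (by linarith [hu.1]))]
    exact div_le_self h0 (by linarith [hu.1])
  · have h1 : IntegrableOn (fun u : ℝ => u ^ (-α - 1)) (Ioi 1) :=
      integrableOn_Ioi_rpow_of_lt (by linarith [hα.1]) one_pos
    refine Integrable.mono' h1 (hmeas.mono_set (Ioi_subset_Ioi zero_le_one)) ?_
    refine (ae_restrict_iff' measurableSet_Ioi).2 (Eventually.of_forall fun u hu => ?_)
    have hu0 : 0 < u := zero_lt_one.trans (mem_Ioi.1 hu)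
    have h0 : 0 ≤ u ^ (-α) := Real.rpow_nonneg hu0.le _
    rw [Real.norm_of_nonneg (by positivity), Real.rpow_sub_one hu0.ne']
    gcongr
    linarith

theorem integrableOn_rpow_div_add {α : ℝ} (hα : α ∈ Ioo (0 : ℝ) 1) {t : ℝ} (ht : 0 < t) :
    IntegrableOn (fun r : ℝ => r ^ (-α) / (r + t)) (Ioi 0) ∧
      ∫ r in Ioi (0 : ℝ), r ^ (-α) / (r + t) =
        t ^ (-α) * ∫ u in Ioi (0 : ℝ), u ^ (-α) / (u + 1) := by
  have h1 : ∀ u ∈ Ioi (0 : ℝ), (t * u) ^ (-α) / (t * u + t) =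
      t ^ (-α) * t⁻¹ * (u ^ (-α) / (u + 1)) := by
    intro u hu
    have h2 : u + 1 ≠ 0 := by linarith [mem_Ioi.1 hu]
    rw [Real.mul_rpow ht.le (le_of_lt hu)]
    field_simp
  constructor
  · have h3 := (integrableOn_Ioi_comp_mul_left_iff (fun r : ℝ => r ^ (-α) / (r + t)) 0 ht)
    rw [mul_zero] at h3
    rw [← h3]
    exact IntegrableOn.congr_fun ((integrableOn_rpow_div hα).const_mul (t ^ (-α) * t⁻¹))
      (fun u hu => (h1 u hu).symm) measurableSet_Ioi
  · have h3 := integral_comp_mul_left_Ioi (fun r : ℝ => r ^ (-α) / (r + t)) 0 ht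
    rw [mul_zero, setIntegral_congr_fun measurableSet_Ioi h1, integral_const_mul, smul_eq_mul] at h3
    have ht0 := ht.ne'
    field_simp at h3
    exact h3.symm

end Beta

/-! ### Fractional powers and the smoothing estimate -/

section FractionalPowers

variable {X : Type*} [NormedAddCommGroup X] [NormedSpace ℝ X]

/-- The exponentially decaying semigroup `e ^ (-ω t) s t`. -/
def damped (ω : ℝ) (s : ℝ → X →L[ℝ] X) (t : ℝ) : X →L[ℝ] X := Real.exp (-(ω * t)) • s t

/-- The derivative of `e ^ (-ω t) s t`. -/
def dampedDeriv (ω : ℝ) (s s' : ℝ → X →L[ℝ] X) (t : ℝ) : X →L[ℝ] X :=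
  Real.exp (-(ω * t)) • (s' t - ω • s t)

/-- The negative power `B ^ (-β) = Γ(β)⁻¹ ∫ t ^ (β - 1) b t dt` of the negative generator `B` of the
semigroup `b`. -/
def negPow (b : ℝ → X →L[ℝ] X) (β : ℝ) : X →L[ℝ] X :=
  (Real.Gamma β)⁻¹ • ∫ t in Ioi (0 : ℝ), t ^ (β - 1) • b t

/-- The operators `B ^ α b t = - B ^ (-(1 - α)) b' t`. -/
def fracKernel (α ω : ℝ) (s s' : ℝ → X →L[ℝ] X) (t : ℝ) : X →L[ℝ] X :=
  -(negPow (damped ω s) (1 - α) * dampedDeriv ω s s' t)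

namespace IsHolomorphicSemigroup

variable {ρ : X →L[ℝ] X} {K : ℝ} {s s' : ℝ → X →L[ℝ] X} {ω : ℝ}
variable (h : IsHolomorphicSemigroup ρ K s s') (hω : 0 < ω)

include h

theorem hasDerivAt_damped {t : ℝ} (ht : 0 < t) :
    HasDerivAt (damped ω s) (dampedDeriv ω s s' t) t := by
  have h1 : HasDerivAt (fun t : ℝ => Real.exp (-(ω * t))) (Real.exp (-(ω * t)) * -ω) t := by
    simpa using ((hasDerivAt_id t).const_mul ω).neg.exp
  refine (h1.smul (h.hasDerivAt t ht)).congr_deriv ?_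
  rw [dampedDeriv]
  module

theorem continuousOn_damped : ContinuousOn (damped ω s) (Ioi 0) :=
  fun _ ht => (h.hasDerivAt_damped ht).continuousAt.continuousWithinAt

theorem norm_damped_le {t : ℝ} (ht : 0 < t) : ‖damped ω s t‖ ≤ K * Real.exp (-(ω * t)) := by
  rw [damped, norm_smul, Real.norm_of_nonneg (Real.exp_pos _).le, mul_comm]
  gcongr
  exact h.norm_le t ht

theorem damped_add {t r : ℝ} (ht : 0 < t) (hr : 0 < r) :
    damped ω s (t + r) = damped ω s t * damped ω s r := by
  rw [damped, damped, damped, h.add ht hr, smul_mul_smul_comm, ← Real.exp_add]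
  congr 2
  ring

theorem damped_mul_dampedDeriv {t r : ℝ} (hr : 0 < r) (ht : 0 < t) :
    dampedDeriv ω s s' (r + t) = damped ω s r * dampedDeriv ω s s' t := by
  have h1 : HasDerivAt (fun t => damped ω s (r + t)) (dampedDeriv ω s s' (r + t)) t :=
    (h.hasDerivAt_damped (add_pos hr ht)).comp_const_add r t
  refine h1.unique (((h.hasDerivAt_damped ht).const_mul (damped ω s r)).congr_of_eventuallyEq ?_)
  filter_upwards [Ioi_mem_nhds ht] with t' ht' using h.damped_add hr ht'

theorem dampedDeriv_mul_damped {t r : ℝ} (hr : 0 < r) (ht : 0 < t) :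
    dampedDeriv ω s s' (r + t) = dampedDeriv ω s s' t * damped ω s r := by
  have h1 : HasDerivAt (fun t => damped ω s (r + t)) (dampedDeriv ω s s' (r + t)) t :=
    (h.hasDerivAt_damped (add_pos hr ht)).comp_const_add r t
  refine h1.unique (((h.hasDerivAt_damped ht).mul_const (damped ω s r)).congr_of_eventuallyEq ?_)
  filter_upwards [Ioi_mem_nhds ht] with t' ht'
  rw [add_comm, h.damped_add ht' hr]

theorem continuousOn_dampedDeriv : ContinuousOn (dampedDeriv ω s s') (Ioi 0) := by
  intro t ht
  have ht2 : 0 < t / 2 := half_pos ht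
  have h1 : ContinuousAt (fun r => damped ω s (r - t / 2) * dampedDeriv ω s s' (t / 2)) t := by
    have e1 : 0 < t - t / 2 := by linarith
    have e2 : ContinuousAt (fun r => damped ω s (r - t / 2)) t :=
      ContinuousAt.comp' (f := fun r : ℝ => r - t / 2) (h.hasDerivAt_damped e1).continuousAt
        (by fun_prop)
    exact e2.mul continuousAt_const
  refine (h1.congr ?_).continuousWithinAt
  filter_upwards [Ioi_mem_nhds (by linarith : t / 2 < t)] with r hr
  rw [← h.damped_mul_dampedDeriv (sub_pos.2 hr) ht2, sub_add_cancel]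

include hω

theorem norm_dampedDeriv_le {t : ℝ} (ht : 0 < t) : ‖dampedDeriv ω s s' t‖ ≤ 2 * K / t := by
  have hK := h.bound_nonneg
  have h1 : ‖s' t - ω • s t‖ ≤ K / t + ω * K := by
    refine (norm_sub_le _ _).trans (add_le_add (h.norm_deriv_le t ht) ?_)
    rw [norm_smul, Real.norm_of_nonneg hω.le]
    gcongr
    exact h.norm_le t ht
  -- The elementary inequality `(1 + ω t) e ^ (-ω t) ≤ 1` absorbs the term `ω s t`.
  have h2 : Real.exp (-(ω * t)) * (1 + ω * t) ≤ 1 := by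
    rw [Real.exp_neg, inv_mul_le_iff₀ (Real.exp_pos _), mul_one, add_comm]
    exact Real.add_one_le_exp _
  rw [dampedDeriv, norm_smul, Real.norm_of_nonneg (Real.exp_pos _).le]
  calc _ ≤ Real.exp (-(ω * t)) * (K / t + ω * K) := by gcongr
    _ = (Real.exp (-(ω * t)) * (1 + ω * t)) * (K / t) := by field_simp
    _ ≤ 1 * (K / t) := by gcongr
    _ ≤ 2 * K / t := by rw [one_mul]; gcongr; linarith

theorem integrableOn_damped {β : ℝ} (hβ : 0 < β) :
    IntegrableOn (fun t : ℝ => t ^ (β - 1) • damped ω s t) (Ioi 0) := by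
  have h1 := integrableOn_rpow_mul_exp_neg_mul_rpow (s := β - 1) (p := 1) (b := ω)
    (by linarith) one_pos hω
  refine Integrable.mono' (h1.const_mul K) ?_ ?_
  · refine ContinuousOn.aestronglyMeasurable (ContinuousOn.fun_smul (fun t ht => ?_)
      h.continuousOn_damped) measurableSet_Ioi
    exact (Real.continuousAt_rpow_const t _ (Or.inl (ne_of_gt ht))).continuousWithinAt
  · refine (ae_restrict_iff' measurableSet_Ioi).2 (Eventually.of_forall fun t ht => ?_)
    have h0 : 0 ≤ t ^ (β - 1) := Real.rpow_nonneg (le_of_lt ht) _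
    rw [norm_smul, Real.norm_of_nonneg h0, Real.rpow_one, mul_left_comm, neg_mul]
    gcongr
    exact h.norm_damped_le ht

variable [CompleteSpace X]

theorem negPow_mul_negPow {α : ℝ} (hα : α ∈ Ioo (0 : ℝ) 1) :
    negPow (damped ω s) α * negPow (damped ω s) (1 - α) = ∫ t in Ioi (0 : ℝ), damped ω s t := by
  have hα' : 0 < 1 - α := by linarith [hα.2]
  have h1 := integral_posConvolution (h.integrableOn_damped hω hα.1)
    (h.integrableOn_damped hω hα') (ContinuousLinearMap.mul ℝ (X →L[ℝ] X))
  have h2 : ∀ x ∈ Ioi (0 : ℝ), ∫ t in 0..x, ContinuousLinearMap.mul ℝ (X →L[ℝ] X)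
      (t ^ (α - 1) • damped ω s t) ((x - t) ^ (1 - α - 1) • damped ω s (x - t)) =
      (Real.Gamma α * Real.Gamma (1 - α)) • damped ω s x := by
    intro x hx
    rw [← integral_rpow_mul_sub_rpow hα hx, ← intervalIntegral.integral_smul_const
      (fun t : ℝ => t ^ (α - 1) * (x - t) ^ (1 - α - 1)) (damped ω s x),
      intervalIntegral.integral_of_le (le_of_lt hx), intervalIntegral.integral_of_le (le_of_lt hx),
      integral_Ioc_eq_integral_Ioo, integral_Ioc_eq_integral_Ioo]
    refine setIntegral_congr_fun measurableSet_Ioo fun t ht => ?_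
    simp only [ContinuousLinearMap.mul_apply']
    rw [smul_mul_smul_comm, ← h.damped_add ht.1 (sub_pos.2 ht.2), add_sub_cancel]
  rw [setIntegral_congr_fun measurableSet_Ioi h2, integral_smul,
    ContinuousLinearMap.mul_apply'] at h1
  have hg1 := (Real.Gamma_pos_of_pos hα.1).ne'
  have hg2 := (Real.Gamma_pos_of_pos hα').ne'
  rw [negPow, negPow, smul_mul_smul_comm, ← h1, smul_smul, mul_mul_mul_comm, inv_mul_cancel₀ hg1,
    inv_mul_cancel₀ hg2, one_mul, one_smul]

theorem integral_damped_mul {t : ℝ} (ht : 0 < t) :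
    (∫ r in Ioi (0 : ℝ), damped ω s r) * dampedDeriv ω s s' t = -damped ω s t := by
  have hi : IntegrableOn (damped ω s) (Ioi 0) := by
    simpa using h.integrableOn_damped hω one_pos
  rw [← integral_mul_const_of_integrable hi]
  have hlim : Tendsto (fun r => damped ω s (r + t)) atTop (𝓝 0) := by
    have e1 : Tendsto (fun r : ℝ => K * Real.exp (-(ω * (r + t)))) atTop (𝓝 0) := by
      have := (Real.tendsto_exp_neg_atTop_nhds_zero.comp
        ((tendsto_atTop_add_const_right atTop t tendsto_id).const_mul_atTop hω)).const_mul K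
      simpa [Function.comp_def] using this
    refine squeeze_zero_norm' ?_ e1
    filter_upwards [eventually_ge_atTop 0] with r hr using h.norm_damped_le (by positivity)
  have hd : ∀ r, 0 ≤ r → HasDerivAt (fun r => damped ω s (r + t)) (dampedDeriv ω s s' (r + t)) r :=
    fun r hr => (h.hasDerivAt_damped (by positivity)).comp_add_const r t
  rw [integral_Ioi_of_hasDerivAt_of_tendsto (hd 0 le_rfl).continuousAt.continuousWithinAt
    (fun r hr => (hd r (le_of_lt hr)).congr_deriv (h.damped_mul_dampedDeriv hr ht))
    (hi.mul_const _) hlim, zero_add, zero_sub]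

omit [CompleteSpace X] in
theorem negPow_mul_damped {β : ℝ} (hβ : 0 < β) {t : ℝ} (ht : 0 < t) :
    negPow (damped ω s) β * damped ω s t = damped ω s t * negPow (damped ω s) β := by
  have hi := h.integrableOn_damped hω hβ
  rw [negPow, smul_mul_assoc, mul_smul_comm, ← integral_mul_const_of_integrable hi,
    ← integral_const_mul_of_integrable hi]
  congr 1
  refine setIntegral_congr_fun measurableSet_Ioi fun r hr => ?_
  simp only [smul_mul_assoc, mul_smul_comm]
  rw [← h.damped_add hr ht, ← h.damped_add ht hr, add_comm]

omit [CompleteSpace X] in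
theorem negPow_mul_dampedDeriv {β : ℝ} (hβ : 0 < β) {t : ℝ} (ht : 0 < t) :
    negPow (damped ω s) β * dampedDeriv ω s s' t =
      dampedDeriv ω s s' t * negPow (damped ω s) β := by
  have hi := h.integrableOn_damped hω hβ
  rw [negPow, smul_mul_assoc, mul_smul_comm, ← integral_mul_const_of_integrable hi,
    ← integral_const_mul_of_integrable hi]
  congr 1
  refine setIntegral_congr_fun measurableSet_Ioi fun r hr => ?_
  simp only [smul_mul_assoc, mul_smul_comm]
  rw [← h.damped_mul_dampedDeriv hr ht, ← h.dampedDeriv_mul_damped hr ht]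

variable {α : ℝ} (hα : α ∈ Ioo (0 : ℝ) 1)
include hα

theorem negPow_mul_fracKernel {t : ℝ} (ht : 0 < t) :
    negPow (damped ω s) α * fracKernel α ω s s' t = damped ω s t := by
  rw [fracKernel, mul_neg, ← mul_assoc, h.negPow_mul_negPow hω hα, h.integral_damped_mul hω ht,
    neg_neg]

theorem fracKernel_mul_negPow {t : ℝ} (ht : 0 < t) :
    fracKernel α ω s s' t * negPow (damped ω s) α = damped ω s t := by
  have hα' : 1 - α ∈ Ioo (0 : ℝ) 1 := ⟨by linarith [hα.2], by linarith [hα.1]⟩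
  have h1 := h.negPow_mul_negPow hω hα'
  rw [sub_sub_cancel] at h1
  rw [fracKernel, neg_mul, mul_assoc, ← h.negPow_mul_dampedDeriv hω hα.1 ht, ← mul_assoc, h1,
    h.integral_damped_mul hω ht, neg_neg]

omit [CompleteSpace X] in
theorem fracKernel_add {t r : ℝ} (ht : 0 < t) (hr : 0 < r) :
    fracKernel α ω s s' (t + r) = damped ω s t * fracKernel α ω s s' r := by
  rw [fracKernel, fracKernel, h.damped_mul_dampedDeriv ht hr, mul_neg, ← mul_assoc, ← mul_assoc,
    h.negPow_mul_damped hω (by linarith [hα.2]) ht]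

omit hω hα [CompleteSpace X] in
theorem continuousOn_fracKernel : ContinuousOn (fracKernel α ω s s') (Ioi 0) :=
  (continuousOn_const.mul h.continuousOn_dampedDeriv).neg

omit [CompleteSpace X] in
/-- The smoothing estimate `‖B ^ α b t‖ ≤ C t ^ (-α)`. -/
theorem exists_norm_fracKernel_le :
    ∃ C, 0 ≤ C ∧ ∀ t, 0 < t → ‖fracKernel α ω s s' t‖ ≤ C * t ^ (-α) := by
  have hα' : 0 < 1 - α := by linarith [hα.2]
  have hK := h.bound_nonneg
  have hg := Real.Gamma_pos_of_pos hα'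
  set I := ∫ u in Ioi (0 : ℝ), u ^ (-α) / (u + 1) with hI
  have hI0 : 0 ≤ I := setIntegral_nonneg measurableSet_Ioi fun u hu =>
    div_nonneg (Real.rpow_nonneg (le_of_lt hu) _) (by linarith [mem_Ioi.1 hu])
  refine ⟨(Real.Gamma (1 - α))⁻¹ * (2 * K * I), by positivity, fun t ht => ?_⟩
  obtain ⟨e1, e2⟩ := integrableOn_rpow_div_add hα ht
  have hi := h.integrableOn_damped hω hα'
  rw [fracKernel, norm_neg, negPow, smul_mul_assoc, ← integral_mul_const_of_integrable hi,
    norm_smul, Real.norm_of_nonneg (inv_nonneg.2 hg.le), mul_assoc]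
  gcongr
  have hb : ∀ᵐ r ∂(volume.restrict (Ioi (0 : ℝ))),
      ‖(r ^ (1 - α - 1) • damped ω s r) * dampedDeriv ω s s' t‖ ≤
        2 * K * (r ^ (-α) / (r + t)) := by
    refine (ae_restrict_iff' measurableSet_Ioi).2 (Eventually.of_forall fun r hr => ?_)
    have hr0 : 0 < r := hr
    have h0 : 0 ≤ r ^ (-α) := Real.rpow_nonneg hr0.le _
    rw [smul_mul_assoc, ← h.damped_mul_dampedDeriv hr ht, norm_smul, sub_sub_cancel_left,
      Real.norm_of_nonneg h0]
    calc _ ≤ r ^ (-α) * (2 * K / (r + t)) := by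
          gcongr
          exact h.norm_dampedDeriv_le hω (by positivity)
      _ = _ := by ring
  refine (norm_integral_le_of_norm_le (e1.const_mul (2 * K)) hb).trans_eq ?_
  rw [integral_const_mul, e2]
  ring

theorem negPow_injective : Function.Injective (negPow (damped ω s) α) := by
  rw [injective_iff_map_eq_zero]
  intro x hx
  have h0 : ∀ t, 0 < t → s t x = 0 := by
    intro t ht
    have e := congrArg (fun f : X →L[ℝ] X => f x) (h.fracKernel_mul_negPow hω hα ht)
    simp only [mul_apply_eq_comp, hx, map_zero, damped, smul_apply] at e
    exact (smul_eq_zero.1 e.symm).resolve_left (Real.exp_pos _).ne'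
  refine tendsto_nhds_unique (h.isC0Semigroup.tendsto x) (tendsto_const_nhds.congr' ?_)
  filter_upwards [self_mem_nhdsWithin] with t ht
  rw [extendOne_of_pos ht, h0 t ht]

end IsHolomorphicSemigroup

end FractionalPowers

/-! ### Singular Gronwall inequality and singular convolutions -/

section Gronwall

variable {α : ℝ} (hα : α ∈ Ioo (0 : ℝ) 1)
include hα

theorem intervalIntegrable_sub_rpow (a t : ℝ) :
    IntervalIntegrable (fun r => (t - r) ^ (-α)) volume a t := by
  have h1 := (intervalIntegral.intervalIntegrable_rpow' (a := t - a) (b := 0) (r := -α)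
    (by linarith [hα.2])).comp_sub_left t
  simpa using h1

theorem integral_sub_rpow (a t : ℝ) :
    ∫ r in a..t, (t - r) ^ (-α) = (t - a) ^ (1 - α) / (1 - α) := by
  rw [intervalIntegral.integral_comp_sub_left (fun r => r ^ (-α)) t, sub_self,
    integral_rpow (Or.inl (by linarith [hα.2])), neg_add_eq_sub,
    Real.zero_rpow (by linarith [hα.2]), sub_zero]

theorem intervalIntegrable_sub_rpow_mul {a t : ℝ} {φ : ℝ → ℝ} (hat : a ≤ t)
    (hφ : ContinuousOn φ (Icc a t)) :
    IntervalIntegrable (fun r => (t - r) ^ (-α) * φ r) volume a t :=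
  (intervalIntegrable_sub_rpow hα a t).mul_continuousOn (by rwa [uIcc_of_le hat])

theorem integral_sub_rpow_mul_exp_le {θ : ℝ} (hθ : 0 < θ) {t : ℝ} (ht : 0 ≤ t) :
    ∫ r in 0..t, (t - r) ^ (-α) * Real.exp (-(θ * (t - r))) ≤
      (1 / θ) ^ (1 - α) * Real.Gamma (1 - α) := by
  have h1 := integrableOn_rpow_mul_exp_neg_mul_rpow (s := -α) (p := 1) (b := θ)
    (by linarith [hα.2]) one_pos hθ
  have h2 := Real.integral_rpow_mul_exp_neg_mul_Ioi (a := 1 - α) (r := θ) (by linarith [hα.2]) hθ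
  rw [intervalIntegral.integral_comp_sub_left (fun r => r ^ (-α) * Real.exp (-(θ * r))) t, sub_self,
    sub_zero, ← h2, intervalIntegral.integral_of_le ht, sub_sub_cancel_left]
  refine setIntegral_mono_set (by simpa using h1) ?_ Ioc_subset_Ioi_self.eventuallyLE
  refine (ae_restrict_iff' measurableSet_Ioi).2 (Eventually.of_forall fun r hr => ?_)
  exact mul_nonneg (Real.rpow_nonneg (le_of_lt hr) _) (Real.exp_pos _).le

/-- For a large rate `θ` the weighted kernel `b t ^ (-α) e ^ (-θ t)` has integral at most `1 / 2`
over the half line. -/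
theorem exists_exp_rate (b : ℝ) :
    ∃ θ : ℝ, 0 < θ ∧ b * ((1 / θ) ^ (1 - α) * Real.Gamma (1 - α)) ≤ 1 / 2 := by
  have h1 : Tendsto (fun θ : ℝ => b * ((1 / θ) ^ (1 - α) * Real.Gamma (1 - α))) atTop (𝓝 0) := by
    have h2 := ((tendsto_rpow_neg_atTop (y := 1 - α) (by linarith [hα.2])).mul_const
      (Real.Gamma (1 - α))).const_mul b
    rw [zero_mul, mul_zero] at h2
    refine h2.congr' ?_
    filter_upwards [eventually_gt_atTop 0] with θ hθ
    rw [one_div, Real.inv_rpow hθ.le, ← Real.rpow_neg hθ.le]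
  obtain ⟨θ, h3, h4⟩ := ((h1.eventually_le_const (by norm_num : (0 : ℝ) < 1 / 2)).and
    (eventually_gt_atTop 0)).exists
  exact ⟨θ, h4, h3⟩

/-- **Singular Gronwall inequality.** The exponential weight `e ^ (-θ t)` turns the integral
operator with kernel `b (t - r) ^ (-α)` into one of norm at most `1 / 2`. -/
theorem le_of_singular_integral_le {b θ : ℝ} (hb : 0 ≤ b) (hθ : 0 < θ)
    (hbθ : b * ((1 / θ) ^ (1 - α) * Real.Gamma (1 - α)) ≤ 1 / 2) {a τ : ℝ} {φ : ℝ → ℝ}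
    (ha : 0 ≤ a) (hφ : ContinuousOn φ (Icc 0 τ)) (hφ0 : ∀ t ∈ Icc 0 τ, 0 ≤ φ t)
    (hle : ∀ t ∈ Icc 0 τ, φ t ≤ a + b * ∫ r in 0..t, (t - r) ^ (-α) * φ r) :
    ∀ t ∈ Icc 0 τ, φ t ≤ 2 * a * Real.exp (θ * t) := by
  intro t ht
  have hψ : ContinuousOn (fun r => Real.exp (-(θ * r)) * φ r) (Icc 0 τ) :=
    ContinuousOn.mul (by fun_prop) hφ
  obtain ⟨t₀, ht₀, hmax⟩ := isCompact_Icc.exists_isMaxOn ⟨t, ht⟩ hψ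
  set N := Real.exp (-(θ * t₀)) * φ t₀ with hN
  have hmax' : ∀ r ∈ Icc 0 τ, φ r ≤ N * Real.exp (θ * r) := by
    intro r hr
    have h1 : Real.exp (-(θ * r)) * φ r ≤ N := hmax hr
    rwa [Real.exp_neg, inv_mul_le_iff₀ (Real.exp_pos _), mul_comm] at h1
  have hN0 : 0 ≤ N := mul_nonneg (Real.exp_pos _).le (hφ0 _ ht₀)
  have hsub : Icc 0 t₀ ⊆ Icc 0 τ := Icc_subset_Icc_right ht₀.2
  have h2 : ∫ r in 0..t₀, (t₀ - r) ^ (-α) * φ r ≤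
      N * Real.exp (θ * t₀) * ((1 / θ) ^ (1 - α) * Real.Gamma (1 - α)) := by
    have e1 : ∫ r in 0..t₀, (t₀ - r) ^ (-α) * φ r ≤ ∫ r in 0..t₀,
        N * Real.exp (θ * t₀) * ((t₀ - r) ^ (-α) * Real.exp (-(θ * (t₀ - r)))) := by
      refine intervalIntegral.integral_mono_on ht₀.1
        (intervalIntegrable_sub_rpow_mul hα ht₀.1 (hφ.mono hsub))
        ((intervalIntegrable_sub_rpow_mul hα ht₀.1 (by fun_prop)).const_mul _) fun r hr => ?_
      calc (t₀ - r) ^ (-α) * φ r ≤ (t₀ - r) ^ (-α) * (N * Real.exp (θ * r)) := by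
            gcongr
            · exact Real.rpow_nonneg (sub_nonneg.2 hr.2) _
            · exact hmax' r (hsub hr)
        _ = N * (Real.exp (θ * t₀) * Real.exp (-(θ * (t₀ - r)))) * (t₀ - r) ^ (-α) := by
            rw [← Real.exp_add]; ring_nf
        _ = _ := by ring
    refine e1.trans ?_
    rw [intervalIntegral.integral_const_mul]
    gcongr
    exact integral_sub_rpow_mul_exp_le hα hθ ht₀.1
  have h3 : N ≤ a + N / 2 := by
    have e1 := hle t₀ ht₀
    have e2 : Real.exp (-(θ * t₀)) * φ t₀ ≤ Real.exp (-(θ * t₀)) * (a + b *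
        (N * Real.exp (θ * t₀) * ((1 / θ) ^ (1 - α) * Real.Gamma (1 - α)))) := by
      gcongr
      exact e1.trans (by gcongr)
    have e3 : Real.exp (-(θ * t₀)) * Real.exp (θ * t₀) = 1 := by
      rw [← Real.exp_add, neg_add_cancel, Real.exp_zero]
    have e4 : Real.exp (-(θ * t₀)) ≤ 1 :=
      Real.exp_le_one_iff.2 (neg_nonpos.2 (mul_nonneg hθ.le ht₀.1))
    calc N ≤ Real.exp (-(θ * t₀)) * a + N * (b * ((1 / θ) ^ (1 - α) * Real.Gamma (1 - α))) *
          (Real.exp (-(θ * t₀)) * Real.exp (θ * t₀)) := e2.trans_eq (by ring)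
      _ ≤ 1 * a + N * (1 / 2) * 1 := by rw [e3]; gcongr
      _ = _ := by ring
  calc φ t ≤ N * Real.exp (θ * t) := hmax' t ht
    _ ≤ 2 * a * Real.exp (θ * t) := by gcongr; linarith

end Gronwall

section Convolution

variable {X : Type*} [NormedAddCommGroup X] [NormedSpace ℝ X]

/-- A `C₀` semigroup `T` of compact operators together with the operators `K t = B ^ α T t`, of
which only the semigroup relation and the singularity `t ^ (-α)` at `t = 0` are recorded. -/
structure IsSmoothingPair (α : ℝ) (T K : ℝ → X →L[ℝ] X) : Prop where
  mem_Ioo : α ∈ Ioo (0 : ℝ) 1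
  isC0Semigroup : IsC0Semigroup T
  isCompactOperator : ∀ t, 0 < t → IsCompactOperator (T t)
  continuousOn_kernel : ContinuousOn K (Ioi 0)
  kernel_add : ∀ t r, 0 < t → 0 < r → K (t + r) = T t * K r
  kernel_bound : ∀ τ : ℝ, ∃ C, 0 ≤ C ∧ ∀ t ∈ Ioc 0 τ, ‖K t‖ ≤ C * t ^ (-α)

namespace IsSmoothingPair

variable {α : ℝ} {T K : ℝ → X →L[ℝ] X} (h : IsSmoothingPair α T K)
include h

theorem continuousOn_integrand {a t : ℝ} {f : ℝ → X} (hf : ContinuousOn f (Ico a t)) :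
    ContinuousOn (fun r => K (t - r) (f r)) (Ico a t) :=
  (h.continuousOn_kernel.comp (by fun_prop) (fun r hr => sub_pos.2 hr.2)).clm_apply hf

omit h in
theorem norm_integrand_le {C τ : ℝ} (hC : ∀ t ∈ Ioc 0 τ, ‖K t‖ ≤ C * t ^ (-α)) {a t : ℝ}
    (ht : t - a ≤ τ) {f : ℝ → X} {φ : ℝ → ℝ} (hφ : ∀ r ∈ Ico a t, ‖f r‖ ≤ φ r) :
    ∀ᵐ r, r ∈ Ioc a t → ‖K (t - r) (f r)‖ ≤ C * ((t - r) ^ (-α) * φ r) := by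
  filter_upwards [Measure.ae_ne volume t] with r hr hrt
  have h1 : r ∈ Ico a t := ⟨hrt.1.le, lt_of_le_of_ne hrt.2 hr⟩
  have h2 : ‖K (t - r)‖ ≤ C * (t - r) ^ (-α) := hC _ ⟨sub_pos.2 h1.2, by linarith [hrt.1]⟩
  rw [← mul_assoc]
  exact (ContinuousLinearMap.le_opNorm _ _).trans
    (mul_le_mul h2 (hφ r h1) (norm_nonneg _) ((norm_nonneg _).trans h2))

theorem intervalIntegrable {a t N : ℝ} (hat : a ≤ t) {f : ℝ → X} (hf : ContinuousOn f (Ico a t))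
    (hN : ∀ r ∈ Ico a t, ‖f r‖ ≤ N) :
    IntervalIntegrable (fun r => K (t - r) (f r)) volume a t := by
  obtain ⟨C, -, hC⟩ := h.kernel_bound (t - a)
  have h1 := ((intervalIntegrable_sub_rpow h.mem_Ioo a t).mul_const N).const_mul C
  rw [intervalIntegrable_iff_integrableOn_Ioc_of_le hat] at h1 ⊢
  refine Integrable.mono' h1 ?_ ((ae_restrict_iff' measurableSet_Ioc).2
    (norm_integrand_le hC le_rfl (φ := fun _ => N) hN))
  rw [← restrict_Ioo_eq_restrict_Ioc]
  exact ((h.continuousOn_integrand hf).mono Ioo_subset_Ico_self).aestronglyMeasurable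
    measurableSet_Ioo

theorem norm_integral_le {C τ : ℝ} (hC : ∀ t ∈ Ioc 0 τ, ‖K t‖ ≤ C * t ^ (-α)) {a t : ℝ}
    (hat : a ≤ t) (ht : t - a ≤ τ) {f : ℝ → X} {φ : ℝ → ℝ} (hφ : ∀ r ∈ Ico a t, ‖f r‖ ≤ φ r)
    (hφc : ContinuousOn φ (Icc a t)) :
    ‖∫ r in a..t, K (t - r) (f r)‖ ≤ C * ∫ r in a..t, (t - r) ^ (-α) * φ r := by
  rw [← intervalIntegral.integral_const_mul]
  exact intervalIntegral.norm_integral_le_of_norm_le hat (norm_integrand_le hC ht hφ)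
    ((intervalIntegrable_sub_rpow_mul h.mem_Ioo hat hφc).const_mul C)

theorem norm_integral_le_const {C τ : ℝ} (hC : ∀ t ∈ Ioc 0 τ, ‖K t‖ ≤ C * t ^ (-α)) {a t N : ℝ}
    (hat : a ≤ t) (ht : t - a ≤ τ) {f : ℝ → X} (hN : ∀ r ∈ Ico a t, ‖f r‖ ≤ N) :
    ‖∫ r in a..t, K (t - r) (f r)‖ ≤ C * N * ((t - a) ^ (1 - α) / (1 - α)) := by
  refine (h.norm_integral_le hC hat ht (φ := fun _ => N) hN continuousOn_const).trans_eq ?_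
  rw [intervalIntegral.integral_mul_const, integral_sub_rpow h.mem_Ioo]
  ring

/-- The convolution of the kernel with a bounded continuous function on `[0, τ)` is continuous on
the closed interval `[0, τ]`. -/
theorem continuousOn_integral {τ N : ℝ} {f : ℝ → X} (hf : ContinuousOn f (Ico 0 τ))
    (hN : ∀ r ∈ Ico 0 τ, ‖f r‖ ≤ N) :
    ContinuousOn (fun t => ∫ r in 0..t, K (t - r) (f r)) (Icc 0 τ) := by
  obtain ⟨C, hC0, hC⟩ := h.kernel_bound τ
  set H : ℝ → ℝ → X := fun t => (Iio t).indicator (fun σ => K σ (f (t - σ))) with hH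
  have hmem : ∀ t ∈ Icc 0 τ, ∀ σ ∈ Ioo 0 t, t - σ ∈ Ico 0 τ := fun t ht σ hσ =>
    ⟨sub_nonneg.2 hσ.2.le, by linarith [hσ.1, ht.2]⟩
  have hset : ∀ t ∈ Icc 0 τ, Ioc 0 τ ∩ Iio t = Ioo 0 t := fun t ht => by
    ext σ
    exact ⟨fun hσ => ⟨hσ.1.1, hσ.2⟩, fun hσ => ⟨⟨hσ.1, (hσ.2.trans_le ht.2).le⟩, hσ.2⟩⟩
  have hrepr : ∀ t ∈ Icc 0 τ, ∫ r in 0..t, K (t - r) (f r) = ∫ σ in Ioc 0 τ, H t σ := by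
    intro t ht
    have e1 := intervalIntegral.integral_comp_sub_left (a := 0) (b := t)
      (fun σ => K σ (f (t - σ))) t
    simp only [sub_sub_cancel, sub_zero, sub_self] at e1
    rw [e1, hH, setIntegral_indicator measurableSet_Iio, hset t ht,
      intervalIntegral.integral_of_le ht.1, integral_Ioc_eq_integral_Ioo]
  refine ContinuousOn.congr ?_ hrepr
  intro t₀ ht₀
  have hpow : IntegrableOn (fun σ : ℝ => C * σ ^ (-α) * max N 0) (Ioc 0 τ) := by
    have := (intervalIntegral.intervalIntegrable_rpow' (a := 0) (b := τ) (r := -α)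
      (by linarith [h.mem_Ioo.2]))
    rw [intervalIntegrable_iff_integrableOn_Ioc_of_le (ht₀.1.trans ht₀.2)] at this
    exact (this.const_mul C).mul_const _
  refine continuousWithinAt_of_dominated (bound := fun σ => C * σ ^ (-α) * max N 0) ?_ ?_ hpow ?_
  · filter_upwards [self_mem_nhdsWithin] with t ht
    rw [hH, aestronglyMeasurable_indicator_iff measurableSet_Iio, Measure.restrict_restrict
      measurableSet_Iio, inter_comm, hset t ht]
    refine ContinuousOn.aestronglyMeasurable ?_ measurableSet_Ioo
    exact (h.continuousOn_kernel.mono (fun σ hσ => hσ.1)).clm_apply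
      (hf.comp (by fun_prop) (hmem t ht))
  · filter_upwards [self_mem_nhdsWithin] with t ht
    refine (ae_restrict_iff' measurableSet_Ioc).2 (Eventually.of_forall fun σ hσ => ?_)
    have hσ0 : 0 ≤ σ ^ (-α) := Real.rpow_nonneg hσ.1.le _
    by_cases hσt : σ < t
    · simp only [hH]
      rw [indicator_of_mem (mem_Iio.2 hσt)]
      refine (ContinuousLinearMap.le_opNorm _ _).trans (mul_le_mul (hC σ hσ)
        ((hN _ (hmem t ht σ ⟨hσ.1, hσt⟩)).trans (le_max_left _ _)) (norm_nonneg _) (by positivity))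
    · simp only [hH]
      rw [indicator_of_notMem (by exact hσt), norm_zero]
      positivity
  · refine (ae_restrict_iff' measurableSet_Ioc).2 ?_
    filter_upwards [Measure.ae_ne volume t₀] with σ hσ hσm
    rcases lt_or_gt_of_ne hσ with hlt | hgt
    · have e1 : t₀ - σ ∈ Ioo 0 τ := ⟨sub_pos.2 hlt, by linarith [hσm.1, ht₀.2]⟩
      have e2 : ContinuousAt f (t₀ - σ) := hf.continuousAt (Ico_mem_nhds e1.1 e1.2)
      have e3 : ContinuousAt (fun t => K σ (f (t - σ))) t₀ :=
        (K σ).continuous.continuousAt.comp (ContinuousAt.comp' (f := fun t : ℝ => t - σ) e2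
          (by fun_prop))
      refine (e3.congr ?_).continuousWithinAt
      filter_upwards [Ioi_mem_nhds hlt] with t ht
      simp only [hH]
      rw [indicator_of_mem (by exact ht)]
    · refine ContinuousAt.continuousWithinAt (continuousAt_const (y := (0 : X)) |>.congr ?_)
      filter_upwards [Iio_mem_nhds hgt] with t ht
      simp only [hH]
      rw [indicator_of_notMem (by exact not_lt.2 (le_of_lt (mem_Iio.1 ht)))]

variable [CompleteSpace X]

/-- The variation of constants formula may be restarted at any intermediate time. -/
theorem restart {x : X} {a t : ℝ} (ha : 0 ≤ a) (hat : a < t) {f : ℝ → X}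
    (hf : ContinuousOn f (Icc 0 t)) :
    T t x + ∫ r in 0..t, K (t - r) (f r) =
      T (t - a) (T a x + ∫ r in 0..a, K (a - r) (f r)) + ∫ r in a..t, K (t - r) (f r) := by
  obtain ⟨N, hN⟩ := isCompact_Icc.exists_bound_of_continuousOn hf
  have h0t : 0 ≤ t := ha.trans hat.le
  have hs : Ico 0 t ⊆ Icc 0 t := Ico_subset_Icc_self
  have hsa : Ico 0 a ⊆ Icc 0 t := fun r hr => ⟨hr.1, (hr.2.trans hat).le⟩
  have i1 := h.intervalIntegrable h0t (hf.mono hs) (fun r hr => hN r (hs hr))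
  have i2 := h.intervalIntegrable ha (hf.mono hsa) (fun r hr => hN r (hsa hr))
  have hT : T t x = T (t - a) (T a x) := by
    have := h.isC0Semigroup.add (t - a) a (sub_nonneg.2 hat.le) ha
    rw [sub_add_cancel] at this
    rw [this]; rfl
  have hI : T (t - a) (∫ r in 0..a, K (a - r) (f r)) = ∫ r in 0..a, K (t - r) (f r) := by
    rw [← ContinuousLinearMap.intervalIntegral_comp_comm _ i2]
    refine intervalIntegral.integral_congr_ae ?_
    filter_upwards [Measure.ae_ne volume a] with r hr hra
    rw [uIoc_of_le ha] at hra
    have e := h.kernel_add (t - a) (a - r) (sub_pos.2 hat) (sub_pos.2 (lt_of_le_of_ne hra.2 hr))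
    rw [sub_add_sub_cancel] at e
    rw [e]; rfl
  have i3 : IntervalIntegrable (fun r => K (t - r) (f r)) volume 0 a :=
    i1.mono_set (by rw [uIcc_of_le ha, uIcc_of_le h0t]; exact Icc_subset_Icc_right hat.le)
  have i4 : IntervalIntegrable (fun r => K (t - r) (f r)) volume a t :=
    i1.mono_set (by rw [uIcc_of_le hat.le, uIcc_of_le h0t]; exact Icc_subset_Icc_left ha)
  rw [map_add, ← hT, hI, add_assoc, intervalIntegral.integral_add_adjacent_intervals i3 i4]

end IsSmoothingPair

end Convolution

/-! ### The Volterra equation: a priori estimates -/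

section Volterra

variable {X : Type*} [NormedAddCommGroup X]

/-- A parametrized nonlinearity: continuous, locally Lipschitz in space uniformly in the parameter
and in time, and of linear growth with the time-dependent bound `c`. -/
structure IsAdmissible {S : Type*} [TopologicalSpace S] (G : S → ℝ → X → X) (c : ℝ → ℝ) :
    Prop where
  continuousOn : ContinuousOn (fun p : S × ℝ × X => G p.1 p.2.1 p.2.2) {p | 0 ≤ p.2.1}
  lipschitz : ∀ x : X, ∃ V ∈ 𝓝 x, ∃ L : ℝ, ∀ s, ∀ t, 0 ≤ t → ∀ y ∈ V, ∀ z ∈ V,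
    ‖G s t y - G s t z‖ ≤ L * ‖y - z‖
  growth : ∀ s t, 0 ≤ t → ∀ y, ‖G s t y‖ ≤ c t * (1 + ‖y‖)
  continuousOn_bound : ContinuousOn c (Ici 0)

namespace IsAdmissible

variable {S : Type*} [TopologicalSpace S] {G : S → ℝ → X → X} {c : ℝ → ℝ} (hG : IsAdmissible G c)
include hG

theorem comp_add {t₀ : ℝ} (ht₀ : 0 ≤ t₀) :
    IsAdmissible (fun s t => G s (t₀ + t)) (fun t => c (t₀ + t)) where
  continuousOn := hG.continuousOn.comp (f := fun p : S × ℝ × X => (p.1, t₀ + p.2.1, p.2.2))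
    (by fun_prop) fun p hp => add_nonneg ht₀ hp
  lipschitz x := by
    obtain ⟨V, hV, L, hL⟩ := hG.lipschitz x
    exact ⟨V, hV, L, fun s t ht => hL s _ (add_nonneg ht₀ ht)⟩
  growth s t ht := hG.growth s _ (add_nonneg ht₀ ht)
  continuousOn_bound := hG.continuousOn_bound.comp (by fun_prop) fun t ht =>
    add_nonneg ht₀ (mem_Ici.1 ht)

theorem continuousOn_comp {J : Set ℝ} (hJ : J ⊆ Ici 0) (s : S) {v : ℝ → X}
    (hv : ContinuousOn v J) : ContinuousOn (fun r => G s r (v r)) J :=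
  hG.continuousOn.comp (f := fun r => (s, r, v r))
    (continuousOn_const.prodMk (continuousOn_id.prodMk hv)) fun _ hr => mem_Ici.1 (hJ hr)

theorem exists_growth_le (τ : ℝ) :
    ∃ N, 0 ≤ N ∧ ∀ s, ∀ t ∈ Icc 0 τ, ∀ y, ‖G s t y‖ ≤ N * (1 + ‖y‖) := by
  obtain ⟨N, hN⟩ := isCompact_Icc.exists_bound_of_continuousOn
    (hG.continuousOn_bound.mono (fun r (hr : r ∈ Icc 0 τ) => mem_Ici.2 hr.1))
  refine ⟨max N 0, le_max_right _ _, fun s t ht y => (hG.growth s t ht.1 y).trans ?_⟩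
  gcongr
  exact ((le_abs_self _).trans (hN t ht)).trans (le_max_left _ _)

/-- Near a compact set the local Lipschitz constants can be chosen uniformly. -/
theorem exists_lipschitz_near {Q : Set X} (hQ : IsCompact Q) :
    ∃ ε > 0, ∃ L, 0 ≤ L ∧ ∀ s t, 0 ≤ t → ∀ x ∈ Q, ∀ y, ‖y - x‖ < ε →
      ‖G s t y - G s t x‖ ≤ L * ‖y - x‖ := by
  refine hQ.induction_on (p := fun Q => ∃ ε > 0, ∃ L, 0 ≤ L ∧ ∀ s t, 0 ≤ t → ∀ x ∈ Q, ∀ y,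
    ‖y - x‖ < ε → ‖G s t y - G s t x‖ ≤ L * ‖y - x‖) ?_ ?_ ?_ ?_
  · exact ⟨1, one_pos, 0, le_rfl, fun _ _ _ x hx => absurd hx (notMem_empty x)⟩
  · rintro P Q hPQ ⟨ε, hε, L, hL, h⟩
    exact ⟨ε, hε, L, hL, fun s t ht x hx => h s t ht x (hPQ hx)⟩
  · rintro P Q ⟨ε₁, hε₁, L₁, hL₁, h₁⟩ ⟨ε₂, hε₂, L₂, hL₂, h₂⟩
    refine ⟨min ε₁ ε₂, lt_min hε₁ hε₂, max L₁ L₂, le_max_of_le_left hL₁, ?_⟩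
    rintro s t ht x (hx | hx) y hy
    · exact (h₁ s t ht x hx y (hy.trans_le (min_le_left _ _))).trans
        (by gcongr; exact le_max_left _ _)
    · exact (h₂ s t ht x hx y (hy.trans_le (min_le_right _ _))).trans
        (by gcongr; exact le_max_right _ _)
  · intro x _
    obtain ⟨V, hV, L, hL⟩ := hG.lipschitz x
    obtain ⟨r, hr, hrV⟩ := Metric.mem_nhds_iff.1 hV
    refine ⟨Metric.ball x (r / 2),
      mem_nhdsWithin_of_mem_nhds (Metric.ball_mem_nhds x (by linarith)),
      r / 2, by linarith, max L 0, le_max_right _ _, fun s t ht y hy z hz => ?_⟩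
    have hy' : y ∈ V := hrV (Metric.ball_subset_ball (by linarith) hy)
    have hz' : z ∈ V := hrV (by
      rw [Metric.mem_ball] at hy ⊢
      have := dist_triangle z y x
      rw [dist_eq_norm z y] at this
      linarith)
    exact (hL s t ht z hz' y hy').trans (by gcongr; exact le_max_left _ _)

end IsAdmissible

variable [NormedSpace ℝ X]

/-- `v` solves `v t = T t x + ∫₀ᵗ K (t - r) (g r (v r)) dr` on `[0, τ]`. -/
structure IsVolterraSolution (T K : ℝ → X →L[ℝ] X) (g : ℝ → X → X) (x : X) (τ : ℝ)
    (v : ℝ → X) : Prop where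
  continuousOn : ContinuousOn v (Icc 0 τ)
  eq : ∀ t ∈ Icc 0 τ, v t = T t x + ∫ r in 0..t, K (t - r) (g r (v r))

namespace IsSmoothingPair

variable {α : ℝ} {T K : ℝ → X →L[ℝ] X} (h : IsSmoothingPair α T K) [CompleteSpace X]
include h

/-- Gronwall estimate for the variation of constants formula. -/
theorem exists_gronwall_const {L : ℝ} (hL : 0 ≤ L) (τ₀ : ℝ) :
    ∃ Γ, 0 ≤ Γ ∧ ∀ τ ≤ τ₀, ∀ (x : X) (f y : ℝ → X) (η : ℝ), 0 ≤ η → ContinuousOn y (Icc 0 τ) →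
      (∀ t ∈ Icc 0 τ, y t = T t x + ∫ r in 0..t, K (t - r) (f r)) →
      (∀ r ∈ Ico 0 τ, ‖f r‖ ≤ L * ‖y r‖ + η) → ∀ t ∈ Icc 0 τ, ‖y t‖ ≤ Γ * (‖x‖ + η) := by
  obtain ⟨M, hM0, hM⟩ := h.isC0Semigroup.exists_bound τ₀
  obtain ⟨C, hC0, hC⟩ := h.kernel_bound τ₀
  obtain ⟨θ, hθ, hbθ⟩ := exists_exp_rate h.mem_Ioo (C * L)
  have h1α : 0 < 1 - α := by linarith [h.mem_Ioo.2]
  set D := max M (C * (τ₀ ^ (1 - α) / (1 - α))) with hD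
  have hD0 : 0 ≤ D := le_max_of_le_left hM0
  refine ⟨2 * D * Real.exp (θ * τ₀), by positivity, ?_⟩
  intro τ hτ x f y η hη hy heq hf t ht
  have hle : ∀ t ∈ Icc 0 τ, ‖y t‖ ≤
      D * (‖x‖ + η) + C * L * ∫ r in 0..t, (t - r) ^ (-α) * ‖y r‖ := by
    intro t ht
    have hsub : Icc 0 t ⊆ Icc 0 τ := Icc_subset_Icc_right ht.2
    have hyn : ContinuousOn (fun r => ‖y r‖) (Icc 0 t) := (hy.mono hsub).norm
    have e1 := h.norm_integral_le hC ht.1 (by linarith [ht.2]) (φ := fun r => L * ‖y r‖ + η)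
      (fun r hr => hf r ⟨hr.1, hr.2.trans_le ht.2⟩) (by fun_prop)
    have e2 : ∫ r in 0..t, (t - r) ^ (-α) * (L * ‖y r‖ + η) =
        L * (∫ r in 0..t, (t - r) ^ (-α) * ‖y r‖) + (t ^ (1 - α) / (1 - α)) * η := by
      have := integral_sub_rpow h.mem_Ioo 0 t
      rw [sub_zero] at this
      rw [← this, ← intervalIntegral.integral_const_mul, ← intervalIntegral.integral_mul_const,
        ← intervalIntegral.integral_add
          ((intervalIntegrable_sub_rpow_mul h.mem_Ioo ht.1 hyn).const_mul L)
          ((intervalIntegrable_sub_rpow h.mem_Ioo 0 t).mul_const η)]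
      congr 1
      ext r
      ring
    have e3 : t ^ (1 - α) ≤ τ₀ ^ (1 - α) := Real.rpow_le_rpow ht.1 (ht.2.trans hτ) h1α.le
    have e4 : ‖T t x‖ ≤ D * ‖x‖ := (ContinuousLinearMap.le_opNorm _ _).trans (by
      gcongr
      exact (hM t ⟨ht.1, ht.2.trans hτ⟩).trans (le_max_left _ _))
    have e5 : C * (t ^ (1 - α) / (1 - α)) * η ≤ D * η := by
      gcongr
      exact le_trans (by gcongr) (le_max_right _ _)
    rw [e2] at e1
    rw [heq t ht]
    refine (norm_add_le _ _).trans ?_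
    calc _ ≤ D * ‖x‖ + C * (L * (∫ r in 0..t, (t - r) ^ (-α) * ‖y r‖) +
          (t ^ (1 - α) / (1 - α)) * η) := add_le_add e4 e1
      _ = D * ‖x‖ + C * (t ^ (1 - α) / (1 - α)) * η +
          C * L * (∫ r in 0..t, (t - r) ^ (-α) * ‖y r‖) := by ring
      _ ≤ D * ‖x‖ + D * η + C * L * (∫ r in 0..t, (t - r) ^ (-α) * ‖y r‖) := by gcongr
      _ = _ := by ring
  have e6 := le_of_singular_integral_le h.mem_Ioo (mul_nonneg hC0 hL) hθ hbθ
    (mul_nonneg hD0 (add_nonneg (norm_nonneg x) hη)) hy.norm (fun _ _ => norm_nonneg _) hle t ht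
  calc ‖y t‖ ≤ 2 * (D * (‖x‖ + η)) * Real.exp (θ * t) := e6
    _ ≤ 2 * (D * (‖x‖ + η)) * Real.exp (θ * τ₀) := by
        gcongr
        exact ht.2.trans hτ
    _ = _ := by ring

variable {S : Type*} [TopologicalSpace S] {G : S → ℝ → X → X} {c : ℝ → ℝ}

/-- Linear growth bounds all solutions with initial values in a given ball. -/
theorem exists_norm_solution_le (hG : IsAdmissible G c) (τ₀ R : ℝ) :
    ∃ B, ∀ τ ≤ τ₀, ∀ s x v, ‖x‖ ≤ R → IsVolterraSolution T K (G s) x τ v →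
      ∀ t ∈ Icc 0 τ, ‖v t‖ ≤ B := by
  obtain ⟨N, hN0, hN⟩ := hG.exists_growth_le τ₀
  obtain ⟨Γ, hΓ0, hΓ⟩ := h.exists_gronwall_const hN0 τ₀
  refine ⟨Γ * (R + N), fun τ hτ s x v hx hv t ht => ?_⟩
  refine (hΓ τ hτ x (fun r => G s r (v r)) v N hN0 hv.continuousOn hv.eq (fun r hr => ?_) t
    ht).trans (by gcongr)
  exact (hN s r ⟨hr.1, hr.2.le.trans hτ⟩ (v r)).trans_eq (by ring)

/-- Two solutions whose data are close stay in the tube around the first one in which the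
nonlinearity is Lipschitz, and their distance is controlled there. -/
theorem exists_tube_const {L : ℝ} (hL : 0 ≤ L) (τ : ℝ) :
    ∃ Γ, 0 ≤ Γ ∧ ∀ (g g' : ℝ → X → X) (x x' : X) (u v : ℝ → X) (ε η : ℝ), 0 ≤ η →
      IsVolterraSolution T K g x τ u → IsVolterraSolution T K g' x' τ v →
      ContinuousOn (fun r => g r (u r)) (Icc 0 τ) → ContinuousOn (fun r => g' r (v r)) (Icc 0 τ) →
      (∀ t ∈ Icc 0 τ, ‖g' t (u t) - g t (u t)‖ ≤ η) →
      (∀ t ∈ Icc 0 τ, ∀ y, ‖y - u t‖ < ε → ‖g' t y - g' t (u t)‖ ≤ L * ‖y - u t‖) →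
      Γ * (‖x' - x‖ + η) < ε → ∀ t ∈ Icc 0 τ, ‖v t - u t‖ ≤ Γ * (‖x' - x‖ + η) := by
  obtain ⟨Γ, hΓ0, hΓ⟩ := h.exists_gronwall_const hL τ
  refine ⟨Γ, hΓ0, fun g g' x x' u v ε η hη hu hv hgu hgv hclose hlip hsmall => ?_⟩
  have hw : ContinuousOn (fun t => v t - u t) (Icc 0 τ) := hv.continuousOn.sub hu.continuousOn
  have heq : ∀ t ∈ Icc 0 τ, v t - u t = T t (x' - x) +
      ∫ r in 0..t, K (t - r) (g' r (v r) - g r (u r)) := by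
    intro t ht
    have hs : Ico 0 t ⊆ Icc 0 τ := fun r hr => ⟨hr.1, hr.2.le.trans ht.2⟩
    obtain ⟨N₁, hN₁⟩ := isCompact_Icc.exists_bound_of_continuousOn hgu
    obtain ⟨N₂, hN₂⟩ := isCompact_Icc.exists_bound_of_continuousOn hgv
    have i1 := h.intervalIntegrable ht.1 (hgu.mono hs) (fun r hr => hN₁ r (hs hr))
    have i2 := h.intervalIntegrable ht.1 (hgv.mono hs) (fun r hr => hN₂ r (hs hr))
    simp only [map_sub]
    rw [intervalIntegral.integral_sub i2 i1, hv.eq t ht, hu.eq t ht]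
    abel
  -- the estimate on `[0, σ]`, as long as the tube has not been left before `σ`
  have hupto : ∀ σ ≤ τ, (∀ r ∈ Ico 0 σ, ‖v r - u r‖ < ε) →
      ∀ t ∈ Icc 0 σ, ‖v t - u t‖ ≤ Γ * (‖x' - x‖ + η) := by
    intro σ hσ hin
    have hsub : Icc 0 σ ⊆ Icc 0 τ := Icc_subset_Icc_right hσ
    refine hΓ σ hσ (x' - x) (fun r => g' r (v r) - g r (u r)) (fun t => v t - u t) η hη
      (hw.mono hsub) (fun t ht => heq t (hsub ht)) fun r hr => ?_
    have hr' : r ∈ Icc 0 τ := hsub (Ico_subset_Icc_self hr)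
    calc ‖g' r (v r) - g r (u r)‖ = ‖(g' r (v r) - g' r (u r)) + (g' r (u r) - g r (u r))‖ := by
          rw [sub_add_sub_cancel]
      _ ≤ _ := (norm_add_le _ _).trans (add_le_add (hlip r hr' _ (hin r hr)) (hclose r hr'))
  have hnever : ∀ t ∈ Icc 0 τ, ‖v t - u t‖ < ε := by
    by_contra! hex
    obtain ⟨t, ht, hte⟩ := hex
    have hcl : IsClosed (Icc 0 τ ∩ (fun t => ‖v t - u t‖) ⁻¹' Ici ε) :=
      hw.norm.preimage_isClosed_of_isClosed isClosed_Icc isClosed_Ici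
    obtain ⟨σ, ⟨hσ, hσε⟩, hmin⟩ := (isCompact_Icc.of_isClosed_subset hcl
      inter_subset_left).exists_isLeast ⟨t, ht, hte⟩
    have h1 := hupto σ hσ.2 (fun r hr => by
      by_contra! hr'
      exact absurd (hmin ⟨⟨hr.1, hr.2.le.trans hσ.2⟩, hr'⟩) (not_le.2 hr.2)) σ ⟨hσ.1, le_rfl⟩
    exact absurd (h1.trans_lt hsmall) (not_lt.2 hσε)
  exact hupto τ le_rfl fun r hr => hnever r (Ico_subset_Icc_self hr)

end IsSmoothingPair

end Volterra

/-! ### The Volterra equation: uniqueness, continuous dependence, compactness -/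

section Volterra

variable {X : Type*} [NormedAddCommGroup X] [NormedSpace ℝ X]

theorem IsVolterraSolution.mono {T K : ℝ → X →L[ℝ] X} {g : ℝ → X → X} {x : X} {τ τ' : ℝ}
    {v : ℝ → X} (hv : IsVolterraSolution T K g x τ v) (hτ : τ' ≤ τ) :
    IsVolterraSolution T K g x τ' v :=
  ⟨hv.continuousOn.mono (Icc_subset_Icc_right hτ), fun t ht => hv.eq t ⟨ht.1, ht.2.trans hτ⟩⟩

namespace IsSmoothingPair

variable {α : ℝ} {T K : ℝ → X →L[ℝ] X} (h : IsSmoothingPair α T K) [CompleteSpace X]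
  {S : Type*} [TopologicalSpace S] {G : S → ℝ → X → X} {c : ℝ → ℝ} (hG : IsAdmissible G c)
include h hG

theorem solution_unique {s : S} {x : X} {τ : ℝ} {u v : ℝ → X}
    (hu : IsVolterraSolution T K (G s) x τ u) (hv : IsVolterraSolution T K (G s) x τ v) :
    EqOn u v (Icc 0 τ) := by
  obtain ⟨ε, hε, L, hL, hlip⟩ :=
    hG.exists_lipschitz_near (isCompact_Icc.image_of_continuousOn hu.continuousOn)
  obtain ⟨Γ, -, hΓ⟩ := h.exists_tube_const hL τ
  have hsub : Icc 0 τ ⊆ Ici 0 := fun r hr => mem_Ici.2 hr.1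
  intro t ht
  have h1 := hΓ (G s) (G s) x x u v ε 0 le_rfl hu hv (hG.continuousOn_comp hsub s hu.continuousOn)
    (hG.continuousOn_comp hsub s hv.continuousOn) (fun t _ => by simp)
    (fun t ht y hy => hlip s t ht.1 (u t) (mem_image_of_mem u ht) y hy) (by simpa using hε) t ht
  rw [sub_self, norm_zero, add_zero, mul_zero] at h1
  exact (sub_eq_zero.1 (norm_le_zero_iff.1 h1)).symm

/-- The value at a fixed time depends continuously on the parameter and the initial value. -/
theorem continuous_solution {U : S → X → ℝ → X} {t : ℝ} (ht : 0 ≤ t)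
    (hU : ∀ s x, IsVolterraSolution T K (G s) x t (U s x)) :
    Continuous fun p : S × X => U p.1 p.2 t := by
  rw [continuous_iff_continuousAt]
  rintro ⟨s₀, x₀⟩
  have hsub : Icc 0 t ⊆ Ici 0 := fun r hr => mem_Ici.2 hr.1
  have hu := hU s₀ x₀
  set u := U s₀ x₀ with hudef
  obtain ⟨ε, hε, L, hL, hlip⟩ :=
    hG.exists_lipschitz_near (isCompact_Icc.image_of_continuousOn hu.continuousOn)
  obtain ⟨Γ, hΓ0, hΓ⟩ := h.exists_tube_const hL t
  rw [Metric.continuousAt_iff']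
  intro κ hκ
  -- `ρ` bounds both the perturbation of the initial value and that of the nonlinearity
  obtain ⟨ρ, hρ, hρ'⟩ : ∃ ρ > 0, Γ * (ρ + ρ) < min ε κ := by
    have h0 : 0 < min ε κ := lt_min hε hκ
    refine ⟨min ε κ / (4 * (Γ + 1)), by positivity, ?_⟩
    have : Γ * (min ε κ / (4 * (Γ + 1)) + min ε κ / (4 * (Γ + 1))) =
        (Γ / (Γ + 1)) * (min ε κ / 2) := by field_simp; ring
    rw [this]
    have h2 : Γ / (Γ + 1) ≤ 1 := by rw [div_le_one (by positivity)]; linarith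
    nlinarith
  have hcont : ContinuousOn (Function.uncurry fun (s : S) r => G s r (u r)) (univ ×ˢ Icc 0 t) := by
    refine hG.continuousOn.comp (f := fun p : S × ℝ => (p.1, p.2, u p.2)) ?_ fun p hp => hp.2.1
    exact continuousOn_fst.prodMk (continuousOn_snd.prodMk
      (hu.continuousOn.comp continuousOn_snd fun p hp => hp.2))
  obtain ⟨W, hW, hWu⟩ := isCompact_Icc.mem_uniformity_of_prod hcont (mem_univ s₀)
    (Metric.dist_mem_uniformity hρ)
  rw [nhdsWithin_univ] at hW
  filter_upwards [prod_mem_nhds hW (Metric.ball_mem_nhds x₀ hρ)] with p hp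
  have hx : ‖p.2 - x₀‖ ≤ ρ := by
    rw [← dist_eq_norm]; exact le_of_lt (Metric.mem_ball.1 hp.2)
  have hle : Γ * (‖p.2 - x₀‖ + ρ) ≤ Γ * (ρ + ρ) := by gcongr
  have h1 := hΓ (G s₀) (G p.1) x₀ p.2 u (U p.1 p.2) ε ρ hρ.le hu (hU p.1 p.2)
    (hG.continuousOn_comp hsub s₀ hu.continuousOn)
    (hG.continuousOn_comp hsub p.1 (hU p.1 p.2).continuousOn)
    (fun r hr => by rw [← dist_eq_norm]; exact le_of_lt (hWu p.1 hp.1 r hr))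
    (fun r hr y hy => hlip p.1 r hr.1 (u r) (mem_image_of_mem u hr) y hy)
    (hle.trans_lt (hρ'.trans_le (min_le_left _ _))) t ⟨ht, le_rfl⟩
  rw [dist_eq_norm]
  exact (h1.trans hle).trans_lt (hρ'.trans_le (min_le_right _ _))

/-- Compactness of the semigroup: up to an arbitrarily small error, the values at time `t` are
images of values at time `t - ε`, which stay in a fixed ball, under the compact operator `T ε`. -/
theorem isCompact_closure_values {t R : ℝ} (ht : 0 < t) :
    IsCompact (closure {y : X | ∃ s x v, ‖x‖ ≤ R ∧ IsVolterraSolution T K (G s) x t v ∧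
      y = v t}) := by
  obtain ⟨B, hB⟩ := h.exists_norm_solution_le hG t R
  obtain ⟨N, hN0, hN⟩ := hG.exists_growth_le t
  obtain ⟨C, hC0, hC⟩ := h.kernel_bound t
  refine isCompact_iff_totallyBounded_isComplete.2
    ⟨TotallyBounded.closure ?_, isClosed_closure.isComplete⟩
  rw [Metric.totallyBounded_iff]
  intro κ hκ
  obtain ⟨e, he0, het, heκ⟩ : ∃ e, 0 < e ∧ e ≤ t ∧
      C * (N * (1 + B)) * (e ^ (1 - α) / (1 - α)) < κ / 2 := by
    have h1 : Tendsto (fun e : ℝ => C * (N * (1 + B)) * (e ^ (1 - α) / (1 - α)))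
        (𝓝[>] 0) (𝓝 0) := by
      have := ((Real.continuousAt_rpow_const 0 (1 - α)
        (Or.inr (by linarith [h.mem_Ioo.2]))).tendsto.div_const (1 - α)).const_mul
        (C * (N * (1 + B)))
      rw [Real.zero_rpow (by linarith [h.mem_Ioo.2]), zero_div, mul_zero] at this
      exact this.mono_left nhdsWithin_le_nhds
    obtain ⟨e, h2, h3⟩ := ((h1.eventually_lt_const (half_pos hκ)).and
      (Ioc_mem_nhdsGT ht)).exists
    exact ⟨e, h3.1, h3.2, h2⟩
  have hcomp : TotallyBounded (T e '' Metric.closedBall 0 B) :=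
    ((h.isCompactOperator e he0).isCompact_closure_image_closedBall B).totallyBounded.subset
      subset_closure
  obtain ⟨F, hF, hFc⟩ := Metric.totallyBounded_iff.1 hcomp (κ / 2) (half_pos hκ)
  refine ⟨F, hF, ?_⟩
  rintro y ⟨s, x, v, hx, hv, rfl⟩
  have hsub : Icc 0 t ⊆ Ici 0 := fun r hr => mem_Ici.2 hr.1
  have hte : 0 ≤ t - e := sub_nonneg.2 het
  have h1 := h.restart (x := x) hte (by linarith : t - e < t)
    (hG.continuousOn_comp hsub s hv.continuousOn)
  rw [← hv.eq t ⟨ht.le, le_rfl⟩, ← hv.eq (t - e) ⟨hte, by linarith⟩, sub_sub_cancel] at h1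
  have h2 : ‖∫ r in (t - e)..t, K (t - r) (G s r (v r))‖ < κ / 2 := by
    refine lt_of_le_of_lt ?_ heκ
    have := h.norm_integral_le_const hC (a := t - e) (t := t) (N := N * (1 + B)) (by linarith)
      (by linarith) (f := fun r => G s r (v r)) fun r hr => by
        have hr' : r ∈ Icc 0 t := ⟨hte.trans hr.1, hr.2.le⟩
        exact (hN s r hr' _).trans (by gcongr; exact hB t le_rfl s x v hx hv r hr')
    rwa [sub_sub_cancel] at this
  have h3 : T e (v (t - e)) ∈ T e '' Metric.closedBall 0 B :=
    mem_image_of_mem _ (by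
      rw [mem_closedBall_zero_iff]; exact hB t le_rfl s x v hx hv _ ⟨hte, by linarith⟩)
  obtain ⟨z, hz, hzb⟩ := mem_iUnion₂.1 (hFc h3)
  refine mem_iUnion₂.2 ⟨z, hz, ?_⟩
  rw [Metric.mem_ball] at hzb ⊢
  have h4 : dist (v t) (T e (v (t - e))) < κ / 2 := by
    rw [dist_eq_norm, h1, add_sub_cancel_left]; exact h2
  linarith [dist_triangle (v t) (T e (v (t - e))) z]

/-- A solution on `[0, τ)` with values in a bounded set has a continuation to `[0, τ]`, given by
the variation of constants formula itself. -/
theorem exists_solution_of_Ico {s : S} {x : X} {τ : ℝ}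
    (hex : ∀ τ' ∈ Ico 0 τ, ∃ v, IsVolterraSolution T K (G s) x τ' v) :
    ∃ v, IsVolterraSolution T K (G s) x τ v := by
  obtain ⟨B, hB⟩ := h.exists_norm_solution_le hG τ ‖x‖
  obtain ⟨N, hN0, hN⟩ := hG.exists_growth_le τ
  have hex' : ∀ τ', ∃ v, τ' ∈ Ico 0 τ → IsVolterraSolution T K (G s) x τ' v := fun τ' => by
    by_cases h0 : τ' ∈ Ico 0 τ
    · obtain ⟨v, hv⟩ := hex τ' h0
      exact ⟨v, fun _ => hv⟩
    · exact ⟨0, fun h1 => absurd h1 h0⟩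
  choose w hw using hex'
  set u : ℝ → X := fun t => w t t with hu
  have huw : ∀ t' ∈ Ico 0 τ, EqOn u (w t') (Icc 0 t') := fun t' ht' t ht =>
    h.solution_unique hG (hw t ⟨ht.1, ht.2.trans_lt ht'.2⟩) ((hw t' ht').mono ht.2) ⟨ht.1, le_rfl⟩
  have huc : ContinuousOn u (Ico 0 τ) := by
    intro t ht
    obtain ⟨t', h1, h2⟩ := exists_between ht.2
    have h3 : t' ∈ Ico 0 τ := ⟨ht.1.trans h1.le, h2⟩
    have h4 : ContinuousWithinAt u (Icc 0 t') t :=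
      ((hw t' h3).continuousOn.congr (huw t' h3)) t ⟨ht.1, h1.le⟩
    refine h4.mono_of_mem_nhdsWithin ?_
    filter_upwards [self_mem_nhdsWithin, nhdsWithin_le_nhds (Iio_mem_nhds h1)] with r hr hr'
    exact ⟨hr.1, le_of_lt hr'⟩
  have hsub : Ico 0 τ ⊆ Ici 0 := fun r hr => mem_Ici.2 hr.1
  have hg : ContinuousOn (fun r => G s r (u r)) (Ico 0 τ) := hG.continuousOn_comp hsub s huc
  have hgN : ∀ r ∈ Ico 0 τ, ‖G s r (u r)‖ ≤ N * (1 + B) := fun r hr =>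
    (hN s r (Ico_subset_Icc_self hr) _).trans (by
      gcongr
      exact hB r hr.2.le s x (w r) le_rfl (hw r hr) r ⟨hr.1, le_rfl⟩)
  set z : ℝ → X := fun t => T t x + ∫ r in 0..t, K (t - r) (G s r (u r)) with hz
  have hzu : ∀ t ∈ Ico 0 τ, z t = u t := by
    intro t ht
    refine Eq.trans ?_ ((hw t ht).eq t ⟨ht.1, le_rfl⟩).symm
    simp only [hz]
    congr 1
    refine intervalIntegral.integral_congr fun r hr => ?_
    rw [uIcc_of_le ht.1] at hr
    rw [← huw t ht hr]
  refine ⟨z, ?_, fun t ht => ?_⟩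
  · refine ContinuousOn.add ?_ (h.continuousOn_integral hg hgN)
    exact (h.isC0Semigroup.continuousOn x).mono fun r hr => mem_Ici.2 hr.1
  · rw [hz]
    simp only
    congr 1
    refine intervalIntegral.integral_congr_ae ?_
    filter_upwards [Measure.ae_ne volume τ] with r hr hrt
    rw [uIoc_of_le ht.1] at hrt
    have := hzu r ⟨hrt.1.le, lt_of_le_of_ne (hrt.2.trans ht.2) hr⟩
    rw [hz] at this
    simp only at this
    rw [this]

end IsSmoothingPair

end Volterra

/-! ### The Volterra equation: existence -/

section Volterra

variable {X : Type*} [NormedAddCommGroup X] [NormedSpace ℝ X]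

namespace IsSmoothingPair

variable {α : ℝ} {T K : ℝ → X →L[ℝ] X} (h : IsSmoothingPair α T K) [CompleteSpace X]
  {S : Type*} [TopologicalSpace S] {G : S → ℝ → X → X} {c : ℝ → ℝ} (hG : IsAdmissible G c)
include h hG

/-- Local existence by the contraction principle in a ball of `C([0, τ], X)` around the constant
function `x`. -/
theorem exists_local_solution (s : S) (x : X) :
    ∃ τ > 0, ∃ v, IsVolterraSolution T K (G s) x τ v := by
  have h1α : 0 < 1 - α := by linarith [h.mem_Ioo.2]
  obtain ⟨V, hV, L', hL'⟩ := hG.lipschitz x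
  obtain ⟨ε, hε, hεV⟩ := Metric.mem_nhds_iff.1 hV
  obtain ⟨N', hN0, hN⟩ := hG.exists_growth_le 1
  obtain ⟨C, hC0, hC⟩ := h.kernel_bound 1
  set r := ε / 2 with hr
  have hr0 : 0 < r := half_pos hε
  set L := max L' 0 with hLdef
  have hL0 : 0 ≤ L := le_max_right _ _
  have hL : ∀ t, 0 ≤ t → ∀ y ∈ Metric.closedBall x r, ∀ z ∈ Metric.closedBall x r,
      ‖G s t y - G s t z‖ ≤ L * ‖y - z‖ := fun t ht y hy z hz =>
    (hL' s t ht y (hεV (Metric.closedBall_subset_ball (by linarith) hy)) z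
      (hεV (Metric.closedBall_subset_ball (by linarith) hz))).trans
        (by gcongr; exact le_max_left _ _)
  set N := N' * (1 + (‖x‖ + r)) with hNdef
  have hNr : ∀ t ∈ Icc (0 : ℝ) 1, ∀ y ∈ Metric.closedBall x r, ‖G s t y‖ ≤ N := fun t ht y hy => by
    refine (hN s t ht y).trans ?_
    rw [hNdef]
    gcongr
    rw [Metric.mem_closedBall, dist_eq_norm] at hy
    calc ‖y‖ = ‖x + (y - x)‖ := by rw [add_sub_cancel]
      _ ≤ _ := (norm_add_le _ _).trans (by gcongr)
  have htend : ∀ b : ℝ, Tendsto (fun e : ℝ => b * (e ^ (1 - α) / (1 - α))) (𝓝[>] 0) (𝓝 0) := by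
    intro b
    have := ((Real.continuousAt_rpow_const 0 (1 - α) (Or.inr h1α.le)).tendsto.div_const
      (1 - α)).const_mul b
    rw [Real.zero_rpow h1α.ne', zero_div, mul_zero] at this
    exact this.mono_left nhdsWithin_le_nhds
  have hT0 : ∀ᶠ e in 𝓝[>] (0 : ℝ), ∀ t ∈ Icc 0 e, ‖T t x - x‖ ≤ r / 2 := by
    have e1 : Tendsto (fun t => T t x) (𝓝[≥] 0) (𝓝 x) := by
      have := h.isC0Semigroup.continuousOn x 0 (mem_Ici.2 le_rfl)
      rw [ContinuousWithinAt, h.isC0Semigroup.zero] at this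
      exact this
    have e2 := e1 (Metric.closedBall_mem_nhds x (half_pos hr0))
    obtain ⟨e, he, hes⟩ := (mem_nhdsGE_iff_exists_Icc_subset).1 e2
    filter_upwards [Ioc_mem_nhdsGT (mem_Ioi.1 he)] with e' he' t ht
    have := hes ⟨ht.1, ht.2.trans he'.2⟩
    rwa [mem_preimage, Metric.mem_closedBall, dist_eq_norm] at this
  obtain ⟨τ, hτT, hτN, hτL, hτ⟩ := (hT0.and (((htend (C * N)).eventually_le_const
    (half_pos hr0)).and (((htend (C * L)).eventually_le_const (half_pos one_pos)).and
      (Ioc_mem_nhdsGT one_pos)))).exists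
  have hτ0 : 0 ≤ τ := hτ.1.le
  have hI1 : ∀ t ∈ Icc 0 τ, t ∈ Icc (0 : ℝ) 1 := fun t ht => ⟨ht.1, ht.2.trans hτ.2⟩
  have hsub : Icc 0 τ ⊆ Ici 0 := fun r hr => mem_Ici.2 hr.1
  have hpow : ∀ t ∈ Icc 0 τ, t ^ (1 - α) / (1 - α) ≤ τ ^ (1 - α) / (1 - α) := fun t ht => by
    gcongr
    exacts [ht.1, ht.2]
  -- the extension of a function on `[0, τ]`, and the fixed point map
  let E : C(Icc 0 τ, X) → ℝ → X := fun v t => v (projIcc 0 τ hτ0 t)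
  have hE : ∀ v, Continuous (E v) := fun v => v.continuous.comp continuous_projIcc
  have hgE : ∀ v, ContinuousOn (fun t => G s t (E v t)) (Icc 0 τ) := fun v =>
    hG.continuousOn_comp hsub s (hE v).continuousOn
  let Z : C(Icc 0 τ, X) → ℝ → X := fun v t =>
    T t x + ∫ r in 0..t, K (t - r) (G s r (E v r))
  have hZ : ∀ v, ContinuousOn (Z v) (Icc 0 τ) := fun v => by
    obtain ⟨N₁, hN₁⟩ := isCompact_Icc.exists_bound_of_continuousOn (hgE v)
    exact ((h.isC0Semigroup.continuousOn x).mono hsub).add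
      (h.continuousOn_integral ((hgE v).mono Ico_subset_Icc_self)
        fun r hr => hN₁ r (Ico_subset_Icc_self hr))
  let Φ : C(Icc 0 τ, X) → C(Icc 0 τ, X) := fun v =>
    ⟨(Icc 0 τ).domRestrict (Z v), (hZ v).domRestrict⟩
  let B : Set C(Icc 0 τ, X) := Metric.closedBall (ContinuousMap.const _ x) r
  have hB : ∀ v ∈ B, ∀ t, E v t ∈ Metric.closedBall x r := fun v hv t =>
    (ContinuousMap.dist_apply_le_dist (f := v) (g := ContinuousMap.const _ x)
      (projIcc 0 τ hτ0 t)).trans (Metric.mem_closedBall.1 hv)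
  have hmaps : MapsTo Φ B B := by
    intro v hv
    refine Metric.mem_closedBall.2 ((ContinuousMap.dist_le hr0.le).2 fun t => ?_)
    change dist (Z v t) x ≤ r
    have e1 := h.norm_integral_le_const hC (a := 0) (t := t) (N := N) t.2.1
      (by linarith [(hI1 t t.2).2]) (f := fun r => G s r (E v r))
      fun r hr => hNr r ⟨hr.1, hr.2.le.trans (hI1 t t.2).2⟩ _ (hB v hv r)
    rw [sub_zero] at e1
    have hN0 : 0 ≤ C * N := by positivity
    have e2 := e1.trans (mul_le_mul_of_nonneg_left (hpow t t.2) hN0)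
    rw [dist_eq_norm]
    calc ‖Z v t - x‖ = ‖(T t x - x) + ∫ r in 0..(t : ℝ), K (t - r) (G s r (E v r))‖ := by
          congr 1
          simp only [Z]
          abel
      _ ≤ r / 2 + r / 2 := (norm_add_le _ _).trans
          (add_le_add (hτT t t.2) (e2.trans hτN))
      _ = r := by ring
  have hcontr : ContractingWith (1 / 2) (hmaps.restrict Φ B B) := by
    refine ⟨by rw [← NNReal.coe_lt_coe]; norm_num, LipschitzWith.of_dist_le_mul ?_⟩
    rintro ⟨v, hv⟩ ⟨w, hw⟩
    change dist (Φ v) (Φ w) ≤ _ * dist v w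
    refine (ContinuousMap.dist_le (by positivity)).2 fun t => ?_
    change dist (Z v t) (Z w t) ≤ _
    have hs : Ico 0 (t : ℝ) ⊆ Icc 0 τ := fun r hr => ⟨hr.1, hr.2.le.trans t.2.2⟩
    have i : ∀ v ∈ B, IntervalIntegrable (fun r => K (t - r) (G s r (E v r))) volume 0 t :=
      fun v hv => h.intervalIntegrable t.2.1 ((hgE v).mono hs)
        fun r hr => hNr r (hI1 r (hs hr)) _ (hB v hv r)
    have e1 := h.norm_integral_le_const hC (a := 0) (t := t) (N := L * dist v w) t.2.1
      (by linarith [(hI1 t t.2).2]) (f := fun r => G s r (E v r) - G s r (E w r))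
      fun r hr => (hL r hr.1 _ (hB v hv r) _ (hB w hw r)).trans (by
        gcongr
        rw [← dist_eq_norm]
        exact ContinuousMap.dist_apply_le_dist _)
    rw [sub_zero] at e1
    simp only [map_sub] at e1
    rw [intervalIntegral.integral_sub (i v hv) (i w hw)] at e1
    rw [dist_eq_norm]
    simp only [Z, add_sub_add_left_eq_sub]
    refine e1.trans ?_
    have e2 : C * L * (t ^ (1 - α) / (1 - α)) ≤ 1 / 2 :=
      (mul_le_mul_of_nonneg_left (hpow t t.2) (mul_nonneg hC0 hL0)).trans hτL
    calc C * (L * dist v w) * ((t : ℝ) ^ (1 - α) / (1 - α)) =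
          C * L * ((t : ℝ) ^ (1 - α) / (1 - α)) * dist v w := by ring
      _ ≤ 1 / 2 * dist v w := by gcongr
      _ = _ := by simp
  obtain ⟨v, -, hfix, -⟩ := hcontr.exists_fixedPoint' Metric.isClosed_closedBall.isComplete hmaps
    (Metric.mem_closedBall_self hr0.le) (edist_ne_top _ _)
  refine ⟨τ, hτ.1, E v, (hE v).continuousOn, fun t ht => ?_⟩
  have e1 : E v t = v ⟨t, ht⟩ := by simp only [E, projIcc_of_mem hτ0 ht]
  rw [e1]
  conv_lhs => rw [← hfix.eq]
  rfl

/-- A solution can be continued beyond its final time, by a solution of the equation restarted at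
that time. -/
theorem exists_extension {s : S} {x : X} {τ : ℝ} (hτ : 0 ≤ τ) {v : ℝ → X}
    (hv : IsVolterraSolution T K (G s) x τ v) :
    ∃ e > 0, ∃ w, IsVolterraSolution T K (G s) x (τ + e) w := by
  obtain ⟨e, he, w, hw⟩ := h.exists_local_solution (hG.comp_add hτ) s (v τ)
  have hw0 : w 0 = v τ := by
    rw [hw.eq 0 ⟨le_rfl, he.le⟩, h.isC0Semigroup.zero, intervalIntegral.integral_same, add_zero]
    rfl
  set z : ℝ → X := fun t => if t ≤ τ then v t else w (t - τ) with hz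
  have hzv : ∀ t ≤ τ, z t = v t := fun t ht => if_pos ht
  have hzw : ∀ t, τ ≤ t → z t = w (t - τ) := fun t ht => by
    rcases ht.eq_or_lt with rfl | hlt
    · rw [hzv _ le_rfl, sub_self, hw0]
    · exact if_neg (not_le.2 hlt)
  have hzc : ContinuousOn z (Icc 0 (τ + e)) := by
    rw [← Icc_union_Icc_eq_Icc hτ (by linarith : τ ≤ τ + e)]
    refine ContinuousOn.union_of_isClosed
      (hv.continuousOn.congr fun t ht => hzv t ht.2) ?_ isClosed_Icc isClosed_Icc
    refine ContinuousOn.congr (hw.continuousOn.comp (f := fun t => t - τ) (by fun_prop)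
      fun t ht => ⟨sub_nonneg.2 ht.1, by linarith [ht.2]⟩) fun t ht => hzw t ht.1
  refine ⟨e, he, z, hzc, fun t ht => ?_⟩
  have hcongr : ∀ t ∈ Icc 0 τ, ∫ r in 0..t, K (t - r) (G s r (z r)) =
      ∫ r in 0..t, K (t - r) (G s r (v r)) := by
    intro t ht
    refine intervalIntegral.integral_congr fun r hr => ?_
    rw [uIcc_of_le ht.1] at hr
    rw [hzv r (hr.2.trans ht.2)]
  rcases le_or_gt t τ with hle | hlt
  · rw [hzv t hle, hv.eq t ⟨ht.1, hle⟩, hcongr t ⟨ht.1, hle⟩]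
  · have hsub : Icc 0 t ⊆ Ici 0 := fun r hr => mem_Ici.2 hr.1
    rw [h.restart hτ hlt (hG.continuousOn_comp hsub s (hzc.mono (Icc_subset_Icc_right ht.2))),
      hcongr τ ⟨hτ, le_rfl⟩, ← hv.eq τ ⟨hτ, le_rfl⟩, hzw t hlt.le,
      hw.eq (t - τ) ⟨sub_nonneg.2 hlt.le, by linarith [ht.2]⟩]
    congr 1
    have e1 := intervalIntegral.integral_comp_add_left (a := 0) (b := t - τ)
      (fun r => K (t - r) (G s r (z r))) τ
    rw [add_zero, add_sub_cancel] at e1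
    rw [← e1]
    refine intervalIntegral.integral_congr fun r hr => ?_
    rw [uIcc_of_le (sub_nonneg.2 hlt.le)] at hr
    rw [hzw _ (le_add_of_nonneg_right hr.1), add_sub_cancel_left, sub_sub]

/-- The times up to which a solution exists form a closed set by the a priori bound, and an open one
by local existence. -/
theorem exists_solution (s : S) (x : X) {τ : ℝ} (hτ : 0 ≤ τ) :
    ∃ v, IsVolterraSolution T K (G s) x τ v := by
  set J : Set ℝ := {τ | ∃ v, IsVolterraSolution T K (G s) x τ v} with hJ
  have hdown : ∀ {a b : ℝ}, a ≤ b → b ∈ J → a ∈ J := fun hab ⟨v, hv⟩ => ⟨v, hv.mono hab⟩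
  refine IsClosed.Icc_subset_of_forall_exists_gt (s := J) (a := 0) (b := τ) ?_ ?_ ?_ ⟨hτ, le_rfl⟩
  · refine isClosed_of_closure_subset fun t ht => ?_
    have htI : t ∈ Icc 0 τ := closure_minimal inter_subset_right isClosed_Icc ht
    refine ⟨h.exists_solution_of_Ico hG fun t' ht' => ?_, htI⟩
    obtain ⟨b, hb, hbt⟩ := mem_closure_iff.1 ht (Ioi t') isOpen_Ioi ht'.2
    exact hdown (le_of_lt hb) hbt.1
  · obtain ⟨e, he, v, hv⟩ := h.exists_local_solution hG s x
    exact ⟨v, hv.mono he.le⟩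
  · rintro a ⟨⟨v, hv⟩, ha⟩ y hy
    obtain ⟨e, he, w, hw⟩ := h.exists_extension hG ha.1 hv
    exact ⟨min (a + e) y, hdown (min_le_left _ _) ⟨w, hw⟩,
      lt_min (by linarith) (mem_Ioi.1 hy), min_le_right _ _⟩

theorem exists_global_solution (s : S) (x : X) :
    ∃ v, ∀ τ, IsVolterraSolution T K (G s) x τ v := by
  have hex : ∀ τ, ∃ v, 0 ≤ τ → IsVolterraSolution T K (G s) x τ v := fun τ => by
    rcases le_or_gt 0 τ with h0 | h0
    · obtain ⟨v, hv⟩ := h.exists_solution hG s x h0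
      exact ⟨v, fun _ => hv⟩
    · exact ⟨0, fun h1 => absurd h1 (not_le.2 h0)⟩
  choose w hw using hex
  have huw : ∀ τ, EqOn (fun t => w t t) (w τ) (Icc 0 τ) := fun τ t ht =>
    h.solution_unique hG (hw t ht.1) ((hw τ (ht.1.trans ht.2)).mono ht.2) ⟨ht.1, le_rfl⟩
  refine ⟨fun t => w t t, fun τ => ?_⟩
  rcases lt_or_ge τ 0 with h0 | h0
  · refine ⟨?_, ?_⟩ <;> simp [Icc_eq_empty (not_le.2 h0)]
  · refine ⟨(hw τ h0).continuousOn.congr (huw τ), fun t ht => ?_⟩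
    refine (huw τ ht).trans (((hw τ h0).eq t ht).trans ?_)
    congr 1
    refine intervalIntegral.integral_congr fun r hr => ?_
    rw [uIcc_of_le ht.1] at hr
    have e : w r r = w τ r := huw τ ⟨hr.1, hr.2.trans ht.2⟩
    rw [e]

end IsSmoothingPair

end Volterra

/-! ### The linear part and the fractional power space -/

section LinearPart

variable {X : Type*} [NormedAddCommGroup X] [NormedSpace ℝ X]

/-- Applying `P = B ^ (-α)` turns the mild formulation, which lives in `X`, into the Volterra
equation for `v = B ^ α u`. -/
theorem IsSmoothingPair.mild_iff [CompleteSpace X] {α : ℝ} {T K : ℝ → X →L[ℝ] X}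
    (h : IsSmoothingPair α T K) {P : X →L[ℝ] X} (hP : Function.Injective P)
    (hPK : ∀ t, 0 < t → P * K t = T t) (hPT : ∀ t, 0 ≤ t → P * T t = T t * P) {v f : ℝ → X}
    (hf : ContinuousOn f (Ici 0)) :
    (∀ t ∈ Ici (0 : ℝ), ∀ t' ∈ Ici (0 : ℝ), t' < t →
      P (v t) = T (t - t') (P (v t')) + ∫ r in t'..t, T (t - r) (f r)) ↔
    ∀ t ∈ Ici (0 : ℝ), v t = T t (v 0) + ∫ r in 0..t, K (t - r) (f r) := by
  have hint : ∀ t' t, 0 ≤ t' → t' < t →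
      ∫ r in t'..t, T (t - r) (f r) = P (∫ r in t'..t, K (t - r) (f r)) := by
    intro t' t ht' htt
    have hsub : Icc t' t ⊆ Ici 0 := fun r hr => mem_Ici.2 (ht'.trans hr.1)
    obtain ⟨N, hN⟩ := isCompact_Icc.exists_bound_of_continuousOn (hf.mono hsub)
    have i := h.intervalIntegrable htt.le (hf.mono (Ico_subset_Icc_self.trans hsub))
      fun r hr => hN r (Ico_subset_Icc_self hr)
    rw [← ContinuousLinearMap.intervalIntegral_comp_comm _ i]
    refine intervalIntegral.integral_congr_ae ?_
    filter_upwards [Measure.ae_ne volume t] with r hr hrt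
    rw [uIoc_of_le htt.le] at hrt
    rw [← hPK _ (sub_pos.2 (lt_of_le_of_ne hrt.2 hr))]
    rfl
  have hPT' : ∀ t, 0 ≤ t → ∀ x, P (T t x) = T t (P x) := fun t ht x =>
    congrArg (fun f : X →L[ℝ] X => f x) (hPT t ht)
  constructor
  · intro hm t ht
    rcases (mem_Ici.1 ht).eq_or_lt with rfl | h0
    · rw [intervalIntegral.integral_same, h.isC0Semigroup.zero, add_zero]
      rfl
    · refine hP ?_
      rw [hm t ht 0 (mem_Ici.2 le_rfl) h0, sub_zero, hint 0 t le_rfl h0, map_add, hPT' t h0.le]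
  · intro hv t ht t' ht' htt
    have hsub : Icc 0 t ⊆ Ici 0 := fun r hr => mem_Ici.2 hr.1
    rw [hv t ht, h.restart (mem_Ici.1 ht') htt (hf.mono hsub), ← hv t' ht', map_add,
      hPT' _ (sub_nonneg.2 htt.le), hint t' t ht' htt]

/-- The linear part of the problem: for a sectorial operator with compact resolvents, the semigroup
generated by `-A + lam I` is compact, and composition with `(A + δ I) ^ α` costs a factor
`t ^ (-α)`. -/
theorem exists_isSmoothingPair [CompleteSpace X] {A : X →ₗ.[ℝ] X} (hA : IsSectorial A)
    (hAc : HasCompactResolvents A) {δ : ℝ} (hδ : IsPositivelyDefined (shift A δ)) {α : ℝ}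
    (hα : α ∈ Ioo (0 : ℝ) 1) (lam : ℝ) :
    ∃ T K : ℝ → X →L[ℝ] X, IsSmoothingPair α T K ∧
      Function.Injective (fracNegPow (shift A δ) α) ∧
      (∀ t, 0 < t → fracNegPow (shift A δ) α * K t = T t) ∧
      (∀ t, 0 ≤ t → fracNegPow (shift A δ) α * T t = T t * fracNegPow (shift A δ) α) ∧
      ∀ t, 0 ≤ t → T t = Real.exp (lam * t) • semigroup A t := by
  obtain ⟨ω, hω, M, hM⟩ := exists_hasHalfPlaneBound hA hδ
  obtain ⟨ρ, C, s, s', hρ, hρc, h⟩ := hM.exists_isHolomorphicSemigroup hA.2.1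
  have hcomp := hρc (hAc.shift _)
  set L := shift A (δ - ω) with hL
  have hLδ : shift A δ = shift L ω := by rw [hL, shift_shift, sub_add_cancel]
  have hLA : A = shift L (ω - δ) := by
    rw [hL, shift_shift, sub_add_sub_cancel, sub_self, shift_zero]
  have hP : fracNegPow (shift A δ) α = negPow (damped ω s) α := by
    rw [fracNegPow, negPow, hLδ]
    congr 1
    refine setIntegral_congr_fun measurableSet_Ioi fun t ht => ?_
    rw [h.semigroup_shift hρ ω (le_of_lt ht), extendOne_of_pos ht]
    rfl
  set κ := lam + δ with hκ
  set T : ℝ → X →L[ℝ] X := fun t => Real.exp (-((ω - κ) * t)) • extendOne s t with hT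
  set K : ℝ → X →L[ℝ] X := fun t => Real.exp (κ * t) • fracKernel α ω s s' t with hK
  have hTd : ∀ t, 0 < t → T t = Real.exp (κ * t) • damped ω s t := fun t ht => by
    simp only [hT, damped, extendOne_of_pos ht, smul_smul, ← Real.exp_add]
    ring_nf
  rw [hP]
  refine ⟨T, K, ⟨hα, h.isC0Semigroup.exp_smul _, fun t ht => ?_, ?_, fun t r ht hr => ?_,
    fun τ => ?_⟩, h.negPow_injective hω hα, fun t ht => ?_, fun t ht => ?_, fun t ht => ?_⟩
  · have e1 : IsCompactOperator (s t) := by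
      rw [h.eq_mul t ht]
      exact hcomp.comp_clm _
    simp only [hT, extendOne_of_pos ht]
    exact e1.smul _
  · exact ContinuousOn.fun_smul (by fun_prop) h.continuousOn_fracKernel
  · simp only [hK]
    rw [h.fracKernel_add hω hα ht hr, hTd t ht, smul_mul_smul_comm, ← Real.exp_add, mul_add]
  · obtain ⟨c, hc, hcb⟩ := h.exists_norm_fracKernel_le hω hα
    refine ⟨Real.exp (|κ| * τ) * c, by positivity, fun t ht => ?_⟩
    simp only [hK]
    rw [norm_smul, Real.norm_of_nonneg (Real.exp_pos _).le, mul_assoc]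
    have e1 : κ * t ≤ |κ| * τ := mul_le_mul (le_abs_self κ) ht.2 ht.1.le (abs_nonneg κ)
    gcongr
    exact hcb t ht.1
  · simp only [hK]
    rw [mul_smul_comm, h.negPow_mul_fracKernel hω hα ht, hTd t ht]
  · rcases ht.eq_or_lt with rfl | h0
    · simp [hT, extendOne_zero]
    · rw [hTd t h0, mul_smul_comm, smul_mul_assoc, h.negPow_mul_damped hω hα.1 h0]
  · conv_rhs => rw [hLA]
    rw [h.semigroup_shift hρ _ ht, smul_smul, ← Real.exp_add]
    simp only [hT, hκ]
    ring_nf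

end LinearPart

section FractionalSpace

variable {X : Type*} [NormedAddCommGroup X] [NormedSpace ℝ X] {B : X →ₗ.[ℝ] X} {α : ℝ}

namespace FracSpace

theorem fracNegPow_pow (hB : Function.Injective (fracNegPow B α)) (x : FracSpace B α) :
    fracNegPow B α (pow x) = toX x := by
  set f : X →ₗ.[ℝ] X := (fracNegPow B α : X →ₗ[ℝ] X).toPMap ⊤ with hf
  have hker : f.toFun.ker = ⊥ := by
    rw [LinearMap.ker_eq_bot]
    intro y z hyz
    exact Subtype.ext (hB hyz)
  have hx : (x : (fracPow B α).domain).1 ∈ LinearMap.range f.toFun := by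
    rw [← LinearPMap.inverse_domain]
    exact x.2
  obtain ⟨y, hy⟩ := hx
  have h1 : pow x = (y : X) := LinearPMap.inverse_apply_eq hker (y := x) (x := y) hy
  rw [h1]
  exact hy

theorem exists_pow_eq (hB : Function.Injective (fracNegPow B α)) (w : X) :
    ∃ x : FracSpace B α, pow x = w := by
  set f : X →ₗ.[ℝ] X := (fracNegPow B α : X →ₗ[ℝ] X).toPMap ⊤ with hf
  have hx : fracNegPow B α w ∈ (fracPow B α).domain := by
    change _ ∈ f.inverse.domain
    rw [LinearPMap.inverse_domain]
    exact ⟨⟨w, trivial⟩, rfl⟩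
  exact ⟨⟨_, hx⟩, hB (fracNegPow_pow hB ⟨_, hx⟩)⟩

/-- `B ^ α` as an isometric isomorphism from `D(B ^ α)` onto `X`. -/
def powEquiv (hB : Function.Injective (fracNegPow B α)) : FracSpace B α ≃ₗᵢ[ℝ] X where
  __ := LinearEquiv.ofBijective (pow (B := B) (α := α))
    ⟨fun x y hxy => Subtype.ext (by
      have h1 := fracNegPow_pow hB x
      have hxy' : pow x = pow y := hxy
      rw [hxy', fracNegPow_pow hB y] at h1
      exact h1.symm), exists_pow_eq hB⟩
  norm_map' _ := rfl

theorem fracNegPow_powEquiv (hB : Function.Injective (fracNegPow B α)) (x : FracSpace B α) :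
    fracNegPow B α (powEquiv hB x) = toX x :=
  fracNegPow_pow hB x

end FracSpace

end FractionalSpace

/-! ### Mild solutions -/

section MildSolutions

variable {X : Type*} [NormedAddCommGroup X] [NormedSpace ℝ X]
  {A : X →ₗ.[ℝ] X} {δ α lam : ℝ} {F : ℝ → ℝ → FracSpace (shift A δ) α → X}

/-- The nonlinearity, transported to `X` by the isometry `(A + δ I) ^ α`. -/
def transported (F : ℝ → ℝ → FracSpace (shift A δ) α → X) (e : FracSpace (shift A δ) α ≃ₗᵢ[ℝ] X)
    (s : unitInterval) (t : ℝ) (y : X) : X :=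
  F s t (e.symm y)

theorem exists_isAdmissible_transported (e : FracSpace (shift A δ) α ≃ₗᵢ[ℝ] X)
    (hF : ContinuousOn (fun p : ℝ × ℝ × FracSpace (shift A δ) α => F p.1 p.2.1 p.2.2)
      (Icc 0 1 ×ˢ Ici 0 ×ˢ univ))
    (hF1 : LocallyLipschitzInSpace A F) (hF2 : HasLinearGrowth A F) :
    ∃ c, IsAdmissible (transported F e) c := by
  obtain ⟨c, hc, -, hgrowth⟩ := hF2
  refine ⟨c, ?_, fun x => ?_, fun s t ht y => ?_, hc⟩
  · exact hF.comp (f := fun p : unitInterval × ℝ × X => ((p.1 : ℝ), p.2.1, e.symm p.2.2))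
      (by fun_prop) fun p hp => ⟨p.1.2, hp, trivial⟩
  · obtain ⟨V, hV, L, -, hL⟩ := hF1 (e.symm x)
    refine ⟨e.symm ⁻¹' V, e.symm.continuous.continuousAt.preimage_mem_nhds hV, L,
      fun s t ht y hy z hz => (hL s s.2 _ hy _ hz t ht).trans_eq ?_⟩
    rw [← map_sub, e.symm.norm_map]
  · have := hgrowth s s.2 t ht (e.symm y)
    rwa [e.symm.norm_map] at this

variable [CompleteSpace X]

/-- Mild solutions in `X^α` are the solutions of the Volterra equation in `X`, read through the
isometry `(A + δ I) ^ α`. -/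
theorem isMildSolution_iff {T K : ℝ → X →L[ℝ] X} (h : IsSmoothingPair α T K)
    (hP : Function.Injective (fracNegPow (shift A δ) α))
    (hPK : ∀ t, 0 < t → fracNegPow (shift A δ) α * K t = T t)
    (hPT : ∀ t, 0 ≤ t → fracNegPow (shift A δ) α * T t = T t * fracNegPow (shift A δ) α)
    (hT : ∀ t, 0 ≤ t → T t = Real.exp (lam * t) • semigroup A t) {c : ℝ → ℝ}
    (hG : IsAdmissible (transported F (FracSpace.powEquiv hP)) c) (s : unitInterval)
    (u : ℝ → FracSpace (shift A δ) α) :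
    IsMildSolution A lam F s (Ici 0) u ↔ ∀ τ, IsVolterraSolution T K
      (transported F (FracSpace.powEquiv hP) s) (FracSpace.powEquiv hP (u 0)) τ
      (fun t => FracSpace.powEquiv hP (u t)) := by
  set e := FracSpace.powEquiv hP with he
  have hgu : ∀ r, transported F e s r (e (u r)) = F s r (u r) := fun r => by
    rw [transported, e.symm_apply_apply]
  have hcont : ContinuousOn u (Ici 0) ↔ ContinuousOn (fun t => e (u t)) (Ici 0) :=
    e.toHomeomorph.isInducing.continuousOn_iff
  have hcontI : ContinuousOn (fun t => e (u t)) (Ici 0) ↔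
      ∀ τ, ContinuousOn (fun t => e (u t)) (Icc 0 τ) := by
    refine ⟨fun h1 τ => h1.mono fun r hr => mem_Ici.2 hr.1, fun h1 t ht => ?_⟩
    refine (h1 (t + 1) t ⟨ht, by linarith⟩).mono_of_mem_nhdsWithin ?_
    filter_upwards [self_mem_nhdsWithin,
      nhdsWithin_le_nhds (Iio_mem_nhds (by linarith : t < t + 1))] with r hr hr'
    exact ⟨hr, le_of_lt hr'⟩
  have hmild : ContinuousOn u (Ici 0) → ((∀ t ∈ Ici (0 : ℝ), ∀ t' ∈ Ici (0 : ℝ), t' < t →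
      (u t).toX = Real.exp (lam * (t - t')) • semigroup A (t - t') (u t').toX +
        ∫ τ in t'..t, Real.exp (lam * (t - τ)) • semigroup A (t - τ) (F s τ (u τ))) ↔
      ∀ t ∈ Ici (0 : ℝ), e (u t) = T t (e (u 0)) +
        ∫ r in 0..t, K (t - r) (transported F e s r (e (u r)))) := by
    intro hu
    have hf : ContinuousOn (fun r => transported F e s r (e (u r))) (Ici 0) :=
      hG.continuousOn_comp Subset.rfl s (hcont.1 hu)
    rw [← h.mild_iff hP hPK hPT (v := fun t => e (u t)) hf]
    refine forall₂_congr fun t ht => forall₂_congr fun t' ht' => forall_congr' fun htt => ?_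
    have e1 : ∀ x, Real.exp (lam * (t - t')) • semigroup A (t - t') x = T (t - t') x := fun x => by
      rw [hT _ (sub_nonneg.2 htt.le)]; rfl
    have e2 : ∫ τ in t'..t, Real.exp (lam * (t - τ)) • semigroup A (t - τ) (F s τ (u τ)) =
        ∫ r in t'..t, T (t - r) (transported F e s r (e (u r))) := by
      refine intervalIntegral.integral_congr fun r hr => ?_
      rw [uIcc_of_le htt.le] at hr
      rw [hT _ (sub_nonneg.2 hr.2), hgu]
      rfl
    simp only [he]
    rw [FracSpace.fracNegPow_powEquiv hP, FracSpace.fracNegPow_powEquiv hP, e1, e2]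
  constructor
  · rintro ⟨hu, heq⟩ τ
    exact ⟨hcontI.1 (hcont.1 hu) τ, fun t ht => (hmild hu).1 heq t (mem_Ici.2 ht.1)⟩
  · intro hv
    have hu := hcont.2 (hcontI.2 fun τ => (hv τ).continuousOn)
    exact ⟨hu, (hmild hu).2 fun t ht => (hv t).eq t ⟨ht, le_rfl⟩⟩

end MildSolutions

end SemilinearEvolution

end

open SemilinearEvolution in
theorem mainTheorem11 {X : Type*} [NormedAddCommGroup X] [NormedSpace ℝ X] [CompleteSpace X]
    (A : X →ₗ.[ℝ] X) (hA : IsSectorial A) (hAc : HasCompactResolvents A)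
    (δ : ℝ) (hδ : IsPositivelyDefined (shift A δ))
    (α : ℝ) (hα : α ∈ Set.Ioo (0 : ℝ) 1) (lam : ℝ)
    (F : ℝ → ℝ → FracSpace (shift A δ) α → X)
    (hF : ContinuousOn (fun p : ℝ × ℝ × FracSpace (shift A δ) α => F p.1 p.2.1 p.2.2)
      (Set.Icc 0 1 ×ˢ Set.Ici 0 ×ˢ Set.univ))
    (hF1 : LocallyLipschitzInSpace A F) (hF2 : HasLinearGrowth A F) :
    (∀ s ∈ Set.Icc (0 : ℝ) 1, ∀ x : FracSpace (shift A δ) α,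
      (IsMildSolution A lam F s (Set.Ici 0) (mildSolution A lam F s x) ∧
        mildSolution A lam F s x 0 = x) ∧
      ∀ v : ℝ → FracSpace (shift A δ) α, IsMildSolution A lam F s (Set.Ici 0) v → v 0 = x →
        Set.EqOn v (mildSolution A lam F s x) (Set.Ici 0)) ∧
    ∀ t : ℝ, 0 < t →
      (∀ Ω : Set (FracSpace (shift A δ) α), Bornology.IsBounded Ω →
        IsCompact (closure {y : FracSpace (shift A δ) α |
          ∃ s ∈ Set.Icc (0 : ℝ) 1, ∃ x ∈ Ω, y = mildSolution A lam F s x t})) ∧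
      IsCompletelyContinuous (translationOperator A lam F t) := by
  obtain ⟨T, K, h, hP, hPK, hPT, hT⟩ := exists_isSmoothingPair hA hAc hδ hα lam
  set e := FracSpace.powEquiv hP with he
  obtain ⟨c, hG⟩ := exists_isAdmissible_transported e hF hF1 hF2
  have hiff := isMildSolution_iff h hP hPK hPT hT hG
  have hsol : ∀ (s : unitInterval) x, IsMildSolution A lam F s (Ici 0) (mildSolution A lam F s x) ∧
      mildSolution A lam F s x 0 = x := by
    intro s x
    obtain ⟨v, hv⟩ := h.exists_global_solution hG s (e x)
    have hv0 : v 0 = e x := by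
      rw [(hv 0).eq 0 ⟨le_rfl, le_rfl⟩, intervalIntegral.integral_same, h.isC0Semigroup.zero,
        add_zero]
      rfl
    have hex : ∃ u, IsMildSolution A lam F s (Ici 0) u ∧ u 0 = x := by
      refine ⟨fun t => e.symm (v t), (hiff s _).2 fun τ => ?_, ?_⟩
      · simp only [← he, e.apply_symm_apply, hv0]
        exact hv τ
      · exact (congrArg e.symm hv0).trans (e.symm_apply_apply x)
    have : mildSolution A lam F s x = hex.choose := dif_pos hex
    rw [this]
    exact hex.choose_spec
  have hvol : ∀ (s : unitInterval) x τ, IsVolterraSolution T K (transported F e s) (e x) τ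
      (fun t => e (mildSolution A lam F s x t)) := by
    intro s x τ
    have := (hiff s _).1 (hsol s x).1 τ
    rwa [(hsol s x).2] at this
  have hcompact : ∀ t : ℝ, 0 < t → ∀ Ω : Set (FracSpace (shift A δ) α), Bornology.IsBounded Ω →
      IsCompact (closure {y : FracSpace (shift A δ) α |
        ∃ s ∈ Set.Icc (0 : ℝ) 1, ∃ x ∈ Ω, y = mildSolution A lam F s x t}) := by
    intro t ht Ω hΩ
    obtain ⟨R, hR⟩ := hΩ.exists_norm_le
    refine ((h.isCompact_closure_values hG (R := R) ht).image
      e.symm.continuous).closure_of_subset ?_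
    rintro y ⟨s, hs, x, hx, rfl⟩
    refine ⟨e (mildSolution A lam F s x t), subset_closure ⟨⟨s, hs⟩, e x, _, ?_, hvol ⟨s, hs⟩ x t,
      rfl⟩, e.symm_apply_apply _⟩
    rw [e.norm_map]
    exact hR x hx
  refine ⟨fun s hs x => ⟨hsol ⟨s, hs⟩ x, fun v hv hv0 t ht => ?_⟩, fun t ht =>
    ⟨hcompact t ht, ?_, fun Ω hΩ => ?_⟩⟩
  · have h1 := (hiff ⟨s, hs⟩ v).1 hv t
    rw [hv0] at h1
    exact e.injective (h.solution_unique hG h1 (hvol ⟨s, hs⟩ x t) ⟨ht, le_rfl⟩)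
  · have h1 := h.continuous_solution hG (U := fun s y t => e (mildSolution A lam F s (e.symm y) t))
      ht.le fun s y => by
        have := hvol s (e.symm y) t
        rwa [e.apply_symm_apply] at this
    have h2 : Continuous fun p : unitInterval × FracSpace (shift A δ) α =>
        e.symm (e (mildSolution A lam F p.1 (e.symm (e p.2)) t)) :=
      e.symm.continuous.comp (h1.comp (continuous_fst.prodMk (e.continuous.comp continuous_snd)))
    simpa only [e.symm_apply_apply] using! h2
  · refine (hcompact t ht _ hΩ.image_snd).of_isClosed_subset isClosed_closure (closure_mono ?_)
    rintro _ ⟨p, hp, rfl⟩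
    exact ⟨p.1, p.1.2, p.2, mem_image_of_mem _ hp, rfl⟩
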